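/- Let $(\Omega,\Sigma,\mu)$ be a $\sigma$-finite measure space that is separable (there is a countable family of measurable sets approximating every measurable set of finite measure arbitrarily well in the metric $\mu(B\,\triangle\,C)$), let $X$ be a reflexive, separable complex Banach space, and let $1<p<\infty$. A bounded operator $S$ on $L^p(\Omega,X)$ is a multiplication operator if there is $M:\Omega\to\mathcal L(X)$ with $s\mapsto M(s)x$ Bochner measurable for all $x\in X$ and $(Sf)(s)=M(s)f(s)$ for almost every $s$, for all $f\in L^p(\Omega,X)$. A multiplication semigroup is a $C_0$-semigroup on $L^p(\Omega,X)$ consisting of multiplication operators. A $C_0$-semigroup $(T(t))_{t\ge 0}$ on a Banach space is almost weakly stable if there is a Lebesgue measurable set $M\subseteq[0,\infty)$ of density $1$, i.e. $\lim_{t\to\infty}|M\cap[0,t]|/t=1$, such that $T(t)\to 0$ in the weak operator topology as $t\to\infty$, $t\in M$. Let $(e^{t\mathcal A})_{t\ge 0}$ be a multiplication semigroup on $L^p(\Omega,X)$ that is bounded, i.e. $\sup_{t\ge0}\|e^{t\mathcal A}\|<\infty$. Then there is a corresponding family of pointwise semigroups: operators $A(s)$ on $X$ generating $C_0$-semigroups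 $(e^{tA(s)})_{t\ge0}$ for almost every $s\in\Omega$, such that for every $t\ge 0$ the operator $e^{t\mathcal A}$ is the multiplication operator induced by $s\mapsto e^{tA(s)}$. For any such family, put $N_\lambda=\{s\in\Omega : \lambda \text{ is an eigenvalue of } A(s)\}$ for $\lambda\in i\mathbb R$. Then: 1. If $(e^{tA(s)})_{t\ge0}$ is almost weakly stable for almost every $s\in\Omega$, then $(e^{t\mathcal A})_{t\ge 0}$ is almost weakly stable. 2. If $(e^{t\mathcal A})_{t\ge 0}$ is almost weakly stable, then $N_\lambda$ is a null set for every $\lambda\in i\mathbb R$. 3. The set $\bigcup_{\lambda\in i\mathbb R}N_\lambda$ is a null set if and only if $(e^{tA(s)})_{t\ge0}$ is almost weakly stable for almost every $s\in\Omega$. Here a (possibly non-measurable) set is called null if it is contained in a measurable set of measure zero. -/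

import Mathlib

open MeasureTheory Filter Topology Set
open scoped NNReal ENNReal

namespace MulSemigroup

section General

variable {E : Type*} [NormedAddCommGroup E] [NormedSpace ℂ E]

/-- A Banach space is reflexive if the canonical embedding into its bidual is onto. -/
def IsReflexive (E : Type*) [NormedAddCommGroup E] [NormedSpace ℂ E] : Prop :=
  Function.Surjective (NormedSpace.inclusionInDoubleDual ℂ E)

/-- A `C₀`-semigroup (strongly continuous one-parameter semigroup) of bounded operators. -/
structure IsC0Semigroup (T : ℝ≥0 → E →L[ℂ] E) : Prop where
  map_zero : T 0 = ContinuousLinearMap.id ℂ E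
  map_add : ∀ s t, T (s + t) = (T s).comp (T t)
  strong_cont : ∀ x, Continuous fun t => T t x

/-- `y` is the right derivative at `0` of the orbit `t ↦ T t x`. -/
def HasOrbitDeriv (T : ℝ≥0 → E →L[ℂ] E) (x y : E) : Prop :=
  Tendsto (fun h : ℝ≥0 => ((h : ℝ) : ℂ)⁻¹ • (T h x - x)) (𝓝[>] 0) (𝓝 y)

theorem HasOrbitDeriv.add {T : ℝ≥0 → E →L[ℂ] E} {x x' y y' : E}
    (h : HasOrbitDeriv T x y) (h' : HasOrbitDeriv T x' y') :
    HasOrbitDeriv T (x + x') (y + y') := by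
  refine (Tendsto.add h h').congr fun t => ?_
  rw [← smul_add, map_add]
  congr 1
  abel

theorem HasOrbitDeriv.smul {T : ℝ≥0 → E →L[ℂ] E} {x y : E} (c : ℂ)
    (h : HasOrbitDeriv T x y) : HasOrbitDeriv T (c • x) (c • y) := by
  refine (Tendsto.const_smul h c).congr fun t => ?_
  rw [map_smul, ← smul_sub, smul_comm]

theorem HasOrbitDeriv.unique {T : ℝ≥0 → E →L[ℂ] E} {x y y' : E}
    (h : HasOrbitDeriv T x y) (h' : HasOrbitDeriv T x y') : y = y' :=
  tendsto_nhds_unique h h'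

/-- The domain `D(A)` of the generator: all `x` whose orbit is differentiable at `0`. -/
def generatorDomain (T : ℝ≥0 → E →L[ℂ] E) : Submodule ℂ E where
  carrier := {x | ∃ y, HasOrbitDeriv T x y}
  add_mem' := fun ⟨_, h⟩ ⟨_, h'⟩ => ⟨_, h.add h'⟩
  zero_mem' := ⟨0, by simp [HasOrbitDeriv]⟩
  smul_mem' := fun c _ ⟨_, h⟩ => ⟨_, h.smul c⟩

/-- The (in general unbounded) generator `A x = lim_{h ↓ 0} h⁻¹ (T h x - x)` with domain
`generatorDomain T`. -/
noncomputable def generator (T : ℝ≥0 → E →L[ℂ] E) : E →ₗ.[ℂ] E where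
  domain := generatorDomain T
  toFun :=
    { toFun := fun x => x.2.choose
      map_add' := fun x y =>
        (x + y).2.choose_spec.unique (x.2.choose_spec.add y.2.choose_spec)
      map_smul' := fun c x =>
        (c • x).2.choose_spec.unique (x.2.choose_spec.smul c) }

/-- The point spectrum (set of eigenvalues) of an unbounded operator. -/
def pointSpectrum (A : E →ₗ.[ℂ] E) : Set ℂ :=
  {z | ∃ x : A.domain, (x : E) ≠ 0 ∧ A x = z • (x : E)}

/-- A set `M ⊆ [0, ∞)` of times has density one: it is Lebesgue measurable and
`|M ∩ [0, t]| / t → 1` as `t → ∞`. -/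
def HasDensityOne (M : Set ℝ) : Prop :=
  M ⊆ Ici 0 ∧ NullMeasurableSet M ∧
    Tendsto (fun t : ℝ => volume.real (M ∩ Icc 0 t) / t) atTop (𝓝 1)

/-- Almost weak stability: `T t → 0` in the weak operator topology as `t → ∞` within some
set of times of density one. -/
def IsAlmostWeaklyStable (T : ℝ≥0 → E →L[ℂ] E) : Prop :=
  ∃ M : Set ℝ, HasDensityOne M ∧
    Tendsto (fun t : ℝ => ContinuousLinearMapWOT.ofCLM (T t.toNNReal)) (atTop ⊓ 𝓟 M) (𝓝 0)

end General

section Multiplication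

variable {Ω : Type*} [MeasurableSpace Ω] {μ : Measure Ω}
  {X : Type*} [NormedAddCommGroup X] [NormedSpace ℂ X] {p : ℝ≥0∞} [Fact (1 ≤ p)]

/-- The bounded operator `S` on `L^p(Ω, X)` is the multiplication operator induced by
`M : Ω → 𝓛(X)`, where `s ↦ M s x` is Bochner measurable for every `x`, i.e.
`(S f)(s) = M s (f s)` for almost every `s`. -/
structure IsMultiplicationOperator (M : Ω → X →L[ℂ] X) (S : Lp X p μ →L[ℂ] Lp X p μ) : Prop where
  measurable : ∀ x, AEStronglyMeasurable (fun s => M s x) μ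
  apply_ae : ∀ f : Lp X p μ, S f =ᵐ[μ] fun s => M s (f s)

/-- A multiplication semigroup: a `C₀`-semigroup on `L^p(Ω, X)` consisting of multiplication
operators. -/
structure IsMultiplicationSemigroup (S : ℝ≥0 → Lp X p μ →L[ℂ] Lp X p μ) : Prop where
  isC0Semigroup : IsC0Semigroup S
  multiplication : ∀ t, ∃ M : Ω → X →L[ℂ] X, IsMultiplicationOperator M (S t)

/-- `T s t = e^{tA(s)}` is the family of pointwise semigroups of the multiplication semigroup
`S`: for almost every `s`, `T s` is a `C₀`-semigroup on `X` (its generator `generator (T s)` is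
the operator `A(s)`), and each `S t` is the multiplication operator induced by `s ↦ T s t`. -/
structure IsPointwiseSemigroups (S : ℝ≥0 → Lp X p μ →L[ℂ] Lp X p μ)
    (T : Ω → ℝ≥0 → X →L[ℂ] X) : Prop where
  isC0Semigroup : ∀ᵐ s ∂μ, IsC0Semigroup (T s)
  multiplication : ∀ t, IsMultiplicationOperator (fun s => T s t) (S t)

end Multiplication

end MulSemigroup

/-!
Almost weak stability of a bounded semigroup on a separable reflexive space is a spectral property: it
holds if and only if the generator has no eigenvalues on the imaginary axis
(`isAlmostWeaklyStable_iff_forall_notMem_pointSpectrum`). Applied to almost every fibre, this is the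
equivalence between the nullity of `⋃ N_λ` and the stability of almost all pointwise semigroups.

The nontrivial direction is a theorem of Jacobs and de Leeuw-Glicksberg type. If the absolute Cesàro
means of some coefficient `x' (Tⁿ x)` of a power bounded operator `T` do not tend to zero, then the form
`y ↦ lim ‖y (Tⁿ x)‖²` on the dual space, a limit of Cesàro means along an ultrafilter, is nonzero and
invariant under the adjoint of `T`. It is the square of the norm of `L y` for a compact operator `L` into
an `L²` space over a weakly compact ball (`exists_compact_cesaroLim_eq`), and the spectral theorem for
compact symmetric operators provides a finite-dimensional invariant subspace of the adjoint, hence a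
unimodular eigenvalue of the adjoint and of `T` (`exists_unimodular_eigenvector`). For `T = T(1)`, a
Fourier coefficient of the orbit of the eigenvector is an eigenvector of the generator
(`exists_eigenvector_of_eigenvector_one`). In the absence of eigenvalues the Cesàro means of all
coefficients thus tend to zero; summing up countably many coefficients into `weakGauge` and using Markov's
inequality gives a set of times of density one (`exists_hasDensityOne_tendsto`).

The pointwise semigroups are obtained at rational times from the given multiplication operators. Strong
continuity at `0` holds for integral means of orbits, with constants independent of the fibre, and these
means converge almost everywhere along a sequence (`ae_forall_nnrat_norm_sub_lt`).

Stability of almost all fibres passes to `L^p(Ω, X)` because the integral over `Ω` of the weak gauges of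
the fibres has vanishing Cesàro means, so it tends to zero along a set of times of density one, and because
a bounded sequence of functions supported in a set of finite measure that is weakly null at almost every
point is weakly null in `L^p(Ω, X)` (`tendsto_apply_of_forall_ae_tendsto`). The latter uses that a
functional on `L^p(Ω, X)` has a weak density with respect to the variation of its vector measure
(`exists_dual_density`). Conversely, an eigenvalue `λ` on a set of positive measure keeps some coefficient
of the fibres within `1/2` of `exp (λ t)` on a subset of positive measure, and integration over that subset
is a functional violating weak convergence (`measure_setOf_forall_norm_mul_sub_one_le`).
-/

namespace MulSemigroup

/-! ### Cesàro means and their limits along ultrafilters -/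

section Cesaro

variable {F : Type*} [NormedAddCommGroup F] [NormedSpace ℝ F]

/-- The Cesàro mean of the first `N` terms of a sequence (equal to `0` for `N = 0`). -/
noncomputable def cesaro (a : ℕ → F) (N : ℕ) : F :=
  (N : ℝ)⁻¹ • ∑ n ∈ Finset.range N, a n

theorem cesaro_add (a b : ℕ → F) (N : ℕ) :
    cesaro (fun n => a n + b n) N = cesaro a N + cesaro b N := by
  simp [cesaro, Finset.sum_add_distrib]

theorem cesaro_smul {𝕜 : Type*} [NormedField 𝕜] [NormedSpace 𝕜 F] [SMulCommClass ℝ 𝕜 F]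
    (c : 𝕜) (a : ℕ → F) (N : ℕ) : cesaro (fun n => c • a n) N = c • cesaro a N := by
  rw [cesaro, cesaro, ← Finset.smul_sum, smul_comm]

theorem norm_cesaro_le {a : ℕ → F} {C : ℝ} (h : ∀ n, ‖a n‖ ≤ C) (N : ℕ) : ‖cesaro a N‖ ≤ C := by
  have hC : 0 ≤ C := (norm_nonneg _).trans (h 0)
  rcases N.eq_zero_or_pos with rfl | hN
  · simpa [cesaro] using hC
  have hN' : (0 : ℝ) < N := by exact_mod_cast hN
  rw [cesaro, norm_smul, norm_inv, Real.norm_natCast, inv_mul_le_iff₀ hN']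
  refine (norm_sum_le _ _).trans ((Finset.sum_le_sum fun n _ => h n).trans ?_)
  simp

theorem cesaro_mono {a b : ℕ → ℝ} (h : ∀ n, a n ≤ b n) (N : ℕ) : cesaro a N ≤ cesaro b N := by
  simp only [cesaro, smul_eq_mul]
  gcongr
  exact h _

theorem cesaro_nonneg {a : ℕ → ℝ} (h : ∀ n, 0 ≤ a n) (N : ℕ) : 0 ≤ cesaro a N := by
  simp only [cesaro, smul_eq_mul]
  have := Finset.sum_nonneg fun n (_ : n ∈ Finset.range N) => h n
  positivity

theorem cesaro_const {N : ℕ} (hN : N ≠ 0) (c : F) : cesaro (fun _ => c) N = c := by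
  have : (N : ℝ) ≠ 0 := by exact_mod_cast hN
  simp [cesaro, ← Nat.cast_smul_eq_nsmul ℝ, smul_smul, this]

theorem cesaro_succ_sub (a : ℕ → F) (N : ℕ) :
    cesaro (fun n => a (n + 1)) N - cesaro a N = (N : ℝ)⁻¹ • (a N - a 0) := by
  rw [cesaro, cesaro, ← smul_sub, ← Finset.sum_sub_distrib, Finset.sum_range_sub]

variable (𝒰 : Ultrafilter ℕ)

/-- The limit of the Cesàro means of a sequence along an ultrafilter. It is meaningful for bounded
sequences in proper spaces, where it is a shift invariant positive mean. -/
noncomputable def cesaroLim (a : ℕ → F) : F := limUnder (𝒰 : Filter ℕ) (cesaro a)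

variable {𝒰}

theorem cesaroLim_eq {a : ℕ → F} {x : F} (h : Tendsto (cesaro a) 𝒰 (𝓝 x)) :
    cesaroLim 𝒰 a = x := h.limUnder_eq

theorem cesaroLim_const (h𝒰 : (𝒰 : Filter ℕ) ≤ atTop) (c : F) : cesaroLim 𝒰 (fun _ => c) = c := by
  refine cesaroLim_eq (tendsto_const_nhds.congr' ?_)
  filter_upwards [h𝒰 (eventually_ne_atTop 0)] with N hN using (cesaro_const hN c).symm

variable [ProperSpace F]

theorem tendsto_cesaroLim {a : ℕ → F} {C : ℝ} (h : ∀ n, ‖a n‖ ≤ C) :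
    Tendsto (cesaro a) 𝒰 (𝓝 (cesaroLim 𝒰 a)) := by
  obtain ⟨x, -, hx⟩ := (isCompact_closedBall (0 : F) C).ultrafilter_le_nhds (𝒰.map (cesaro a))
    (by
      rw [le_principal_iff, Ultrafilter.mem_coe, Ultrafilter.mem_map]
      filter_upwards with N using by simpa using norm_cesaro_le h N)
  exact tendsto_nhds_limUnder ⟨x, hx⟩

theorem cesaroLim_add {a b : ℕ → F} {C D : ℝ} (ha : ∀ n, ‖a n‖ ≤ C) (hb : ∀ n, ‖b n‖ ≤ D) :
    cesaroLim 𝒰 (fun n => a n + b n) = cesaroLim 𝒰 a + cesaroLim 𝒰 b :=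
  cesaroLim_eq (((tendsto_cesaroLim ha).add (tendsto_cesaroLim hb)).congr
    fun N => (cesaro_add a b N).symm)

theorem cesaroLim_smul {𝕜 : Type*} [NormedField 𝕜] [NormedSpace 𝕜 F] [SMulCommClass ℝ 𝕜 F]
    (c : 𝕜) {a : ℕ → F} {C : ℝ} (ha : ∀ n, ‖a n‖ ≤ C) :
    cesaroLim 𝒰 (fun n => c • a n) = c • cesaroLim 𝒰 a :=
  cesaroLim_eq (((tendsto_cesaroLim ha).const_smul c).congr fun N => (cesaro_smul c a N).symm)

theorem norm_cesaroLim_le {a : ℕ → F} {C : ℝ} (ha : ∀ n, ‖a n‖ ≤ C) : ‖cesaroLim 𝒰 a‖ ≤ C :=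
  le_of_tendsto (tendsto_cesaroLim ha).norm (Eventually.of_forall (norm_cesaro_le ha))

theorem cesaroLim_nonneg {a : ℕ → ℝ} {C : ℝ} (ha : ∀ n, ‖a n‖ ≤ C) (h : ∀ n, 0 ≤ a n) :
    0 ≤ cesaroLim 𝒰 a :=
  ge_of_tendsto (tendsto_cesaroLim ha) (Eventually.of_forall (cesaro_nonneg h))

theorem cesaroLim_mono {a b : ℕ → ℝ} {C D : ℝ} (ha : ∀ n, ‖a n‖ ≤ C) (hb : ∀ n, ‖b n‖ ≤ D)
    (h : ∀ n, a n ≤ b n) : cesaroLim 𝒰 a ≤ cesaroLim 𝒰 b :=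
  le_of_tendsto_of_tendsto (tendsto_cesaroLim ha) (tendsto_cesaroLim hb)
    (Eventually.of_forall (cesaro_mono h))

theorem cesaroLim_succ (h𝒰 : (𝒰 : Filter ℕ) ≤ atTop) {a : ℕ → F} {C : ℝ} (ha : ∀ n, ‖a n‖ ≤ C) :
    cesaroLim 𝒰 (fun n => a (n + 1)) = cesaroLim 𝒰 a := by
  have h0 : Tendsto (fun N : ℕ => (N : ℝ)⁻¹ • (a N - a 0)) atTop (𝓝 0) := by
    refine NormedField.tendsto_zero_smul_of_tendsto_zero_of_bounded
      tendsto_inv_atTop_nhds_zero_nat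
      (isBoundedUnder_of ⟨C + C, fun N => (norm_sub_le _ _).trans (add_le_add (ha _) (ha _))⟩)
  have h1 := (tendsto_cesaroLim (𝒰 := 𝒰) ha).add (h0.mono_left h𝒰)
  rw [add_zero] at h1
  refine cesaroLim_eq (h1.congr fun N => ?_)
  rw [← cesaro_succ_sub]; abel

theorem cesaroLim_map {F' : Type*} [NormedAddCommGroup F'] [NormedSpace ℝ F'] (f : F →L[ℝ] F')
    {a : ℕ → F} {C : ℝ} (ha : ∀ n, ‖a n‖ ≤ C) :
    cesaroLim 𝒰 (fun n => f (a n)) = f (cesaroLim 𝒰 a) :=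
  cesaroLim_eq (((f.continuous.tendsto _).comp (tendsto_cesaroLim ha)).congr fun N => by
    simp [cesaro])

theorem cesaroLim_sum {ι : Type*} (s : Finset ι) {a : ι → ℕ → F} {C : ι → ℝ}
    (ha : ∀ i n, ‖a i n‖ ≤ C i) :
    cesaroLim 𝒰 (fun n => ∑ i ∈ s, a i n) = ∑ i ∈ s, cesaroLim 𝒰 (a i) :=
  cesaroLim_eq ((tendsto_finsetSum s fun i _ => tendsto_cesaroLim (ha i)).congr fun N => by
    simp only [cesaro]
    rw [← Finset.smul_sum, Finset.sum_comm])

end Cesaro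

/-! ### Quadratic means of a bounded sequence as a compact operator -/

section Compact

open scoped CompactlySupported

universe u

variable {X : Type u} [NormedAddCommGroup X] [NormedSpace ℂ X]

/-- The quadratic form `y ↦ lim ‖y (v n)‖²` (Cesàro limit) attached to a bounded sequence `v` in a
separable reflexive space is induced by a *compact* operator into a Hilbert space. The Hilbert space
is `L²(ν)`, where `ν` is a limit of the empirical measures of `v` on a weakly compact ball, and
compactness follows from dominated convergence. -/
theorem exists_compact_cesaroLim_eq [TopologicalSpace.SeparableSpace X] (hX : IsReflexive X)
    {v : ℕ → X} {R : ℝ} (hv : ∀ n, ‖v n‖ ≤ R) (𝒰 : Ultrafilter ℕ) :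
    ∃ (H : Type u) (_ : NormedAddCommGroup H) (_ : InnerProductSpace ℂ H) (_ : CompleteSpace H)
      (L : StrongDual ℂ X →L[ℂ] H), IsCompactOperator L ∧
        ∀ y, ‖L y‖ ^ 2 = cesaroLim 𝒰 (fun n => ‖y (v n)‖ ^ 2) := by
  -- the ball of radius `R` in the bidual, compact for the weak-* topology; `ξ n` is the image of `v n`
  let B : Set (WeakDual ℂ (StrongDual ℂ X)) :=
    WeakDual.toStrongDual ⁻¹' Metric.closedBall 0 R
  have hBc : IsCompact B := WeakDual.isCompact_closedBall 0 R
  have : CompactSpace B := isCompact_iff_compactSpace.mp hBc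
  let : MeasurableSpace B := borel B
  have : BorelSpace B := ⟨rfl⟩
  let ξ : ℕ → B := fun n => ⟨StrongDual.toWeakDual (NormedSpace.inclusionInDoubleDual ℂ X (v n)),
    show NormedSpace.inclusionInDoubleDual ℂ X (v n) ∈ Metric.closedBall 0 R from
      (mem_closedBall_zero_iff (E := StrongDual ℂ (StrongDual ℂ X))).2
        ((NormedSpace.double_dual_bound ℂ X (v n)).trans (hv n))⟩
  have hbd : ∀ f : C(B, ℝ), ∀ n, ‖f (ξ n)‖ ≤ ‖f‖ := fun f n => f.norm_coe_le_norm _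
  -- the mean of a continuous function along `ξ` is a positive functional, hence a measure `ν`
  let Λ : C_c(B, ℝ) →ₚ[ℝ] ℝ := PositiveLinearMap.mk₀
    { toFun := fun f => cesaroLim 𝒰 (fun n => f (ξ n))
      map_add' := fun f g => cesaroLim_add (hbd f.toContinuousMap) (hbd g.toContinuousMap)
      map_smul' := fun c f => cesaroLim_smul c (hbd f.toContinuousMap) }
    (fun f hf => cesaroLim_nonneg (hbd f.toContinuousMap) fun n => hf _)
  let ν : Measure B := RealRMK.rieszMeasure Λ
  have hν : ∀ f : C(B, ℝ), ∫ b, f b ∂ν = cesaroLim 𝒰 (fun n => f (ξ n)) := fun f =>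
    RealRMK.integral_rieszMeasure Λ (CompactlySupportedContinuousMap.continuousMapEquiv f)
  have : IsFiniteMeasure ν := inferInstance
  -- functionals on `X` as continuous functions on `B`
  let ev : StrongDual ℂ X →ₗ[ℂ] C(B, ℂ) :=
    { toFun := fun y => ⟨fun b => (b : WeakDual ℂ (StrongDual ℂ X)) y,
        (WeakDual.eval_continuous y).comp continuous_subtype_val⟩
      map_add' := fun y z => by
        ext b
        exact map_add (WeakDual.toStrongDual (b : WeakDual ℂ (StrongDual ℂ X))) y z
      map_smul' := fun c y => by
        ext b
        exact map_smul (WeakDual.toStrongDual (b : WeakDual ℂ (StrongDual ℂ X))) c y }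
  have hev : ∀ y, ‖ev y‖ ≤ R * ‖y‖ := by
    intro y
    have hR : 0 ≤ R := (norm_nonneg _).trans (hv 0)
    rw [ContinuousMap.norm_le _ (by positivity)]
    intro b
    have hb : ‖WeakDual.toStrongDual (b : WeakDual ℂ (StrongDual ℂ X))‖ ≤ R :=
      (mem_closedBall_zero_iff (E := StrongDual ℂ (StrongDual ℂ X))).1 b.2
    exact (WeakDual.toStrongDual (b : WeakDual ℂ (StrongDual ℂ X))).le_of_opNorm_le hb y
  let L : StrongDual ℂ X →L[ℂ] Lp ℂ 2 ν :=
    (ContinuousMap.toLp 2 ν ℂ).comp (ev.mkContinuous R hev)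
  have hL : ∀ y, ‖L y‖ ^ 2 = ∫ b, ‖ev y b‖ ^ 2 ∂ν := by
    intro y
    rw [@norm_sq_eq_re_inner ℂ, L2.inner_def, ← integral_re (L2.integrable_inner _ _)]
    refine integral_congr_ae ?_
    filter_upwards [ContinuousMap.coeFn_toLp (p := 2) (𝕜 := ℂ) ν (ev y)] with b hb
    change RCLike.re (inner ℂ ((ContinuousMap.toLp 2 ν ℂ (ev y)) b) ((ContinuousMap.toLp 2 ν ℂ (ev y)) b)) = _
    rw [hb, ← @norm_sq_eq_re_inner ℂ]
  refine ⟨Lp ℂ 2 ν, inferInstance, inferInstance, inferInstance, L, ?_, fun y => ?_⟩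
  · refine (isCompactOperator_iff_exists_mem_nhds_isCompact_closure_image L).2
      ⟨Metric.closedBall 0 1, Metric.closedBall_mem_nhds _ one_pos, ?_⟩
    suffices h : IsSeqCompact (L '' Metric.closedBall 0 1) from h.isCompact.closure
    intro u hu
    choose y hy hyu using hu
    -- a weak-* convergent subsequence of functionals converges pointwise on `B`, because every point
    -- of `B` comes from `X` by reflexivity
    obtain ⟨z, hz, φ, hφ, hlim⟩ := WeakDual.isSeqCompact_closedBall ℂ X 0 1
      (x := fun n => StrongDual.toWeakDual (y n)) (fun n => hy n)
    refine ⟨L (WeakDual.toStrongDual z), ⟨_, hz, rfl⟩, φ, hφ, ?_⟩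
    have hpt : ∀ b : B, Tendsto (fun n => ‖ev (y (φ n) - WeakDual.toStrongDual z) b‖ ^ 2) atTop (𝓝 0) := by
      intro b
      obtain ⟨x, hx⟩ := hX (WeakDual.toStrongDual (b : WeakDual ℂ (StrongDual ℂ X)))
      have h1 : Tendsto (fun n => y (φ n) x - z x) atTop (𝓝 0) := by
        have := ((WeakDual.eval_continuous x).tendsto z).comp hlim
        exact tendsto_sub_nhds_zero_iff.2 this
      have h2 := (h1.norm.pow 2)
      simp only [norm_zero, ne_eq, OfNat.ofNat_ne_zero, not_false_eq_true, zero_pow] at h2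
      refine h2.congr fun n => ?_
      have : ev (y (φ n) - WeakDual.toStrongDual z) b
          = WeakDual.toStrongDual (b : WeakDual ℂ (StrongDual ℂ X)) (y (φ n) - WeakDual.toStrongDual z) := rfl
      rw [this, ← hx]
      rfl
    have hint : Tendsto (fun n => ‖L (y (φ n) - WeakDual.toStrongDual z)‖ ^ 2) atTop (𝓝 0) := by
      simp_rw [hL]
      have h0 : (0 : ℝ) = ∫ _ : B, 0 ∂ν := by simp
      rw [h0]
      have hR : 0 ≤ R := (norm_nonneg _).trans (hv 0)
      refine tendsto_integral_of_dominated_convergence (fun _ => (R * 2) ^ 2)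
        (fun n => (by fun_prop : Continuous _).aestronglyMeasurable) (integrable_const _) (fun n => ?_)
        (Eventually.of_forall hpt)
      refine Eventually.of_forall fun b => ?_
      rw [Real.norm_of_nonneg (by positivity)]
      gcongr
      refine ((ev _).norm_coe_le_norm b).trans ((hev _).trans ?_)
      gcongr
      have h1 : ‖y (φ n)‖ ≤ 1 := by simpa using hy (φ n)
      have h2 : ‖WeakDual.toStrongDual z‖ ≤ 1 := by simpa using hz
      linarith [norm_sub_le (y (φ n)) (WeakDual.toStrongDual z)]
    rw [tendsto_iff_norm_sub_tendsto_zero]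
    have h3 := (Real.continuous_sqrt.tendsto 0).comp hint
    simp only [Real.sqrt_zero] at h3
    refine h3.congr fun n => ?_
    simp [Real.sqrt_sq, ← hyu, map_sub]
  · rw [hL]
    exact hν ⟨fun b => ‖ev y b‖ ^ 2, by fun_prop⟩

end Compact

/-! ### Unimodular eigenvalues of power bounded operators -/

section Jacobs

variable {X : Type*} [NormedAddCommGroup X] [NormedSpace ℂ X]

/-- A sequence of constant nonzero norm in a relatively compact set is not orthogonal in mean to
every vector. -/
theorem exists_cesaroLim_inner_ne_zero {H : Type*} [NormedAddCommGroup H] [InnerProductSpace ℂ H]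
    {u : ℕ → H} {r : ℝ} (hr : 0 < r) (hu : ∀ n, ‖u n‖ = r) (hc : TotallyBounded (range u))
    {𝒰 : Ultrafilter ℕ} (h𝒰 : (𝒰 : Filter ℕ) ≤ atTop) :
    ∃ h : H, cesaroLim 𝒰 (fun n => ‖inner ℂ h (u n)‖ ^ 2) ≠ 0 := by
  by_contra! hcon
  obtain ⟨t, ht, htf, hcov⟩ := Metric.finite_approx_of_totallyBounded hc (r / 2) (by positivity)
  lift t to Finset H using htf
  have hbd : ∀ (h : H) (n : ℕ), ‖‖inner ℂ h (u n)‖ ^ 2‖ ≤ (‖h‖ * r) ^ 2 := by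
    intro h n
    rw [norm_pow, norm_norm]
    gcongr
    exact (norm_inner_le_norm _ _).trans (by rw [hu])
  have h0 : cesaroLim 𝒰 (fun n => ∑ h ∈ t, ‖inner ℂ h (u n)‖ ^ 2) = 0 := by
    rw [cesaroLim_sum t hbd, Finset.sum_eq_zero fun h _ => hcon h]
  -- a member of the `r / 2`-net close to `u n` has a large inner product with it
  have h1 : ∀ n, (r ^ 2 / 2) ^ 2 ≤ ∑ h ∈ t, ‖inner ℂ h (u n)‖ ^ 2 := by
    intro n
    obtain ⟨h, hht, hball⟩ := mem_iUnion₂.1 (hcov (mem_range_self n))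
    obtain ⟨m, rfl⟩ := ht hht
    refine le_trans ?_ (Finset.single_le_sum (f := fun h => ‖inner ℂ h (u n)‖ ^ 2)
      (fun _ _ => by positivity) hht)
    have h2 : inner ℂ (u m) (u n) = (r ^ 2 : ℂ) - inner ℂ (u m) (u m - u n) := by
      rw [inner_sub_right, inner_self_eq_norm_sq_to_K, hu]
      exact (sub_sub_cancel _ _).symm
    have h3 : ‖inner ℂ (u m) (u m - u n)‖ ≤ r * (r / 2) := by
      refine (norm_inner_le_norm _ _).trans ?_
      rw [hu]
      have : ‖u m - u n‖ < r / 2 := by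
        rw [← dist_eq_norm, dist_comm]; exact hball
      gcongr
    have h4 : r ^ 2 / 2 ≤ ‖inner ℂ (u m) (u n)‖ := by
      rw [h2]
      have := norm_sub_norm_le ((r : ℂ) ^ 2) (inner ℂ (u m) (u m - u n))
      rw [norm_pow, Complex.norm_real, Real.norm_of_nonneg hr.le] at this
      nlinarith
    gcongr
  have h2 : cesaroLim 𝒰 (fun _ => (r ^ 2 / 2) ^ 2) ≤ 0 := by
    rw [← h0]
    refine cesaroLim_mono (C := ‖(r ^ 2 / 2) ^ 2‖) (D := ∑ h ∈ t, (‖h‖ * r) ^ 2) (fun _ => le_rfl)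
      (fun n => ?_) h1
    exact (norm_sum_le _ _).trans (Finset.sum_le_sum fun h _ => hbd h n)
  rw [cesaroLim_const h𝒰] at h2
  have : 0 < (r ^ 2 / 2) ^ 2 := by positivity
  linarith

/-- An eigenvector of the adjoint of a power bounded operator on a reflexive space, for a unimodular
eigenvalue, yields an eigenvector of the operator: the weak mean of `c⁻ⁿ Tⁿ v`. -/
theorem exists_eigenvector_of_dual_eigenvector (hX : IsReflexive X) {T : X →L[ℂ] X} {K : ℝ}
    (hT : ∀ n, ‖T ^ n‖ ≤ K) {c : ℂ} (hc : ‖c‖ = 1) {y : StrongDual ℂ X} (hy : y ≠ 0)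
    (hTy : y.comp T = c • y) : ∃ w : X, w ≠ 0 ∧ T w = c • w := by
  obtain ⟨v, hv⟩ : ∃ v, y v ≠ 0 := by
    by_contra! h
    exact hy (ContinuousLinearMap.ext h)
  have hc0 : c ≠ 0 := by rintro rfl; simp at hc
  let 𝒰 : Ultrafilter ℕ := Ultrafilter.of atTop
  have h𝒰 : (𝒰 : Filter ℕ) ≤ atTop := Ultrafilter.of_le _
  have hbd : ∀ (z : StrongDual ℂ X) (n : ℕ), ‖(c⁻¹) ^ n * z ((T ^ n) v)‖ ≤ K * ‖v‖ * ‖z‖ := by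
    intro z n
    rw [norm_mul, norm_pow, norm_inv, hc, inv_one, one_pow, one_mul, mul_comm]
    exact z.le_of_opNorm_le_of_le le_rfl ((T ^ n).le_of_opNorm_le (hT n) v)
  -- the weak mean of `c⁻ⁿ Tⁿ v`, an element of the bidual
  let Ψ : StrongDual ℂ (StrongDual ℂ X) := LinearMap.mkContinuous
    { toFun := fun z => cesaroLim 𝒰 (fun n => (c⁻¹) ^ n * z ((T ^ n) v))
      map_add' := fun z z' => by
        simp only [add_apply, mul_add]
        exact cesaroLim_add (hbd z) (hbd z')
      map_smul' := fun a z => by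
        simp only [smul_apply, RingHom.id_apply]
        rw [← cesaroLim_smul a (hbd z)]
        congr 1 with n
        simp only [smul_eq_mul]; ring }
    (K * ‖v‖) (fun z => norm_cesaroLim_le (hbd z))
  obtain ⟨w, hw⟩ := hX Ψ
  have hw' : ∀ z : StrongDual ℂ X, z w = cesaroLim 𝒰 (fun n => (c⁻¹) ^ n * z ((T ^ n) v)) :=
    fun z => by rw [← NormedSpace.dual_def ℂ X w z, hw]; rfl
  have hyn : ∀ n, y ((T ^ n) v) = c ^ n * y v := by
    intro n
    induction n with
    | zero => simp
    | succ n ih =>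
      rw [pow_succ', mul_apply_eq_comp]
      have := DFunLike.congr_fun hTy ((T ^ n) v)
      simp only [ContinuousLinearMap.comp_apply, smul_apply, smul_eq_mul] at this
      rw [this, ih]; ring
  refine ⟨w, ?_, ?_⟩
  · rintro rfl
    have h1 := hw' y
    simp_rw [hyn, ← mul_assoc, ← mul_pow, inv_mul_cancel₀ hc0, one_pow, one_mul] at h1
    rw [cesaroLim_const h𝒰, map_zero] at h1
    exact hv h1.symm
  · refine (SeparatingDual.eq_iff_forall_dual_eq (R := ℂ)).2 fun z => ?_
    have h1 : z (T w) = (z.comp T) w := rfl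
    rw [h1, hw', map_smul, hw', ← cesaroLim_succ h𝒰 (hbd z), ← cesaroLim_smul c fun n => hbd z _]
    congr 1 with n
    simp only [ContinuousLinearMap.comp_apply, smul_eq_mul]
    rw [pow_succ c⁻¹, pow_succ' T, mul_apply_eq_comp]
    field_simp

theorem finiteDimensional_eigenspace_of_isCompactOperator {Y : Type*} [NormedAddCommGroup Y]
    [NormedSpace ℂ Y] {P : Y →L[ℂ] Y} (hP : IsCompactOperator P) {a : ℂ} (ha : a ≠ 0) :
    FiniteDimensional ℂ (Module.End.eigenspace P.toLinearMap a) := by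
  have hcl : IsClosed (Module.End.eigenspace P.toLinearMap a : Set Y) := by
    have : (Module.End.eigenspace P.toLinearMap a : Set Y) = {y | P y = a • y} :=
      Set.ext fun y => Module.End.mem_eigenspace_iff
    rw [this]
    exact isClosed_eq P.continuous (continuous_const_smul a)
  have h := IsCompactOperator.restrict (f := P.toLinearMap) hP (V := Module.End.eigenspace P.toLinearMap a)
    ((Module.End.mem_invtSubmodule_iff_forall_mem_of_mem _).mp
      (Module.End.eigenspace_mem_invtSubmodule P.toLinearMap a)) hcl
  rw [Module.End.restrict_eigenspace, LinearMap.coe_smul, IsCompactOperator.smul_iff₀ ha] at h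
  exact (isCompactOperator_id_iff_finiteDimensional (𝕜 := ℂ)).1 h

/-- Let `L : Y → H` be compact with values in a Hilbert space, and let `A` be an endomorphism of `Y`
that preserves `‖L ·‖`. If `G : H → Y` is such that `L ∘ G` is symmetric and nonzero, and `A` commutes
with `G ∘ L`, then `A` has a unimodular eigenvalue: `L ∘ G` has an eigenvalue `a ≠ 0`, and `A` acts on
the nonzero finite-dimensional space `ker (G ∘ L - a)`. -/
theorem exists_unimodular_eigenvector_of_isCompactOperator {Y H : Type*} [NormedAddCommGroup Y]
    [NormedSpace ℂ Y] [CompleteSpace Y] [NormedAddCommGroup H] [InnerProductSpace ℂ H]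
    [CompleteSpace H] {L : Y →L[ℂ] H} (hL : IsCompactOperator L) {G : H →L[ℂ] Y}
    (hD : (L.comp G).IsSymmetric) (hD0 : L.comp G ≠ 0) {A : Module.End ℂ Y}
    (hiso : ∀ y, ‖L (A y)‖ = ‖L y‖) (hcomm : ∀ y, G (L (A y)) = A (G (L y))) :
    ∃ c : ℂ, ‖c‖ = 1 ∧ ∃ y, y ≠ 0 ∧ A y = c • y := by
  obtain ⟨a, ha, ha0⟩ : ∃ a, Module.End.HasEigenvalue (L.comp G : Module.End ℂ H) a ∧ a ≠ 0 := by
    by_contra! hcon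
    exact hD0 ((ContinuousLinearMap.eq_zero_of_forall_hasEigenvalue_eq_zero
      (hL.comp_clm G) hD).1 hcon)
  obtain ⟨k, hk⟩ := ha.exists_hasEigenvector
  have hk1 : L (G k) = a • k := hk.apply_eq_smul
  have hP : IsCompactOperator (G.comp L) := hL.clm_comp G
  have := finiteDimensional_eigenspace_of_isCompactOperator hP ha0
  let V : Submodule ℂ Y := Module.End.eigenspace (G.comp L).toLinearMap a
  have hV' : ∀ y, y ∈ V ↔ G (L y) = a • y := fun y => Module.End.mem_eigenspace_iff
  have hV : ∀ y ∈ V, A y ∈ V := by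
    intro y hy
    rw [hV'] at hy ⊢
    rw [hcomm, hy, map_smul]
  have : Nontrivial V := by
    refine ⟨⟨⟨G k, (hV' _).2 (by rw [hk1, map_smul])⟩, 0, fun h0 => ?_⟩⟩
    have h1 : G k = 0 := congrArg Subtype.val h0
    rw [h1, map_zero] at hk1
    exact smul_ne_zero ha0 hk.2 hk1.symm
  obtain ⟨c, hc⟩ := Module.End.exists_eigenvalue (A.restrict hV)
  obtain ⟨⟨y, hyV⟩, hy⟩ := hc.exists_hasEigenvector
  have hy0 : y ≠ 0 := fun h0 => hy.2 (Subtype.ext h0)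
  have hAy : A y = c • y := congrArg Subtype.val hy.apply_eq_smul
  have hPy := (hV' y).1 hyV
  have hLy : L y ≠ 0 := by
    intro h0
    rw [h0, map_zero] at hPy
    exact smul_ne_zero ha0 hy0 hPy.symm
  refine ⟨c, ?_, y, hy0, hAy⟩
  have h1 := hiso y
  rw [hAy, map_smul, norm_smul] at h1
  exact mul_right_cancel₀ (norm_ne_zero_iff.2 hLy) (h1.trans (one_mul _).symm)

/-- If the Cesàro means of a bounded nonnegative sequence do not tend to zero, then the means of its
squares have a positive limit along some ultrafilter. -/
theorem exists_ultrafilter_cesaroLim_sq_pos {b : ℕ → ℝ} {C : ℝ} (hb : ∀ n, ‖b n‖ ≤ C)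
    (hb0 : ∀ n, 0 ≤ b n) (h : ¬ Tendsto (cesaro b) atTop (𝓝 0)) :
    ∃ 𝒰 : Ultrafilter ℕ, (𝒰 : Filter ℕ) ≤ atTop ∧ 0 < cesaroLim 𝒰 (fun n => b n ^ 2) := by
  obtain ⟨ε, hε, hfr⟩ : ∃ ε > 0, ∃ᶠ N in atTop, ε ≤ cesaro b N := by
    by_contra! hcon
    refine h (Metric.tendsto_nhds.2 fun ε hε => ?_)
    filter_upwards [hcon ε hε] with N hN
    rwa [Real.dist_0_eq_abs, abs_of_nonneg (cesaro_nonneg hb0 N)]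
  have : NeBot (atTop ⊓ 𝓟 {N | ε ≤ cesaro b N}) := frequently_mem_iff_neBot.1 hfr
  have h𝒰 : (Ultrafilter.of (atTop ⊓ 𝓟 {N | ε ≤ cesaro b N}) : Filter ℕ) ≤ atTop :=
    (Ultrafilter.of_le _).trans inf_le_left
  have h𝒰' : ∀ᶠ N in (Ultrafilter.of (atTop ⊓ 𝓟 {N | ε ≤ cesaro b N}) : Filter ℕ), ε ≤ cesaro b N :=
    ((Ultrafilter.of_le _).trans inf_le_right) (mem_principal_self _)
  refine ⟨Ultrafilter.of (atTop ⊓ 𝓟 {N | ε ≤ cesaro b N}), h𝒰, ?_⟩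
  refine (show 0 < ε ^ 2 by positivity).trans_le
    (ge_of_tendsto (tendsto_cesaroLim (C := C ^ 2) fun n => ?_) ?_)
  · rw [norm_pow]
    exact pow_le_pow_left₀ (norm_nonneg _) (hb n) 2
  -- `b² ≥ 2 ε b - ε²`, and the mean of the right side is at least `ε²`
  filter_upwards [h𝒰', h𝒰 (eventually_ne_atTop 0)] with N hN hN0
  have h3 := cesaro_mono (a := fun n => (2 * ε) • b n + (-ε ^ 2)) (b := fun n => b n ^ 2)
    (fun n => by simp only [smul_eq_mul]; nlinarith [sq_nonneg (b n - ε)]) N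
  rw [cesaro_add, cesaro_smul, cesaro_const hN0, smul_eq_mul] at h3
  nlinarith

/-- A power bounded operator on a separable reflexive space for which some orbit is not weakly null
in mean has a unimodular eigenvalue. The quadratic form `lim ‖y (Tⁿ x)‖²` on the dual space is given by
a compact operator `L`, and the adjoint of `T` preserves it. Therefore the orbit `u n = L (x' ∘ Tⁿ)` is
relatively compact and of constant norm, and `G k = lim ⟪u n, k⟫ x' ∘ Tⁿ` is an operator to which
`exists_unimodular_eigenvector_of_isCompactOperator` applies. -/
theorem exists_unimodular_eigenvector [TopologicalSpace.SeparableSpace X] (hX : IsReflexive X)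
    {T : X →L[ℂ] X} {K : ℝ} (hT : ∀ n, ‖T ^ n‖ ≤ K) {x : X} {x' : StrongDual ℂ X}
    (h : ¬ Tendsto (cesaro fun n => ‖x' ((T ^ n) x)‖) atTop (𝓝 0)) :
    ∃ c : ℂ, ‖c‖ = 1 ∧ ∃ w : X, w ≠ 0 ∧ T w = c • w := by
  have hK : 0 ≤ K := (norm_nonneg _).trans (hT 0)
  have horb : ∀ (n : ℕ) (z : X), ‖(T ^ n) z‖ ≤ K * ‖z‖ := fun n z => (T ^ n).le_of_opNorm_le (hT n) z
  obtain ⟨𝒰, h𝒰, hpos⟩ := exists_ultrafilter_cesaroLim_sq_pos (C := ‖x'‖ * (K * ‖x‖))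
    (fun n => by rw [norm_norm]; exact x'.le_of_opNorm_le_of_le le_rfl (horb n x))
    (fun _ => norm_nonneg _) h
  obtain ⟨H, _, _, _, L, hLc, hL⟩ := exists_compact_cesaroLim_eq hX (horb · x) 𝒰
  have hbdL : ∀ (y : StrongDual ℂ X) (n : ℕ), ‖‖y ((T ^ n) x)‖ ^ 2‖ ≤ (‖y‖ * (K * ‖x‖)) ^ 2 := by
    intro y n
    rw [norm_pow, norm_norm]
    gcongr
    exact y.le_of_opNorm_le_of_le le_rfl (horb n x)
  have hLx' : L x' ≠ 0 := by
    intro h0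
    have h1 := hL x'
    rw [h0, norm_zero, zero_pow two_ne_zero] at h1
    exact hpos.ne h1
  -- the adjoint of `T` is isometric for the seminorm of `L`
  have hiso : ∀ y : StrongDual ℂ X, ‖L (y.comp T)‖ = ‖L y‖ := by
    intro y
    rw [← sq_eq_sq₀ (norm_nonneg _) (norm_nonneg _), hL, hL, ← cesaroLim_succ h𝒰 (hbdL y)]
    congr 1 with n
    rw [pow_succ' T]; rfl
  have hinner : ∀ y z : StrongDual ℂ X,
      inner ℂ (L (y.comp T)) (L (z.comp T)) = inner ℂ (L y) (L z) := by
    intro y z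
    rw [inner_eq_sum_norm_sq_div_four, inner_eq_sum_norm_sq_div_four]
    simp only [← map_smul, ← map_add, ← map_sub, ← ContinuousLinearMap.smul_comp,
      ← ContinuousLinearMap.add_comp, ← ContinuousLinearMap.sub_comp, hiso]
  let u : ℕ → H := fun n => L (x'.comp (T ^ n))
  have hu : ∀ n, ‖u n‖ = ‖L x'‖ := by
    intro n
    induction n with
    | zero => simp only [u, pow_zero]; rfl
    | succ n ih => rw [← ih]; simp only [u, pow_succ]; exact hiso (x'.comp (T ^ n))
  have hxn : ∀ n, ‖x'.comp (T ^ n)‖ ≤ ‖x'‖ * K := fun n =>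
    (ContinuousLinearMap.opNorm_comp_le _ _).trans (by gcongr; exact hT n)
  have hutb : TotallyBounded (range u) := by
    refine (hLc.isCompact_closure_image_closedBall (‖x'‖ * K)).totallyBounded.subset ?_
    rintro _ ⟨n, rfl⟩
    exact subset_closure ⟨_, mem_closedBall_zero_iff.2 (hxn n), rfl⟩
  obtain ⟨h₀, hh₀⟩ := exists_cesaroLim_inner_ne_zero (norm_pos_iff.2 hLx') hu hutb h𝒰
  have hG0 : ∀ (k : H) (z : X) (n : ℕ),
      ‖inner ℂ (u n) k * x' ((T ^ n) z)‖ ≤ ‖L x'‖ * (‖x'‖ * K) * ‖k‖ * ‖z‖ := by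
    intro k z n
    have h1 : ‖x' ((T ^ n) z)‖ ≤ ‖x'‖ * K * ‖z‖ := (x'.comp (T ^ n)).le_of_opNorm_le (hxn n) z
    have h2 : ‖inner ℂ (u n) k‖ ≤ ‖L x'‖ * ‖k‖ := (norm_inner_le_norm _ _).trans (by rw [hu])
    calc _ ≤ (‖L x'‖ * ‖k‖) * (‖x'‖ * K * ‖z‖) := by rw [norm_mul]; gcongr
      _ = _ := by ring
  let G : H →L[ℂ] StrongDual ℂ X := LinearMap.mkContinuous₂
    (LinearMap.mk₂ ℂ (fun k z => cesaroLim 𝒰 fun n => inner ℂ (u n) k * x' ((T ^ n) z))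
      (fun k k' z => by
        simp only [inner_add_right, add_mul]; exact cesaroLim_add (hG0 k z) (hG0 k' z))
      (fun a k z => by
        rw [← cesaroLim_smul a (hG0 k z)]; simp only [inner_smul_right, smul_eq_mul, mul_assoc])
      (fun k z z' => by
        simp only [map_add, mul_add]; exact cesaroLim_add (hG0 k z) (hG0 k z'))
      (fun a k z => by
        rw [← cesaroLim_smul a (hG0 k z)]; simp only [map_smul, smul_eq_mul, mul_left_comm]))
    (‖L x'‖ * (‖x'‖ * K)) (fun k z => norm_cesaroLim_le (hG0 k z))
  have hG : ∀ k z, G k z = cesaroLim 𝒰 fun n => inner ℂ (u n) k * x' ((T ^ n) z) := fun _ _ => rfl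
  -- reflexivity turns `k ↦ ⟪k, L ·⟫` into a vector of `X`
  have hD : ∀ k k' : H, inner ℂ k (L (G k')) = cesaroLim 𝒰 fun n => inner ℂ (u n) k' * inner ℂ k (u n) := by
    intro k k'
    obtain ⟨z, hz⟩ := hX ((innerSL ℂ k).comp L)
    have hz' : ∀ y : StrongDual ℂ X, y z = inner ℂ k (L y) := fun y => by
      rw [← NormedSpace.dual_def ℂ X z y, hz]; rfl
    rw [← hz', hG]
    congr 1 with n
    rw [← hz' (x'.comp (T ^ n))]; rfl
  have hDb : ∀ (k k' : H) (n : ℕ), ‖inner ℂ (u n) k' * inner ℂ k (u n)‖ ≤ ‖L x'‖ * ‖k'‖ * (‖k‖ * ‖L x'‖) := by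
    intro k k' n
    rw [norm_mul]
    gcongr
    · exact (norm_inner_le_norm _ _).trans (by rw [hu])
    · exact (norm_inner_le_norm _ _).trans (by rw [hu])
  have hcomm : ∀ y : StrongDual ℂ X, G (L (y.comp T)) = (G (L y)).comp T := by
    intro y
    ext z
    rw [ContinuousLinearMap.comp_apply, hG, hG, ← cesaroLim_succ h𝒰 (hG0 _ _)]
    congr 1 with n
    have h1 : u (n + 1) = L ((x'.comp (T ^ n)).comp T) := by simp only [u, pow_succ]; rfl
    rw [h1, hinner, pow_succ]; rfl
  have hDs : (L.comp G).IsSymmetric := by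
    intro k k'
    change inner ℂ (L (G k)) k' = inner ℂ k (L (G k'))
    rw [← inner_conj_symm, hD, hD]
    refine (cesaroLim_map (𝒰 := 𝒰) (Complex.conjCLE : ℂ →L[ℝ] ℂ) (hDb k' k)).symm.trans ?_
    congr 1 with n
    simp [mul_comm]
  have hD0 : L.comp G ≠ 0 := by
    intro h0
    have h1 := hD h₀ h₀
    have h2 : L (G h₀) = 0 := DFunLike.congr_fun h0 h₀
    rw [h2, inner_zero_right] at h1
    have h3 := cesaroLim_map (𝒰 := 𝒰) (Complex.ofRealCLM : ℝ →L[ℝ] ℂ)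
      (a := fun n => ‖inner ℂ h₀ (u n)‖ ^ 2) (C := (‖h₀‖ * ‖L x'‖) ^ 2) (fun n => by
        rw [norm_pow, norm_norm]
        gcongr
        exact (norm_inner_le_norm _ _).trans (by rw [hu]))
    have h4 : (fun n => inner ℂ (u n) h₀ * inner ℂ h₀ (u n))
        = fun n => Complex.ofRealCLM (‖inner ℂ h₀ (u n)‖ ^ 2) := by
      ext n
      rw [← inner_conj_symm, mul_comm, Complex.mul_conj, Complex.normSq_eq_norm_sq]; rfl
    rw [h4, h3] at h1
    exact hh₀ (Complex.ofReal_eq_zero.1 h1.symm)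
  obtain ⟨c, hc, y, hy, hTy⟩ := exists_unimodular_eigenvector_of_isCompactOperator hLc hDs hD0
    (A := { toFun := fun y => y.comp T
            map_add' := fun y z => ContinuousLinearMap.add_comp y z T
            map_smul' := fun b y => ContinuousLinearMap.smul_comp b y T }) hiso hcomm
  exact ⟨c, hc, exists_eigenvector_of_dual_eigenvector hX hT hc hy hTy⟩

end Jacobs

/-! ### Eigenvectors of a semigroup and of its generator -/

section Eigenvectors

variable {X : Type*} [NormedAddCommGroup X] [NormedSpace ℂ X] {T : ℝ≥0 → X →L[ℂ] X}

theorem IsC0Semigroup.hasDerivWithinAt (hT : IsC0Semigroup T) {x y : X} (h : HasOrbitDeriv T x y)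
    {t : ℝ} (ht : 0 ≤ t) :
    HasDerivWithinAt (fun t : ℝ => T t.toNNReal x) (T t.toNNReal y) (Ici t) t := by
  rw [hasDerivWithinAt_iff_tendsto_slope, Ici_sdiff_left]
  have h1 : Tendsto (fun u : ℝ => (u - t).toNNReal) (𝓝[>] t) (𝓝[>] 0) := by
    refine tendsto_nhdsWithin_iff.2 ⟨?_, ?_⟩
    · have : Continuous fun u : ℝ => (u - t).toNNReal := by fun_prop
      have h2 := (this.tendsto t).mono_left (nhdsWithin_le_nhds (s := Ioi t))
      simpa using h2
    · filter_upwards [self_mem_nhdsWithin] with u hu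
      simpa using hu
  have h2 := ((T t.toNNReal).continuous.tendsto y).comp (Tendsto.comp h h1)
  refine h2.congr' ?_
  filter_upwards [self_mem_nhdsWithin] with u hu
  have hu' : t < u := hu
  have h3 : u.toNNReal = t.toNNReal + (u - t).toNNReal := by
    rw [← Real.toNNReal_add ht (by linarith)]; congr 1; ring
  simp only [Function.comp_apply, slope, vsub_eq_sub, map_smul, map_sub]
  rw [h3, hT.map_add, Real.coe_toNNReal _ (by linarith : 0 ≤ u - t)]
  rw [← Complex.ofReal_inv, Complex.coe_smul]
  rfl

theorem IsC0Semigroup.continuous_toNNReal (hT : IsC0Semigroup T) (x : X) :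
    Continuous fun t : ℝ => T t.toNNReal x :=
  (hT.strong_cont x).comp continuous_real_toNNReal

theorem hasOrbitDeriv_generator (x : (generator T).domain) :
    HasOrbitDeriv T (x : X) (generator T x) := x.2.choose_spec

/-- `z` is an eigenvalue of the generator if and only if there is `x ≠ 0` with
`T t x = exp (z t) x` for all `t`. -/
theorem mem_pointSpectrum_generator_iff (hT : IsC0Semigroup T) {z : ℂ} :
    z ∈ pointSpectrum (generator T) ↔
      ∃ x : X, x ≠ 0 ∧ ∀ t : ℝ≥0, T t x = Complex.exp (z * (t : ℝ)) • x := by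
  constructor
  · rintro ⟨x, hx0, hx⟩
    refine ⟨x, hx0, fun t => ?_⟩
    have hd := hasOrbitDeriv_generator x
    rw [hx] at hd
    -- `exp (-z s) T s x` has right derivative zero, so it is constant
    let f : ℝ → X := fun s => Complex.exp (-z * s) • T s.toNNReal x
    have hexp : ∀ s : ℝ, HasDerivAt (fun s : ℝ => Complex.exp (-z * s))
        (Complex.exp (-z * s) * (-z)) s := by
      intro s
      have h1 : HasDerivAt (fun s : ℝ => -z * (s : ℂ)) (-z) s := by
        simpa using (Complex.ofRealCLM.hasDerivAt (x := s)).const_mul (-z)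
      exact h1.cexp
    have hcont : Continuous f := (by fun_prop : Continuous fun s : ℝ => Complex.exp (-z * s)).smul
      (hT.continuous_toNNReal _)
    have hf : ∀ s ∈ Ico (0 : ℝ) t, HasDerivWithinAt f 0 (Ici s) s := by
      intro s hs
      have h1 := (hexp s).hasDerivWithinAt.smul (hT.hasDerivWithinAt hd hs.1) (s := Ici s)
      refine HasDerivWithinAt.congr_deriv h1 ?_
      rw [map_smul, smul_smul, ← add_smul]
      simp
    have h2 := constant_of_has_deriv_right_zero hcont.continuousOn hf t ⟨t.2, le_rfl⟩
    have h3 : Complex.exp (-z * (t : ℝ)) • T t x = x := by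
      simpa [f, hT.map_zero] using h2
    rw [← h3, smul_smul, ← Complex.exp_add, h3]
    simp
  · rintro ⟨x, hx0, hx⟩
    have hd : HasOrbitDeriv T x (z • x) := by
      have h1 : HasDerivAt (fun s : ℝ => Complex.exp (z * s)) z 0 := by
        have h1 : HasDerivAt (fun s : ℝ => z * (s : ℂ)) z 0 := by
          simpa using (Complex.ofRealCLM.hasDerivAt (x := 0)).const_mul z
        simpa using h1.cexp
      have h2 := h1.tendsto_slope_zero_right
      have h3 : Tendsto (fun h : ℝ≥0 => (h : ℝ)) (𝓝[>] 0) (𝓝[>] 0) := by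
        refine tendsto_nhdsWithin_iff.2 ⟨?_, ?_⟩
        · exact (NNReal.continuous_coe.tendsto 0).mono_left nhdsWithin_le_nhds
        · filter_upwards [self_mem_nhdsWithin] with u hu
          exact NNReal.coe_pos.2 hu
      refine ((h2.comp h3).smul_const x).congr fun h => ?_
      rw [hx]
      simp only [Function.comp_apply, zero_add, Complex.ofReal_zero, mul_zero, Complex.exp_zero]
      rw [← Complex.ofReal_inv, Complex.coe_smul, smul_assoc, sub_smul, one_smul]
    exact ⟨⟨x, _, hd⟩, hx0, (hasOrbitDeriv_generator (T := T) ⟨x, _, hd⟩).unique hd⟩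

theorem IsC0Semigroup.map_natCast (hT : IsC0Semigroup T) (n : ℕ) : T n = T 1 ^ n := by
  induction n with
  | zero => rw [Nat.cast_zero, hT.map_zero, pow_zero]; rfl
  | succ n ih => rw [Nat.cast_succ, hT.map_add, ih, pow_succ]; rfl

/-- A nonzero continuous `1`-periodic function has a nonzero Fourier coefficient. -/
theorem exists_integral_exp_mul_ne_zero {f : ℝ → ℂ} (hf : ContinuousOn f (Icc 0 1))
    (h01 : f 0 = f 1) (h0 : f 0 ≠ 0) :
    ∃ k : ℤ, ∫ t in (0 : ℝ)..1, Complex.exp (-(2 * Real.pi * Complex.I * k) * t) * f t ≠ 0 := by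
  by_contra! hcon
  have : Fact ((0 : ℝ) < 1) := ⟨one_pos⟩
  let g : C(AddCircle (1 : ℝ), ℂ) := ⟨AddCircle.liftIco 1 0 f,
    AddCircle.liftIco_continuous (by simpa using h01) (by simpa using hf)⟩
  have hg : fourierCoeff g = 0 := by
    ext n
    change fourierCoeff (AddCircle.liftIco 1 0 f) n = 0
    rw [fourierCoeff_liftIco_eq, fourierCoeffOn_eq_integral]
    rw [zero_add]
    refine (congrArg _ (Eq.trans ?_ (hcon n))).trans (smul_zero _)
    refine intervalIntegral.integral_congr fun t _ => ?_
    simp only [fourier_coe_apply, smul_eq_mul]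
    congr 2
    push_cast
    ring
  have hs := has_pointwise_sum_fourier_series_of_summable (f := g) (by rw [hg]; exact summable_zero) 0
  rw [hg] at hs
  simp only [Pi.zero_apply, zero_smul] at hs
  have h2 := hs.unique hasSum_zero
  have h3 : g 0 = f 0 := by
    have := AddCircle.liftIco_coe_apply (p := 1) (a := 0) (f := f) (x := 0) (by simp)
    change AddCircle.liftIco 1 0 f 0 = f 0
    simpa using this
  exact h0 (h3.symm.trans h2)

/-- A unimodular eigenvalue of `T 1` yields an imaginary eigenvalue of the generator: if
`T 1 w = exp (iθ) w`, then `t ↦ exp (-iθt) T t w` is `1`-periodic and each of its Fourier coefficients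
is an eigenvector or zero. -/
theorem exists_eigenvector_of_eigenvector_one [CompleteSpace X] (hT : IsC0Semigroup T) {c : ℂ}
    (hc : ‖c‖ = 1) {w : X} (hw : w ≠ 0) (h1 : T 1 w = c • w) :
    ∃ z : ℂ, z.re = 0 ∧ ∃ x : X, x ≠ 0 ∧ ∀ t : ℝ≥0, T t x = Complex.exp (z * (t : ℝ)) • x := by
  have hcθ : c = Complex.exp (Complex.arg c * Complex.I) := by
    have := Complex.norm_mul_exp_arg_mul_I c
    rw [hc] at this
    simpa using this.symm
  set θ := Complex.arg c
  obtain ⟨x', hx'⟩ := SeparatingDual.exists_ne_zero (R := ℂ) hw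
  have hcont : Continuous fun t : ℝ => x' (T t.toNNReal w) :=
    x'.continuous.comp (hT.continuous_toNNReal w)
  obtain ⟨k, hk⟩ := exists_integral_exp_mul_ne_zero
    (f := fun t => Complex.exp (-(θ * Complex.I) * t) * x' (T t.toNNReal w))
    ((by fun_prop : Continuous fun t : ℝ => Complex.exp (-(θ * Complex.I) * t)).mul hcont).continuousOn
    (by
      simp only [Complex.ofReal_zero, mul_zero, Complex.exp_zero, Complex.ofReal_one, mul_one,
        Real.toNNReal_one, Real.toNNReal_zero, h1, hT.map_zero, map_smul, one_mul, smul_eq_mul]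
      rw [hcθ, ← mul_assoc, ← Complex.exp_add]
      simp)
    (by simpa [hT.map_zero] using hx')
  let z : ℂ := θ * Complex.I + 2 * Real.pi * Complex.I * k
  let v : ℝ → X := fun t => Complex.exp (-z * t) • T t.toNNReal w
  have hv : Continuous v :=
    (by fun_prop : Continuous fun t : ℝ => Complex.exp (-z * t)).smul (hT.continuous_toNNReal w)
  have hvi : ∀ a b, IntervalIntegrable v volume a b := fun a b => hv.intervalIntegrable a b
  have hper : ∀ t : ℝ, 0 ≤ t → v (t + 1) = v t := by
    intro t ht
    simp only [v]
    rw [Real.toNNReal_add ht zero_le_one, hT.map_add, Real.toNNReal_one,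
      ContinuousLinearMap.comp_apply, h1, map_smul, smul_smul]
    congr 1
    nth_rewrite 1 [hcθ]
    rw [← Complex.exp_add, Complex.exp_eq_exp_iff_exists_int]
    refine ⟨-k, ?_⟩
    simp only [z]
    push_cast
    ring
  refine ⟨z, by simp [z], ∫ t in (0 : ℝ)..1, v t, ?_, fun h => ?_⟩
  · intro h0
    have h2 := x'.intervalIntegral_comp_comm (hvi 0 1)
    rw [h0, map_zero] at h2
    refine hk (Eq.trans ?_ h2)
    refine intervalIntegral.integral_congr fun t _ => ?_
    simp only [v, map_smul, smul_eq_mul]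
    rw [← mul_assoc, ← Complex.exp_add]
    congr 2
    simp only [z]
    ring
  · have h2 : ∀ t ∈ uIcc (0 : ℝ) 1, T h (v t) = Complex.exp (z * (h : ℝ)) • v (t + h) := by
      intro t ht
      rw [uIcc_of_le zero_le_one] at ht
      simp only [v]
      rw [map_smul, Real.toNNReal_add ht.1 h.coe_nonneg, Real.toNNReal_coe, add_comm t.toNNReal h, hT.map_add,
        smul_smul, ← Complex.exp_add, ContinuousLinearMap.comp_apply]
      congr 2
      push_cast
      ring
    rw [← (T h).intervalIntegral_comp_comm (hvi 0 1), intervalIntegral.integral_congr h2,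
      intervalIntegral.integral_smul, intervalIntegral.integral_comp_add_right]
    congr 1
    -- by periodicity, the integral of `v` over `[h, 1 + h]` equals the one over `[0, 1]`
    have h3 : ∫ t in (1 : ℝ)..(1 + h), v t = ∫ t in (0 : ℝ)..h, v t := by
      have := intervalIntegral.integral_comp_add_right (a := 0) (b := (h : ℝ)) v 1
      rw [zero_add, add_comm] at this
      rw [← this]
      refine intervalIntegral.integral_congr fun t ht => ?_
      rw [uIcc_of_le h.coe_nonneg] at ht
      exact hper t ht.1
    rw [zero_add, ← intervalIntegral.integral_add_adjacent_intervals (hvi h 1) (hvi 1 _), h3,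
      add_comm, intervalIntegral.integral_add_adjacent_intervals (hvi 0 h) (hvi _ _)]

/-- If the generator of a bounded semigroup on a separable reflexive space has no imaginary
eigenvalues, then all orbits are weakly null in mean. -/
theorem tendsto_cesaro_of_forall_notMem_pointSpectrum [CompleteSpace X]
    [TopologicalSpace.SeparableSpace X] (hX : IsReflexive X) (hT : IsC0Semigroup T) {K : ℝ}
    (hK : ∀ t, ‖T t‖ ≤ K) (h : ∀ z : ℂ, z.re = 0 → z ∉ pointSpectrum (generator T)) (δ : ℝ≥0)
    (x : X) (x' : StrongDual ℂ X) :
    Tendsto (cesaro fun n : ℕ => ‖x' (T (n + δ) x)‖) atTop (𝓝 0) := by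
  by_contra hcon
  have h1 : (fun n : ℕ => ‖x' (T (n + δ) x)‖) = fun n => ‖x' ((T 1 ^ n) (T δ x))‖ := by
    ext n
    rw [hT.map_add, hT.map_natCast]; rfl
  rw [h1] at hcon
  obtain ⟨c, hc, w, hw, hTw⟩ := exists_unimodular_eigenvector hX
    (fun n => by rw [← hT.map_natCast]; exact hK n) hcon
  obtain ⟨z, hz, hzx⟩ := exists_eigenvector_of_eigenvector_one hT hc hw hTw
  exact h z hz ((mem_pointSpectrum_generator_iff hT).2 hzx)

end Eigenvectors

/-! ### Sets of times of density one -/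

section Density

/-- The Cesàro means of a function over all arithmetic progressions of step one control its integral
means. -/
theorem tendsto_integral_mean_of_cesaro {a : ℝ → ℝ} (ha : Continuous a) {C : ℝ}
    (h0 : ∀ t, 0 ≤ a t) (hC : ∀ t, a t ≤ C)
    (h : ∀ δ ∈ Icc (0 : ℝ) 1, Tendsto (cesaro fun n : ℕ => a (n + δ)) atTop (𝓝 0)) :
    Tendsto (fun t : ℝ => t⁻¹ * ∫ r in (0 : ℝ)..t, a r) atTop (𝓝 0) := by
  have hC0 : 0 ≤ C := (h0 0).trans (hC 0)
  have hint : ∀ u v, IntervalIntegrable a volume u v := fun u v => ha.intervalIntegrable u v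
  have h1 : ∀ N : ℕ, ∫ δ in (0 : ℝ)..1, cesaro (fun n : ℕ => a (n + δ)) N
      = (N : ℝ)⁻¹ * ∫ r in (0 : ℝ)..N, a r := by
    intro N
    simp only [cesaro, smul_eq_mul]
    rw [intervalIntegral.integral_const_mul, intervalIntegral.integral_finsetSum
      (f := fun (n : ℕ) δ => a (n + δ)) (fun n _ =>
        (by fun_prop : Continuous fun δ : ℝ => a (n + δ)).intervalIntegrable _ _)]
    have h2 := intervalIntegral.sum_integral_adjacent_intervals (f := a) (μ := volume)
      (a := fun n : ℕ => (n : ℝ)) (n := N) (fun k _ => hint _ _)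
    rw [Nat.cast_zero] at h2
    rw [← h2]
    congr 1
    refine Finset.sum_congr rfl fun n _ => ?_
    rw [intervalIntegral.integral_comp_add_left a (n : ℝ), add_zero, Nat.cast_succ]
  have h2 : Tendsto (fun N : ℕ => (N : ℝ)⁻¹ * ∫ r in (0 : ℝ)..N, a r) atTop (𝓝 0) := by
    simp_rw [← h1]
    suffices h3 : Tendsto (fun N : ℕ => ∫ δ in (0 : ℝ)..1, cesaro (fun n : ℕ => a (n + δ)) N) atTop
        (𝓝 (∫ _ in (0 : ℝ)..1, (0 : ℝ))) by simpa using h3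
    refine intervalIntegral.tendsto_integral_filter_of_dominated_convergence (fun _ => C) ?_ ?_
      intervalIntegrable_const ?_
    · refine Eventually.of_forall fun N => Continuous.aestronglyMeasurable ?_
      unfold cesaro
      fun_prop
    · refine Eventually.of_forall fun N => Eventually.of_forall fun δ _ => ?_
      exact norm_cesaro_le (fun n => by rw [Real.norm_of_nonneg (h0 _)]; exact hC _) N
    · refine Eventually.of_forall fun δ hδ => ?_
      rw [uIoc_of_le zero_le_one] at hδ
      exact h δ ⟨hδ.1.le, hδ.2⟩
  -- pass from natural `N` to real `t` by comparison with `N = ⌈t⌉₊ ≤ 2 t`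
  have h3 := (h2.comp (tendsto_nat_ceil_atTop (α := ℝ))).const_mul 2
  rw [mul_zero] at h3
  refine squeeze_zero' ?_ ?_ h3
  · filter_upwards [eventually_ge_atTop 0] with t ht
    have := intervalIntegral.integral_nonneg (μ := volume) ht fun r _ => h0 r
    positivity
  · filter_upwards [eventually_ge_atTop 1] with t ht
    have ht0 : 0 < t := by linarith
    have hle : t ≤ ⌈t⌉₊ := Nat.le_ceil t
    have hlt : (⌈t⌉₊ : ℝ) < t + 1 := Nat.ceil_lt_add_one ht0.le
    have hmono : ∫ r in (0 : ℝ)..t, a r ≤ ∫ r in (0 : ℝ)..⌈t⌉₊, a r :=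
      intervalIntegral.integral_mono_interval le_rfl ht0.le hle
        (Eventually.of_forall fun r => h0 r) (hint _ _)
    have hpos : 0 ≤ ∫ r in (0 : ℝ)..⌈t⌉₊, a r :=
      intervalIntegral.integral_nonneg (by positivity) fun r _ => h0 r
    have hpos' : 0 ≤ ∫ r in (0 : ℝ)..t, a r := intervalIntegral.integral_nonneg ht0.le fun r _ => h0 r
    have hinv : t⁻¹ ≤ 2 * (⌈t⌉₊ : ℝ)⁻¹ := by
      rw [← div_eq_mul_inv, inv_eq_one_div, div_le_div_iff₀ ht0 (by linarith)]
      linarith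
    calc t⁻¹ * ∫ r in (0 : ℝ)..t, a r ≤ (2 * (⌈t⌉₊ : ℝ)⁻¹) * ∫ r in (0 : ℝ)..⌈t⌉₊, a r := by
          gcongr
      _ = _ := by simp only [Function.comp_apply]; ring

/-- A function tending to zero at infinity is dominated by a positive antitone function with the same
property. -/
theorem exists_antitone_pos_tendsto_zero {m : ℝ → ℝ} (hm : Tendsto m atTop (𝓝 0))
    {C R : ℝ} (hC : ∀ t, R ≤ t → m t ≤ C) :
    ∃ ε : ℝ → ℝ, Antitone ε ∧ (∀ t, 0 < ε t) ∧ Tendsto ε atTop (𝓝 0) ∧ ∀ t, R ≤ t → m t ≤ ε t := by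
  -- the supremum of `m` over `[t, ∞)` is antitone; adding `exp (-t)` makes it positive
  let S : ℝ → Set ℝ := fun t => insert 0 (m '' Ici (max t R))
  have hbdd : ∀ t, BddAbove (S t) := fun t => ((bddAbove_iff_exists_ge 0).2 ⟨max C 0, le_max_right _ _, by
    rintro _ ⟨u, hu, rfl⟩
    exact (hC u (le_trans (le_max_right _ _) hu)).trans (le_max_left _ _)⟩).insert 0
  have hne : ∀ t, (S t).Nonempty := fun t => insert_nonempty _ _
  have hnn : ∀ t, 0 ≤ sSup (S t) := fun t => le_csSup (hbdd t) (mem_insert _ _)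
  refine ⟨fun t => sSup (S t) + Real.exp (-t), ?_, fun t => ?_, ?_, fun t ht => ?_⟩
  · intro s t hst
    refine add_le_add (csSup_le_csSup (hbdd s) (hne t) ?_) (Real.exp_le_exp.2 (by linarith))
    exact insert_subset_insert (image_mono (Ici_subset_Ici.2 (max_le_max_right _ hst)))
  · exact add_pos_of_nonneg_of_pos (hnn t) (Real.exp_pos _)
  · have h1 : Tendsto (fun t => sSup (S t)) atTop (𝓝 0) := by
      rw [Metric.tendsto_atTop]
      intro δ hδ
      obtain ⟨N, hN⟩ := Metric.tendsto_atTop.1 hm (δ / 2) (by positivity)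
      refine ⟨N, fun t ht => ?_⟩
      rw [Real.dist_0_eq_abs, abs_of_nonneg (hnn t)]
      refine lt_of_le_of_lt (csSup_le (hne t) ?_) (half_lt_self hδ)
      rintro _ (rfl | ⟨u, hu, rfl⟩)
      · positivity
      · have := hN u (ht.trans ((le_max_left _ _).trans hu))
        rw [Real.dist_0_eq_abs] at this
        exact (le_abs_self _).trans this.le
    simpa using h1.add (Real.tendsto_exp_neg_atTop_nhds_zero)
  · have := le_csSup (hbdd t) (mem_insert_of_mem 0 ⟨t, by simp [ht], rfl⟩)
    linarith [Real.exp_pos (-t)]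

/-- A bounded nonnegative continuous function whose Cesàro means tend to zero tends to zero along a set
of density one. The set is `{t | a t ≤ ε t}`, where `ε` is antitone and the square of `ε` dominates the
integral means of `a`, so that Markov's inequality applies. -/
theorem exists_hasDensityOne_tendsto {a : ℝ → ℝ} (ha : Continuous a) {C : ℝ}
    (h0 : ∀ t, 0 ≤ a t) (hC : ∀ t, a t ≤ C)
    (h : ∀ δ ∈ Icc (0 : ℝ) 1, Tendsto (cesaro fun n : ℕ => a (n + δ)) atTop (𝓝 0)) :
    ∃ M, HasDensityOne M ∧ Tendsto a (atTop ⊓ 𝓟 M) (𝓝 0) := by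
  have hmean := tendsto_integral_mean_of_cesaro ha h0 hC h
  have hint : ∀ u v, IntervalIntegrable a volume u v := fun u v => ha.intervalIntegrable u v
  obtain ⟨ε, hεa, hε0, hεt, hεm⟩ := exists_antitone_pos_tendsto_zero
    (m := fun t => √(t⁻¹ * ∫ r in (0 : ℝ)..t, a r)) (R := 1) (C := √C)
    (by simpa [Function.comp_def] using (Real.continuous_sqrt.tendsto 0).comp hmean) (fun t ht => by
      have ht0 : 0 < t := by linarith
      refine Real.sqrt_le_sqrt ?_
      rw [inv_mul_le_iff₀ ht0]
      have := intervalIntegral.integral_mono_on ht0.le (hint 0 t) intervalIntegrable_const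
        (fun r _ => hC r)
      simpa using this)
  let M : Set ℝ := {t | 0 ≤ t ∧ a t ≤ ε t}
  have hMm : MeasurableSet M :=
    measurableSet_Ici.inter (measurableSet_le ha.measurable hεa.measurable)
  refine ⟨M, ⟨fun t ht => ht.1, hMm.nullMeasurableSet, ?_⟩, ?_⟩
  · -- Markov's inequality: `ε t * |[0, t] \ M| ≤ ∫ a ≤ t (ε t)²`, as `ε ≥ ε t` on `[0, t]`
    have hlow : ∀ t : ℝ, 1 ≤ t → 1 - ε t ≤ volume.real (M ∩ Icc 0 t) / t := by
      intro t ht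
      have ht0 : 0 < t := by linarith
      have hbad : volume.real (Icc 0 t \ M) ≤ t * ε t := by
        have h1 := mul_meas_ge_le_integral_of_nonneg (μ := volume.restrict (Icc 0 t)) (f := a)
          (Eventually.of_forall h0) (ha.integrableOn_Icc) (ε t)
        rw [integral_Icc_eq_integral_Ioc, ← intervalIntegral.integral_of_le ht0.le] at h1
        have h2 : ∫ r in (0 : ℝ)..t, a r ≤ t * ε t ^ 2 := by
          have h3 := Real.sqrt_le_iff.1 (hεm t ht)
          rw [inv_mul_le_iff₀ ht0] at h3
          exact h3.2
        have h4 : volume.real (Icc 0 t \ M) ≤ (volume.restrict (Icc 0 t)).real {r | ε t ≤ a r} := by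
          rw [measureReal_restrict_apply (measurableSet_le measurable_const ha.measurable)]
          refine measureReal_mono ?_ (measure_ne_top_of_subset inter_subset_right (by simp))
          rintro r ⟨hr, hrM⟩
          refine ⟨?_, hr⟩
          have h5 : ε r < a r := by
            by_contra hcon
            exact hrM ⟨hr.1, not_lt.1 hcon⟩
          exact (hεa hr.2).trans h5.le
        have h6 : ε t * volume.real (Icc 0 t \ M) ≤ ε t * (t * ε t) :=
          (mul_le_mul_of_nonneg_left h4 (hε0 t).le).trans (h1.trans (h2.trans (by ring_nf; rfl)))
        exact le_of_mul_le_mul_left h6 (hε0 t)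
      have h7 : volume.real (Icc 0 t \ M) + volume.real (M ∩ Icc 0 t) = t := by
        rw [inter_comm, add_comm, measureReal_inter_add_sdiff hMm (by simp)]
        simp [ht0.le]
      rw [le_div_iff₀ ht0]
      linarith
    have hup : ∀ t : ℝ, 1 ≤ t → volume.real (M ∩ Icc 0 t) / t ≤ 1 := by
      intro t ht
      have ht0 : 0 < t := by linarith
      rw [div_le_one ht0]
      refine (measureReal_mono inter_subset_right (by simp)).trans ?_
      simp [ht0.le]
    refine tendsto_of_tendsto_of_tendsto_of_le_of_le' (g := fun t => 1 - ε t) (h := fun _ => 1)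
      (by simpa using hεt.const_sub 1) tendsto_const_nhds ?_ ?_
    · filter_upwards [eventually_ge_atTop 1] with t ht using hlow t ht
    · filter_upwards [eventually_ge_atTop 1] with t ht using hup t ht
  · refine squeeze_zero' (Eventually.of_forall h0) ?_ (hεt.mono_left inf_le_left)
    filter_upwards [mem_inf_of_right (mem_principal_self M)] with t ht using ht.2

theorem HasDensityOne.neBot {M : Set ℝ} (hM : HasDensityOne M) : (atTop ⊓ 𝓟 M : Filter ℝ).NeBot := by
  rw [← frequently_mem_iff_neBot]
  by_contra hcon
  rw [not_frequently] at hcon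
  obtain ⟨R, hR⟩ := eventually_atTop.1 hcon
  have h1 : Tendsto (fun t : ℝ => max R 0 / t) atTop (𝓝 0) := tendsto_const_nhds.div_atTop tendsto_id
  have h2 : (1 : ℝ) ≤ 0 := by
    refine le_of_tendsto_of_tendsto hM.2.2 h1 ?_
    filter_upwards [eventually_gt_atTop 0] with t ht
    gcongr
    have h3 : M ∩ Icc 0 t ⊆ Icc 0 (max R 0) := by
      rintro r ⟨hr, hr2⟩
      refine ⟨hr2.1, le_max_of_le_left ?_⟩
      by_contra hlt
      exact hR r (not_le.1 hlt).le hr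
    refine (measureReal_mono h3 (by simp)).trans ?_
    simp
  norm_num at h2

end Density

/-! ### Separability of the dual space -/

section Dual

variable {Y : Type*} [NormedAddCommGroup Y] [NormedSpace ℂ Y]

/-- A normed space with separable dual is separable. -/
theorem separableSpace_of_separableSpace_strongDual
    [TopologicalSpace.SeparableSpace (StrongDual ℂ Y)] : TopologicalSpace.SeparableSpace Y := by
  let f : ℕ → StrongDual ℂ Y := TopologicalSpace.denseSeq _
  have hx : ∀ n, ∃ x : Y, ‖x‖ ≤ 1 ∧ ‖f n‖ / 2 ≤ ‖f n x‖ := by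
    intro n
    rcases eq_or_ne (f n) 0 with h0 | h0
    · exact ⟨0, by simp, by simp [h0]⟩
    · obtain ⟨x, hx1, hx2⟩ := (f n).exists_lt_apply_of_lt_opNorm
        (half_lt_self (norm_pos_iff.2 h0))
      exact ⟨x, hx1.le, hx2.le⟩
  choose x hx1 hx2 using hx
  let V : Submodule ℂ Y := (Submodule.span ℂ (range x)).topologicalClosure
  have hsep : TopologicalSpace.IsSeparable (V : Set Y) := by
    rw [Submodule.topologicalClosure_coe]
    exact ((countable_range x).isSeparable.span (R := ℂ)).closure
  have hV : ∀ y, y ∈ V := by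
    by_contra! hcon
    obtain ⟨y, hy⟩ := hcon
    have hVc : IsClosed (V : Set Y) := Submodule.isClosed_topologicalClosure _
    have hy' : (Submodule.Quotient.mk y : Y ⧸ V) ≠ 0 := by
      rwa [Ne, Submodule.Quotient.mk_eq_zero]
    obtain ⟨g, hg⟩ := SeparatingDual.exists_ne_zero (R := ℂ) hy'
    let h : StrongDual ℂ Y := g.comp V.mkQL
    have hh0 : h ≠ 0 := fun h0 => hg (DFunLike.congr_fun h0 y)
    obtain ⟨_, hn, n, rfl⟩ := Metric.dense_iff.1 (TopologicalSpace.denseRange_denseSeq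
      (StrongDual ℂ Y)) h (‖h‖ / 4) (by have := norm_pos_iff.2 hh0; positivity)
    have hn : ‖f n - h‖ < ‖h‖ / 4 := by rw [← dist_eq_norm]; exact hn
    have h1 : h (x n) = 0 := by
      change g (V.mkQL (x n)) = 0
      have : V.mkQL (x n) = 0 := (Submodule.Quotient.mk_eq_zero V).2
        (Submodule.le_topologicalClosure _ (Submodule.subset_span ⟨n, rfl⟩))
      rw [this, map_zero]
    have h2 : ‖f n (x n)‖ ≤ ‖f n - h‖ := by
      have := (f n - h).le_of_opNorm_le_of_le le_rfl (hx1 n)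
      simpa [h1] using this
    have h3 := hx2 n
    have h4 : ‖h‖ ≤ ‖f n‖ + ‖f n - h‖ := by
      have := norm_sub_le (f n) (f n - h)
      simpa using this
    linarith [norm_nonneg h]
  rw [← TopologicalSpace.isSeparable_univ_iff]
  exact hsep.mono fun y _ => hV y

theorem IsReflexive.separableSpace_strongDual (hY : IsReflexive Y)
    [TopologicalSpace.SeparableSpace Y] : TopologicalSpace.SeparableSpace (StrongDual ℂ Y) := by
  have : TopologicalSpace.SeparableSpace (StrongDual ℂ (StrongDual ℂ Y)) :=
    hY.denseRange.separableSpace (NormedSpace.inclusionInDoubleDual ℂ Y).continuous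
  exact separableSpace_of_separableSpace_strongDual

end Dual

/-! ### A gauge for the weak operator topology -/

section Gauge

variable {X : Type*} [NormedAddCommGroup X] [NormedSpace ℂ X]
  [TopologicalSpace.SeparableSpace X] [TopologicalSpace.SeparableSpace (StrongDual ℂ X)]

/-- The `i`-th summand of `weakGauge`: a truncated and weighted matrix coefficient of `A` for a pair
in a countable dense subset of `X × X'`. -/
noncomputable def weakGaugeTerm (i : ℕ) (A : X →L[ℂ] X) : ℝ :=
  (1 / 2) ^ i * min 1 ‖TopologicalSpace.denseSeq (StrongDual ℂ X) i.unpair.2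
    (A (TopologicalSpace.denseSeq X i.unpair.1))‖

/-- A scalar gauge for the weak operator topology: on bounded sets of operators on a separable space
with separable dual, `A → 0` weakly if and only if `weakGauge A → 0`. -/
noncomputable def weakGauge (A : X →L[ℂ] X) : ℝ := ∑' i, weakGaugeTerm i A

theorem weakGaugeTerm_nonneg (i : ℕ) (A : X →L[ℂ] X) : 0 ≤ weakGaugeTerm i A := by
  unfold weakGaugeTerm; positivity

theorem weakGaugeTerm_le (i : ℕ) (A : X →L[ℂ] X) : weakGaugeTerm i A ≤ (1 / 2) ^ i :=
  mul_le_of_le_one_right (by positivity) (min_le_left _ _)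

theorem norm_weakGaugeTerm_le (i : ℕ) (A : X →L[ℂ] X) : ‖weakGaugeTerm i A‖ ≤ (1 / 2) ^ i := by
  rw [Real.norm_of_nonneg (weakGaugeTerm_nonneg i A)]
  exact weakGaugeTerm_le i A

theorem summable_weakGaugeTerm (A : X →L[ℂ] X) : Summable fun i => weakGaugeTerm i A :=
  Summable.of_norm_bounded summable_geometric_two fun i => norm_weakGaugeTerm_le i A

theorem weakGauge_nonneg (A : X →L[ℂ] X) : 0 ≤ weakGauge A :=
  tsum_nonneg fun i => weakGaugeTerm_nonneg i A

theorem weakGauge_le (A : X →L[ℂ] X) : weakGauge A ≤ 2 := by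
  rw [← tsum_geometric_two]
  exact (summable_weakGaugeTerm A).tsum_le_tsum (fun i => weakGaugeTerm_le i A)
    summable_geometric_two

theorem norm_weakGauge_le (A : X →L[ℂ] X) : ‖weakGauge A‖ ≤ 2 := by
  rw [Real.norm_of_nonneg (weakGauge_nonneg A)]
  exact weakGauge_le A

theorem continuous_weakGauge_comp {α : Type*} [TopologicalSpace α] {T : α → X →L[ℂ] X}
    (hT : ∀ x, Continuous fun t => T t x) : Continuous fun t => weakGauge (T t) := by
  refine continuous_tsum (fun i => ?_) summable_geometric_two
    fun i t => norm_weakGaugeTerm_le i (T t)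
  unfold weakGaugeTerm
  have := hT (TopologicalSpace.denseSeq X i.unpair.1)
  fun_prop

/-- On bounded sets of operators, `weakGauge A → 0` implies that `A → 0` weakly. -/
theorem tendsto_apply_of_tendsto_weakGauge {α : Type*} {l : Filter α} {A : α → X →L[ℂ] X} {K : ℝ}
    (hK : ∀ a, ‖A a‖ ≤ K) (h : Tendsto (fun a => weakGauge (A a)) l (𝓝 0)) (x : X)
    (x' : StrongDual ℂ X) : Tendsto (fun a => x' (A a x)) l (𝓝 0) := by
  rcases isEmpty_or_nonempty α with hα | ⟨⟨a₀⟩⟩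
  · rw [filter_eq_bot_of_isEmpty l]; exact tendsto_bot
  have hK0 : 0 ≤ K := (norm_nonneg _).trans (hK a₀)
  have hterm : ∀ i, Tendsto (fun a => weakGaugeTerm i (A a)) l (𝓝 0) := fun i =>
    squeeze_zero (fun a => weakGaugeTerm_nonneg i _)
      (fun a => (summable_weakGaugeTerm (A a)).le_tsum i fun j _ => weakGaugeTerm_nonneg j _) h
  rw [Metric.tendsto_nhds]
  intro ε hε
  obtain ⟨η, hη0, hη1, hη⟩ : ∃ η > 0, η < 1 ∧ η + η * (K * (‖x‖ + 1)) + ‖x'‖ * (K * η) < ε := by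
    have hc : Continuous fun η : ℝ => η + η * (K * (‖x‖ + 1)) + ‖x'‖ * (K * η) := by fun_prop
    have h1 : ∀ᶠ η in 𝓝[>] (0 : ℝ), η + η * (K * (‖x‖ + 1)) + ‖x'‖ * (K * η) < ε :=
      ((hc.tendsto 0).mono_left nhdsWithin_le_nhds).eventually (gt_mem_nhds (by simpa using hε))
    obtain ⟨η, h2, h3, h4⟩ := (h1.and ((Ioo_mem_nhdsGT one_pos))).exists
    exact ⟨η, h3, h4, h2⟩
  obtain ⟨_, hj, j, rfl⟩ := Metric.dense_iff.1 (TopologicalSpace.denseRange_denseSeq X) x η hη0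
  obtain ⟨_, hk, k, rfl⟩ := Metric.dense_iff.1
    (TopologicalSpace.denseRange_denseSeq (StrongDual ℂ X)) x' η hη0
  have hj : ‖TopologicalSpace.denseSeq X j - x‖ < η := by rw [← dist_eq_norm]; exact hj
  have hk : ‖TopologicalSpace.denseSeq (StrongDual ℂ X) k - x'‖ < η := by
    rw [← dist_eq_norm]; exact hk
  set y := TopologicalSpace.denseSeq X j with hy
  set y' := TopologicalSpace.denseSeq (StrongDual ℂ X) k with hy'
  have h1 : ∀ᶠ a in l, ‖y' (A a y)‖ < η := by
    have h2 := (hterm (Nat.pair j k)).eventually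
      (gt_mem_nhds (show 0 < (1 / 2 : ℝ) ^ Nat.pair j k * η by positivity))
    filter_upwards [h2] with a ha
    simp only [weakGaugeTerm, Nat.unpair_pair] at ha
    have h3 := lt_of_mul_lt_mul_left ha (by positivity)
    exact (min_lt_iff.1 h3).resolve_left (not_lt.2 hη1.le)
  filter_upwards [h1] with a ha
  rw [dist_zero_right]
  have e : x' (A a x) = y' (A a y) - (y' - x') (A a y) - x' (A a (y - x)) := by
    simp
  have hyn : ‖y‖ ≤ ‖x‖ + 1 := by
    have := norm_sub_norm_le y x
    linarith
  have b1 : ‖(y' - x') (A a y)‖ ≤ η * (K * (‖x‖ + 1)) :=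
    (y' - x').le_of_opNorm_le_of_le hk.le
      (((A a).le_of_opNorm_le (hK a) y).trans (by gcongr))
  have b2 : ‖x' (A a (y - x))‖ ≤ ‖x'‖ * (K * η) :=
    x'.le_of_opNorm_le_of_le le_rfl (((A a).le_of_opNorm_le (hK a) (y - x)).trans (by gcongr))
  rw [e]
  have b3 := norm_sub_le (y' (A a y) - (y' - x') (A a y)) (x' (A a (y - x)))
  have b4 := norm_sub_le (y' (A a y)) ((y' - x') (A a y))
  linarith

/-- Cesàro means of `weakGauge` tend to zero as soon as those of all matrix coefficients do. -/
theorem tendsto_cesaro_weakGauge {A : ℕ → X →L[ℂ] X}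
    (h : ∀ x (x' : StrongDual ℂ X), Tendsto (cesaro fun n => ‖x' (A n x)‖) atTop (𝓝 0)) :
    Tendsto (cesaro fun n => weakGauge (A n)) atTop (𝓝 0) := by
  have h1 : (cesaro fun n => weakGauge (A n)) = fun N => ∑' i, cesaro (fun n => weakGaugeTerm i (A n)) N := by
    ext N
    simp only [cesaro, weakGauge, smul_eq_mul]
    rw [tsum_mul_left, Summable.tsum_finsetSum fun n _ => summable_weakGaugeTerm (A n)]
  rw [h1]
  have h2 : (0 : ℝ) = ∑' _ : ℕ, (0 : ℝ) := by simp
  rw [h2]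
  refine tendsto_tsum_of_dominated_convergence summable_geometric_two (fun i => ?_)
    (Eventually.of_forall fun N i => norm_cesaro_le (fun n => norm_weakGaugeTerm_le i (A n)) N)
  have h3 := (h (TopologicalSpace.denseSeq X i.unpair.1)
    (TopologicalSpace.denseSeq (StrongDual ℂ X) i.unpair.2)).const_mul ((1 / 2) ^ i)
  rw [mul_zero] at h3
  refine squeeze_zero (cesaro_nonneg fun n => weakGaugeTerm_nonneg i _) (fun N => ?_) h3
  rw [← smul_eq_mul, ← cesaro_smul]
  refine cesaro_mono (fun n => ?_) N
  unfold weakGaugeTerm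
  rw [smul_eq_mul]
  gcongr
  exact min_le_right _ _

end Gauge

/-! ### Almost weak stability of a single semigroup -/

section Stability

variable {X : Type*} [NormedAddCommGroup X] [NormedSpace ℂ X] {T : ℝ≥0 → X →L[ℂ] X}

/-- An almost weakly stable semigroup has no eigenvectors for imaginary eigenvalues. -/
theorem IsAlmostWeaklyStable.forall_notMem_pointSpectrum (h : IsAlmostWeaklyStable T)
    (hT : IsC0Semigroup T) {z : ℂ} (hz : z.re = 0) : z ∉ pointSpectrum (generator T) := by
  intro hmem
  obtain ⟨x, hx0, hx⟩ := (mem_pointSpectrum_generator_iff hT).1 hmem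
  obtain ⟨M, hM, hlim⟩ := h
  have := hM.neBot
  obtain ⟨x', hx'⟩ := SeparatingDual.exists_ne_zero (R := ℂ) hx0
  rw [ContinuousLinearMapWOT.tendsto_iff_forall_dual_apply_tendsto] at hlim
  have h1 := (hlim x x').norm
  have h2 : ∀ t : ℝ, ‖x' (T t.toNNReal x)‖ = ‖x' x‖ := by
    intro t
    rw [hx, map_smul, norm_smul, Complex.norm_exp]
    simp [hz]
  have h3 : Tendsto (fun t : ℝ => ‖x' (T t.toNNReal x)‖) (atTop ⊓ 𝓟 M) (𝓝 0) := by
    simpa using h1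
  simp_rw [h2] at h3
  exact hx' (norm_eq_zero.1 (tendsto_nhds_unique tendsto_const_nhds h3))

/-- For a bounded semigroup on a separable reflexive space, the Cesàro means of the weak gauge tend to
zero if the generator has no imaginary eigenvalues. -/
theorem tendsto_cesaro_weakGauge_of_forall_notMem_pointSpectrum [CompleteSpace X]
    [TopologicalSpace.SeparableSpace X] [TopologicalSpace.SeparableSpace (StrongDual ℂ X)]
    (hX : IsReflexive X) (hT : IsC0Semigroup T) {K : ℝ}
    (hK : ∀ t, ‖T t‖ ≤ K) (h : ∀ z : ℂ, z.re = 0 → z ∉ pointSpectrum (generator T)) {δ : ℝ}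
    (hδ : 0 ≤ δ) : Tendsto (cesaro fun n : ℕ => weakGauge (T ((n : ℝ) + δ).toNNReal)) atTop (𝓝 0) :=
  tendsto_cesaro_weakGauge fun x x' => by
    have := tendsto_cesaro_of_forall_notMem_pointSpectrum hX hT hK h δ.toNNReal x x'
    refine this.congr fun N => ?_
    congr 1 with n
    rw [Real.toNNReal_add n.cast_nonneg hδ, Real.toNNReal_natCast]

/-- A bounded semigroup on a separable reflexive space is almost weakly stable if and only if its
generator has no imaginary eigenvalues. -/
theorem isAlmostWeaklyStable_iff_forall_notMem_pointSpectrum [CompleteSpace X]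
    [TopologicalSpace.SeparableSpace X] (hX : IsReflexive X) (hT : IsC0Semigroup T) {K : ℝ}
    (hK : ∀ t, ‖T t‖ ≤ K) :
    IsAlmostWeaklyStable T ↔ ∀ z : ℂ, z.re = 0 → z ∉ pointSpectrum (generator T) := by
  refine ⟨fun h z hz => h.forall_notMem_pointSpectrum hT hz, fun h => ?_⟩
  have := hX.separableSpace_strongDual
  obtain ⟨M, hM, hlim⟩ := exists_hasDensityOne_tendsto
    (continuous_weakGauge_comp hT.continuous_toNNReal) (fun t => weakGauge_nonneg _)
    (fun t => weakGauge_le _)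
    (fun δ hδ => tendsto_cesaro_weakGauge_of_forall_notMem_pointSpectrum hX hT hK h hδ.1)
  refine ⟨M, hM, ?_⟩
  rw [ContinuousLinearMapWOT.tendsto_iff_forall_dual_apply_tendsto]
  intro x x'
  simpa using tendsto_apply_of_tendsto_weakGauge (fun t : ℝ => hK t.toNNReal) hlim x x'

end Stability

/-! ### The vector measure of a functional on `L^p(Ω, X)` -/

section DualMeasure

variable {Ω : Type*} [MeasurableSpace Ω] {μ : Measure Ω} {X : Type*} [NormedAddCommGroup X]
  {p : ℝ≥0∞} [Fact (1 ≤ p)] {A : Set Ω}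

/-- Dominated convergence in `L^p` for `p < ∞`. -/
theorem tendsto_Lp_of_dominated (hp : p ≠ ∞) {F : ℕ → Lp X p μ} {f : Lp X p μ} {G : Ω → ℝ}
    (hG : MemLp G p μ) (hF : ∀ n, ∀ᵐ s ∂μ, ‖F n s‖ ≤ G s)
    (hlim : ∀ᵐ s ∂μ, Tendsto (fun n => F n s) atTop (𝓝 (f s))) : Tendsto F atTop (𝓝 f) := by
  have hp0 : p ≠ 0 := (one_pos.trans_le (Fact.out : 1 ≤ p)).ne'
  have hpr : 0 < p.toReal := ENNReal.toReal_pos hp0 hp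
  have hf : ∀ᵐ s ∂μ, ‖f s‖ ≤ G s := by
    filter_upwards [hlim, ae_all_iff.2 hF] with s h1 h2
    exact le_of_tendsto h1.norm (Eventually.of_forall h2)
  rw [Lp.tendsto_Lp_iff_tendsto_eLpNorm']
  simp_rw [eLpNorm_eq_lintegral_rpow_enorm_toReal hp0 hp]
  have hint : Tendsto (fun n => ∫⁻ s, ‖(⇑(F n) - ⇑f) s‖ₑ ^ p.toReal ∂μ) atTop (𝓝 0) := by
    have h0 : (0 : ℝ≥0∞) = ∫⁻ _, 0 ∂μ := by simp
    rw [h0]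
    refine tendsto_lintegral_of_dominated_convergence' (fun s => ‖(2 : ℝ) * G s‖ₑ ^ p.toReal)
      (fun n => ?_) (fun n => ?_) ?_ ?_
    · exact (((Lp.aestronglyMeasurable (F n)).sub (Lp.aestronglyMeasurable f)).enorm).pow_const _
    · filter_upwards [hF n, hf] with s h1 h2
      gcongr
      rw [enorm_le_iff_norm_le, Pi.sub_apply]
      have h3 := norm_sub_le (F n s) (f s)
      have h4 := le_abs_self (2 * G s)
      rw [Real.norm_eq_abs]
      linarith
    · exact (lintegral_rpow_enorm_lt_top_of_eLpNorm_lt_top hp0 hp (hG.const_mul 2).2).ne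
    · filter_upwards [hlim] with s hs
      have h1 : Tendsto (fun n => ‖(⇑(F n) - ⇑f) s‖ₑ) atTop (𝓝 0) := by
        have := (tendsto_sub_nhds_zero_iff.2 hs).enorm
        simpa using this
      have h2 := (ENNReal.continuous_rpow_const (y := p.toReal)).tendsto 0 |>.comp h1
      rw [ENNReal.zero_rpow_of_pos hpr] at h2
      exact h2
  have h5 := (ENNReal.continuous_rpow_const (y := 1 / p.toReal)).tendsto 0 |>.comp hint
  rw [ENNReal.zero_rpow_of_pos (by positivity)] at h5
  exact h5

omit [Fact (1 ≤ p)] in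
/-- Indicators of disjoint subsets of `A` with values in the unit ball add up to a function of norm at
most `‖1_A‖`. -/
theorem norm_sum_indicatorConstLp_le {P : Finset (Set Ω)} (hPd : (P : Set (Set Ω)).PairwiseDisjoint id)
    (hPm : ∀ t ∈ P, MeasurableSet t) (hA : MeasurableSet A) (hμA : μ A ≠ ∞) {x : Set Ω → X}
    (hx : ∀ t, ‖x t‖ ≤ 1) :
    ‖∑ t ∈ P.attach, indicatorConstLp p ((hPm t t.2).inter hA)
      (measure_ne_top_of_subset inter_subset_right hμA) (x t)‖ ≤ μ.real A ^ (1 / p.toReal) := by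
  have h1 : ‖indicatorConstLp p hA hμA (1 : ℝ)‖ ≤ μ.real A ^ (1 / p.toReal) := by
    have := norm_indicatorConstLp_le (p := p) (c := (1 : ℝ)) (hs := hA) (hμs := hμA)
    simpa using this
  refine le_trans (Lp.norm_le_norm_of_ae_le (g := indicatorConstLp p hA hμA (1 : ℝ)) ?_) h1
  have h2 : ∀ᵐ s ∂μ, ∀ t : P, indicatorConstLp p ((hPm t t.2).inter hA)
      (measure_ne_top_of_subset inter_subset_right hμA) (x t) s = ((t : Set Ω) ∩ A).indicator
        (fun _ => x t) s := ae_all_iff.2 fun t => indicatorConstLp_coeFn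
  filter_upwards [h2, Lp.coeFn_finsetSum (μ := μ) P.attach fun t : P =>
    indicatorConstLp p ((hPm t t.2).inter hA)
      (measure_ne_top_of_subset inter_subset_right hμA) (x t),
    indicatorConstLp_coeFn (p := p) (hs := hA) (hμs := hμA) (c := (1 : ℝ))] with s hs1 hs2 hs3
  rw [hs2, hs3, Finset.sum_apply, Finset.sum_congr rfl fun t _ => hs1 t]
  by_cases hsA : s ∈ A
  · rw [indicator_of_mem hsA, norm_one]
    by_cases hex : ∃ t : P, s ∈ (t : Set Ω)
    · obtain ⟨t, ht⟩ := hex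
      rw [Finset.sum_eq_single t]
      · rw [indicator_of_mem (show s ∈ (t : Set Ω) ∩ A from ⟨ht, hsA⟩)]; exact hx _
      · intro t' _ hne
        rw [indicator_of_notMem]
        intro h'
        exact (hPd t'.2 t.2 fun h => hne (Subtype.ext h)).le_bot ⟨h'.1, ht⟩
      · exact fun h => absurd (Finset.mem_attach _ _) h
    · push Not at hex
      rw [Finset.sum_eq_zero fun (t : P) _ => indicator_of_notMem (fun h : s ∈ (t : Set Ω) ∩ A => hex t h.1) _]
      simp
  · rw [Finset.sum_eq_zero fun (t : P) _ => indicator_of_notMem (fun h : s ∈ (t : Set Ω) ∩ A => hsA h.2) _]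
    simp

variable [NormedSpace ℝ X]

/-- The bounded operator `x ↦ 1_s x` from `X` to `L^p(Ω, X)`. -/
noncomputable def indicatorCLM (p : ℝ≥0∞) [Fact (1 ≤ p)] {s : Set Ω} (hs : MeasurableSet s)
    (hμs : μ s ≠ ∞) : X →L[ℝ] Lp X p μ :=
  LinearMap.mkContinuous
    { toFun := fun x => indicatorConstLp p hs hμs x
      map_add' := fun x y => (indicatorConstLp_add).symm
      map_smul' := fun c x => by
        simp only [indicatorConstLp, RingHom.id_apply]
        rw [← MemLp.toLp_const_smul]
        congr 1
        exact indicator_const_smul s c (fun _ => x) }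
    (μ.real s ^ (1 / p.toReal))
    (fun x => by
      rw [mul_comm]
      exact norm_indicatorConstLp_le (hs := hs) (hμs := hμs))

theorem norm_indicatorCLM_le {s : Set Ω} (hs : MeasurableSet s) (hμs : μ s ≠ ∞) :
    ‖(indicatorCLM p hs hμs : X →L[ℝ] Lp X p μ)‖ ≤ μ.real s ^ (1 / p.toReal) :=
  LinearMap.mkContinuous_norm_le _ (by positivity) _

open Classical in
/-- The set function `s ↦ (x ↦ φ (1_{s ∩ A} x))` attached to a functional `φ` on `L^p(Ω, X)`. -/
noncomputable def dualSetFun (φ : Lp X p μ →L[ℝ] ℝ) (hA : MeasurableSet A) (hμA : μ A ≠ ∞)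
    (s : Set Ω) : X →L[ℝ] ℝ :=
  if hs : MeasurableSet s then
    φ.comp (indicatorCLM p (hs.inter hA) (measure_ne_top_of_subset inter_subset_right hμA))
  else 0

variable {φ : Lp X p μ →L[ℝ] ℝ} {hA : MeasurableSet A} {hμA : μ A ≠ ∞}

theorem dualSetFun_apply {s : Set Ω} (hs : MeasurableSet s) (x : X) :
    dualSetFun φ hA hμA s x = φ (indicatorConstLp p (hs.inter hA)
      (measure_ne_top_of_subset inter_subset_right hμA) x) := by
  rw [dualSetFun, dif_pos hs]; rfl

theorem norm_dualSetFun_le {s : Set Ω} (hs : MeasurableSet s) :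
    ‖dualSetFun φ hA hμA s‖ ≤ ‖φ‖ * μ.real (s ∩ A) ^ (1 / p.toReal) := by
  rw [dualSetFun, dif_pos hs]
  refine (ContinuousLinearMap.opNorm_comp_le _ _).trans ?_
  gcongr
  exact norm_indicatorCLM_le _ _

theorem dualSetFun_union {s t : Set Ω} (hs : MeasurableSet s) (ht : MeasurableSet t)
    (hst : Disjoint s t) :
    dualSetFun φ hA hμA (s ∪ t) = dualSetFun φ hA hμA s + dualSetFun φ hA hμA t := by
  ext x
  rw [add_apply, dualSetFun_apply hs, dualSetFun_apply ht, dualSetFun_apply (hs.union ht), ← map_add]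
  have hd : Disjoint (s ∩ A) (t ∩ A) := hst.mono inter_subset_left inter_subset_left
  rw [← indicatorConstLp_disjoint_union (hs.inter hA) (ht.inter hA) _ _ hd]
  congr 2
  exact union_inter_distrib_right s t A

theorem dualSetFun_empty : dualSetFun φ hA hμA (∅ : Set Ω) = 0 := by
  have := dualSetFun_union (φ := φ) (hA := hA) (hμA := hμA) MeasurableSet.empty MeasurableSet.empty
    (disjoint_empty _)
  simpa using this

theorem dualSetFun_biUnion_finset (F : Finset ℕ) {f : ℕ → Set Ω} (hf : ∀ i, MeasurableSet (f i))
    (hd : Pairwise (Function.onFun Disjoint f)) :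
    dualSetFun φ hA hμA (⋃ i ∈ F, f i) = ∑ i ∈ F, dualSetFun φ hA hμA (f i) := by
  classical
  induction F using Finset.induction_on with
  | empty => simp [dualSetFun_empty]
  | insert a F ha ih =>
    rw [Finset.set_biUnion_insert, Finset.sum_insert ha, dualSetFun_union (hf a)
      (Finset.measurableSet_biUnion _ fun i _ => hf i), ih]
    rw [disjoint_iUnion₂_right]
    intro i hi
    exact hd (fun h => ha (h ▸ hi))

/-- The set function `s ↦ (x ↦ φ (1_{s ∩ A} x))` as a countably additive measure with values in the
dual of `X`. -/
noncomputable def dualMeasure (hp : p ≠ ∞) (φ : Lp X p μ →L[ℝ] ℝ) (hA : MeasurableSet A)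
    (hμA : μ A ≠ ∞) : VectorMeasure Ω (X →L[ℝ] ℝ) where
  measureOf' := dualSetFun φ hA hμA
  empty' := dualSetFun_empty
  not_measurable' := fun s hs => dif_neg hs
  m_iUnion' f hf hd := by
    have hpr : 0 < p.toReal :=
      ENNReal.toReal_pos (one_pos.trans_le (Fact.out : 1 ≤ p)).ne' hp
    -- the unions of the sets not yet summed decrease to the empty set, and so do their measures in `A`
    let E : Finset ℕ → Set Ω := fun F => (⋃ i, f i) \ ⋃ i ∈ F, f i
    have hE : ∀ F, MeasurableSet (E F) := fun F =>
      (MeasurableSet.iUnion hf).diff (Finset.measurableSet_biUnion _ fun i _ => hf i)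
    have hsum : ∀ F : Finset ℕ, dualSetFun φ hA hμA (⋃ i, f i) - ∑ i ∈ F, dualSetFun φ hA hμA (f i)
        = dualSetFun φ hA hμA (E F) := by
      intro F
      rw [← dualSetFun_biUnion_finset F hf hd, sub_eq_iff_eq_add, ← dualSetFun_union (hE F)
        (Finset.measurableSet_biUnion _ fun i _ => hf i) disjoint_sdiff_left,
        sdiff_union_of_subset (iUnion₂_subset fun i _ => subset_iUnion f i)]
    have hlim : Tendsto (fun F => (μ.restrict A) (E F)) atTop (𝓝 0) := by
      have h1 := tendsto_measure_iInter_atTop (μ := μ.restrict A) (s := E)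
        (fun F => (hE F).nullMeasurableSet)
        (fun F F' hFF' => sdiff_subset_sdiff_right (biUnion_subset_biUnion_left hFF'))
        ⟨∅, by
          rw [Measure.restrict_apply (hE _)]
          exact measure_ne_top_of_subset inter_subset_right hμA⟩
      have h2 : ⋂ F, E F = ∅ := by
        rw [eq_empty_iff_forall_notMem]
        intro s hs
        obtain ⟨i, hi⟩ := mem_iUnion.1 (mem_iInter.1 hs ∅).1
        exact (mem_iInter.1 hs {i}).2 (by simpa using hi)
      rwa [h2, measure_empty] at h1
    have hlim' : Tendsto (fun F => ‖φ‖ * μ.real (E F ∩ A) ^ (1 / p.toReal)) atTop (𝓝 0) := by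
      have h1 := (ENNReal.tendsto_toReal ENNReal.zero_ne_top).comp hlim
      have h2 := ((Real.continuous_rpow_const (q := 1 / p.toReal) (by positivity)).tendsto _).comp h1
      have h3 := h2.const_mul ‖φ‖
      rw [ENNReal.toReal_zero, Real.zero_rpow (by positivity), mul_zero] at h3
      refine h3.congr fun F => ?_
      simp only [Function.comp_apply, Measure.restrict_apply (hE F), measureReal_def]
    rw [HasSum]
    refine tendsto_iff_norm_sub_tendsto_zero.2 (squeeze_zero (fun _ => norm_nonneg _) (fun F => ?_) hlim')
    rw [norm_sub_rev, hsum]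
    exact norm_dualSetFun_le (hE F)

theorem dualMeasure_apply (hp : p ≠ ∞) {s : Set Ω} (hs : MeasurableSet s) (x : X) :
    dualMeasure hp φ hA hμA s x = φ (indicatorConstLp p (hs.inter hA)
      (measure_ne_top_of_subset inter_subset_right hμA) x) :=
  dualSetFun_apply (hA := hA) (hμA := hμA) hs x

/-- Finitely many functionals `ψ i` satisfy `∑ ‖ψ i‖ ≤ b` as soon as `∑ ψ i (x i) ≤ b` for all vectors
`x i` in the unit ball. -/
theorem sum_norm_le_of_forall_sum_apply_le {ι : Type*} {P : Finset ι} {ψ : ι → X →L[ℝ] ℝ} {b : ℝ}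
    (h : ∀ x : ι → X, (∀ i, ‖x i‖ ≤ 1) → ∑ i ∈ P, ψ i (x i) ≤ b) : ∑ i ∈ P, ‖ψ i‖ ≤ b := by
  have key : ∀ θ : ℝ, 0 ≤ θ → θ < 1 → θ * ∑ i ∈ P, ‖ψ i‖ ≤ b := by
    intro θ hθ0 hθ
    have hx : ∀ i, ∃ x : X, ‖x‖ ≤ 1 ∧ θ * ‖ψ i‖ ≤ ψ i x := by
      intro i
      rcases eq_or_ne (ψ i) 0 with h0 | h0
      · exact ⟨0, by simp, by simp [h0]⟩
      · obtain ⟨x, hx1, hx2⟩ := (ψ i).exists_lt_apply_of_lt_opNorm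
          (mul_lt_of_lt_one_left (norm_pos_iff.2 h0) hθ)
        rcases le_total 0 (ψ i x) with h1 | h1
        · exact ⟨x, hx1.le, by rw [Real.norm_of_nonneg h1] at hx2; exact hx2.le⟩
        · refine ⟨-x, by rw [norm_neg]; exact hx1.le, ?_⟩
          rw [Real.norm_of_nonpos h1] at hx2
          rw [map_neg]; exact hx2.le
    choose x hx1 hx2 using hx
    rw [Finset.mul_sum]
    exact (Finset.sum_le_sum fun i _ => hx2 i).trans (h x hx1)
  have hlim : Tendsto (fun θ : ℝ => θ * ∑ i ∈ P, ‖ψ i‖) (𝓝[<] 1) (𝓝 (1 * ∑ i ∈ P, ‖ψ i‖)) :=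
    ((continuous_id.mul continuous_const).tendsto 1).mono_left nhdsWithin_le_nhds
  rw [one_mul] at hlim
  refine le_of_tendsto hlim ?_
  filter_upwards [Ioo_mem_nhdsLT (zero_lt_one' ℝ)] with θ hθ using key θ hθ.1.le hθ.2

/-- The variation of `dualMeasure`. -/
noncomputable def dualVariation (hp : p ≠ ∞) (φ : Lp X p μ →L[ℝ] ℝ) (hA : MeasurableSet A)
    (hμA : μ A ≠ ∞) : Measure Ω :=
  VectorMeasure.variation (V := X →L[ℝ] ℝ) (dualMeasure hp φ hA hμA)

theorem variation_univ_le {V : Type*} [NormedAddCommGroup V] {m : VectorMeasure Ω V} {b : ℝ}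
    (h : ∀ P : Finset (Set Ω), (P : Set (Set Ω)).PairwiseDisjoint id →
      (∀ t ∈ P, MeasurableSet t) → ∑ t ∈ P, ‖m t‖ ≤ b) : m.variation univ ≤ ENNReal.ofReal b := by
  by_contra! hcon
  obtain ⟨P, -, hPd, hPm, hlt⟩ := m.exists_lt_sum_of_lt_variation MeasurableSet.univ hcon
  refine absurd (ENNReal.ofReal_le_ofReal (h P hPd hPm)) (not_le.2 ?_)
  rw [ENNReal.ofReal_sum_of_nonneg fun _ _ => norm_nonneg _,
    Finset.sum_congr rfl fun t _ => ofReal_norm (m t)]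
  exact hlt

/-- For disjoint sets `t` and vectors `x t` in the unit ball, the sum of the values `φ (1_{t ∩ A} x t)` is the value of
`φ` at a function of norm at most `‖1_A‖`; thus the variation is finite. -/
theorem isFiniteMeasure_dualVariation (hp : p ≠ ∞) : IsFiniteMeasure (dualVariation hp φ hA hμA) := by
  refine ⟨lt_of_le_of_lt ?_ (ENNReal.ofReal_lt_top (r := ‖φ‖ * μ.real A ^ (1 / p.toReal)))⟩
  refine variation_univ_le (V := X →L[ℝ] ℝ) (m := dualMeasure hp φ hA hμA) fun P hPd hPm => ?_
  refine sum_norm_le_of_forall_sum_apply_le (ψ := dualSetFun φ hA hμA) fun x hx => ?_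
  rw [← Finset.sum_attach]
  rw [Finset.sum_congr rfl fun (t : P) _ => dualSetFun_apply (φ := φ) (hA := hA) (hμA := hμA)
    (hPm t t.2) (x t), ← map_sum]
  refine (le_abs_self _).trans ((φ.le_opNorm _).trans ?_)
  gcongr
  exact norm_sum_indicatorConstLp_le hPd hPm hA hμA hx

theorem norm_dualSetFun_le_dualVariation (hp : p ≠ ∞) (s : Set Ω) :
    ‖dualSetFun φ hA hμA s‖ ≤ (dualVariation hp φ hA hμA).real s := by
  have := isFiniteMeasure_dualVariation (φ := φ) (hA := hA) (hμA := hμA) hp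
  exact VectorMeasure.norm_measure_le_variation (V := X →L[ℝ] ℝ) (μ := dualMeasure hp φ hA hμA)
    (measure_ne_top (dualVariation hp φ hA hμA) s)

theorem dualVariation_absolutelyContinuous (hp : p ≠ ∞) : dualVariation hp φ hA hμA ≪ μ := by
  refine Measure.AbsolutelyContinuous.mk fun B hB h0 => ?_
  refine (VectorMeasure.variation_apply_eq_zero (V := X →L[ℝ] ℝ) hB).2 fun t ht htm => ?_
  refine ContinuousLinearMap.ext fun x => ?_
  have h1 : indicatorConstLp p (htm.inter hA)
      (measure_ne_top_of_subset inter_subset_right hμA) x = 0 := by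
    rw [← norm_eq_zero]
    refine le_antisymm ?_ (norm_nonneg _)
    refine norm_indicatorConstLp_le.trans ?_
    have h2 : μ.real (t ∩ A) = 0 := by
      rw [measureReal_def, measure_mono_null (inter_subset_left.trans ht) h0, ENNReal.toReal_zero]
    have hpr : 0 < p.toReal :=
      ENNReal.toReal_pos (one_pos.trans_le (Fact.out : 1 ≤ p)).ne' hp
    rw [h2, Real.zero_rpow (by positivity), mul_zero]
  rw [dualMeasure_apply hp htm, h1, map_zero]
  rfl

end DualMeasure

/-! ### Weak densities and pointwise criteria for weak convergence -/

section DualDensity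

/-- An additive map on a dense subgroup of `X` that is bounded by the norm extends to a functional of
norm at most one. -/
theorem exists_continuousLinearMap_extending {G X : Type*} [AddCommGroup G] [NormedAddCommGroup X]
    [NormedSpace ℝ X] {L : G →+ X} (hL : DenseRange L) {h : G → ℝ}
    (hadd : ∀ a b, h (a + b) = h a + h b) (hle : ∀ a, |h a| ≤ ‖L a‖) :
    ∃ Λ : X →L[ℝ] ℝ, ‖Λ‖ ≤ 1 ∧ ∀ a, Λ (L a) = h a := by
  let h' : G →+ ℝ := AddMonoidHom.mk' h hadd
  have hsub : ∀ a b, |h a - h b| ≤ ‖L a - L b‖ := fun a b => by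
    have := hle (a - b)
    rwa [map_sub, show h (a - b) = h a - h b from map_sub h' a b] at this
  let f : X → ℝ := fun x => by
    classical exact if hx : ∃ a, L a = x then h hx.choose else 0
  have hf : ∀ a, f (L a) = h a := by
    intro a
    have hx : ∃ b, L b = L a := ⟨a, rfl⟩
    have h1 : f (L a) = h hx.choose := dif_pos hx
    have h2 := hsub hx.choose a
    rw [hx.choose_spec, sub_self, norm_zero] at h2
    rw [h1]
    exact sub_eq_zero.1 (abs_nonpos_iff.1 h2)
  have hlip : LipschitzOnWith 1 f (range L) := by
    refine LipschitzOnWith.of_dist_le_mul ?_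
    rintro _ ⟨a, rfl⟩ _ ⟨b, rfl⟩
    rw [hf, hf, Real.dist_eq, dist_eq_norm, NNReal.coe_one, one_mul]
    exact hsub a b
  obtain ⟨F, hF, hFf⟩ := hlip.extend_real
  have hFL : ∀ a, F (L a) = h a := fun a => by rw [← hFf ⟨a, rfl⟩, hf]
  have hFadd : ∀ x y, F (x + y) = F x + F y := by
    intro x y
    refine hL.induction_on₂ (p := fun x y => F (x + y) = F x + F y) ?_ ?_ x y
    · exact isClosed_eq (hF.continuous.comp continuous_add)
        ((hF.continuous.comp continuous_fst).add (hF.continuous.comp continuous_snd))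
    · intro a b
      rw [← map_add, hFL, hFL, hFL, hadd]
  refine ⟨AddMonoidHom.toRealLinearMap (AddMonoidHom.mk' F hFadd) hF.continuous, ?_, hFL⟩
  refine ContinuousLinearMap.opNorm_le_bound _ zero_le_one fun x => ?_
  have h0 : F 0 = 0 := by simpa using hFadd 0 0
  have h1 := hF.dist_le_mul x 0
  rw [h0, dist_zero_right, dist_zero_right, NNReal.coe_one] at h1
  exact h1

theorem sum_indicator_fiber {Ω X Y : Type*} [MeasurableSpace Ω] {s : Ω} (F : SimpleFunc Ω X)
    [AddCommMonoid Y] (v : X → Y) :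
    ∑ x ∈ F.range, (F ⁻¹' {x}).indicator (fun _ => v x) s = v (F s) := by
  rw [Finset.sum_eq_single (F s)]
  · exact indicator_of_mem (s := F ⁻¹' {F s}) rfl _
  · intro x _ hx
    exact indicator_of_notMem (fun h => hx h.symm) _
  · exact fun h => absurd (F.mem_range_self s) h

variable {Ω : Type*} [MeasurableSpace Ω] {μ : Measure Ω} {X : Type*} [NormedAddCommGroup X]
  [NormedSpace ℝ X] {p : ℝ≥0∞} [Fact (1 ≤ p)] {A : Set Ω}
  {φ : Lp X p μ →L[ℝ] ℝ} {hA : MeasurableSet A} {hμA : μ A ≠ ∞}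

/-- The scalar measure `s ↦ φ (1_{s ∩ A} x)`. -/
noncomputable def dualSignedMeasure (hp : p ≠ ∞) (φ : Lp X p μ →L[ℝ] ℝ) (hA : MeasurableSet A)
    (hμA : μ A ≠ ∞) (x : X) : SignedMeasure Ω :=
  (dualMeasure hp φ hA hμA).mapRange (ContinuousLinearMap.apply ℝ ℝ x : (X →L[ℝ] ℝ) →+ ℝ)
    (ContinuousLinearMap.apply ℝ ℝ x).continuous

/-- The Radon-Nikodym density of `dualSignedMeasure` with respect to the variation. -/
theorem exists_integrable_setIntegral_eq (hp : p ≠ ∞) (x : X) :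
    ∃ h : Ω → ℝ, Integrable h (dualVariation hp φ hA hμA) ∧
      ∀ B, MeasurableSet B → ∫ s in B, h s ∂(dualVariation hp φ hA hμA) = dualSetFun φ hA hμA B x := by
  have := isFiniteMeasure_dualVariation (φ := φ) (hA := hA) (hμA := hμA) hp
  set m := dualSignedMeasure hp φ hA hμA x
  refine ⟨m.rnDeriv (dualVariation hp φ hA hμA), SignedMeasure.integrable_rnDeriv _ _, fun B hB => ?_⟩
  rw [← withDensityᵥ_apply (SignedMeasure.integrable_rnDeriv _ _) hB,
    SignedMeasure.withDensityᵥ_rnDeriv_eq]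
  · rfl
  · refine VectorMeasure.AbsolutelyContinuous.mk fun s hs h0 => ?_
    rw [Measure.toENNRealVectorMeasure_apply_measurable hs] at h0
    have h1 := norm_dualSetFun_le_dualVariation (φ := φ) (hA := hA) (hμA := hμA) hp s
    rw [measureReal_def, h0, ENNReal.toReal_zero, norm_le_zero_iff] at h1
    change dualSetFun φ hA hμA s x = 0
    rw [h1]; rfl

/-- A functional on `L^p(Ω, X)` has a weak density on sets of finite measure: a field `Λ` of functionals
in the unit ball representing `φ` on indicators with respect to the variation. -/
theorem exists_dual_density [TopologicalSpace.SeparableSpace X] (hp : p ≠ ∞) :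
    ∃ Λ : Ω → X →L[ℝ] ℝ, (∀ s, ‖Λ s‖ ≤ 1) ∧
      (∀ x, AEStronglyMeasurable (fun s => Λ s x) (dualVariation hp φ hA hμA)) ∧
      ∀ x B, MeasurableSet B →
        ∫ s in B, Λ s x ∂(dualVariation hp φ hA hμA) = dualSetFun φ hA hμA B x := by
  have := isFiniteMeasure_dualVariation (φ := φ) (hA := hA) (hμA := hμA) hp
  set lam := dualVariation hp φ hA hμA with hlam
  -- integer combinations of a dense sequence form a countable dense subgroup
  let L : (ℕ →₀ ℤ) →+ X :=
    (Finsupp.linearCombination ℤ (TopologicalSpace.denseSeq X)).toAddMonoidHom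
  have hL : DenseRange L := by
    refine (TopologicalSpace.denseRange_denseSeq X).mono ?_
    rintro _ ⟨n, rfl⟩
    exact ⟨Finsupp.single n 1, by simp [L]⟩
  choose h hint hB using fun c => exists_integrable_setIntegral_eq (φ := φ) (hA := hA) (hμA := hμA) hp
    (L c)
  have hadd : ∀ᵐ s ∂lam, ∀ a b, h (a + b) s = h a s + h b s := by
    refine ae_all_iff.2 fun a => ae_all_iff.2 fun b => ?_
    refine Integrable.ae_eq_of_forall_setIntegral_eq _ _ (hint _) ((hint a).add (hint b))
      fun B hBm _ => ?_
    rw [hB _ B hBm, integral_add (hint a).integrableOn (hint b).integrableOn, hB _ B hBm, hB _ B hBm,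
      map_add, map_add]
  have hle : ∀ᵐ s ∂lam, ∀ a, |h a s| ≤ ‖L a‖ := by
    refine ae_all_iff.2 fun a => ?_
    have hbd : ∀ B, MeasurableSet B → |∫ s in B, h a s ∂lam| ≤ ∫ s in B, ‖L a‖ ∂lam := by
      intro B hBm
      rw [hB a B hBm, setIntegral_const, smul_eq_mul]
      refine ((dualSetFun φ hA hμA B).le_opNorm _).trans ?_
      gcongr
      exact norm_dualSetFun_le_dualVariation hp B
    have h1 := ae_le_of_forall_setIntegral_le (hint a) (integrable_const ‖L a‖)
      fun B hBm _ => (le_abs_self _).trans (hbd B hBm)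
    have h2 := ae_le_of_forall_setIntegral_le (hint a).neg (integrable_const ‖L a‖)
      fun B hBm _ => by
        rw [integral_neg']
        exact (neg_le_abs _).trans (hbd B hBm)
    filter_upwards [h1, h2] with s h3 h4
    exact abs_le'.2 ⟨h3, h4⟩
  -- almost everywhere the densities are additive and bounded on the subgroup, so they extend to `X`
  have hex : ∀ s, ∃ Λ : X →L[ℝ] ℝ, ‖Λ‖ ≤ 1 ∧
      ((∀ a b, h (a + b) s = h a s + h b s) → (∀ a, |h a s| ≤ ‖L a‖) → ∀ a, Λ (L a) = h a s) := by
    intro s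
    by_cases hs : (∀ a b, h (a + b) s = h a s + h b s) ∧ ∀ a, |h a s| ≤ ‖L a‖
    · obtain ⟨Λ, h1, h2⟩ := exists_continuousLinearMap_extending hL hs.1 hs.2
      exact ⟨Λ, h1, fun _ _ => h2⟩
    · exact ⟨0, by simp, fun h1 h2 => absurd ⟨h1, h2⟩ hs⟩
  choose Λ hΛ1 hΛ2 using hex
  have hΛh : ∀ a, (fun s => Λ s (L a)) =ᵐ[lam] h a := fun a => by
    filter_upwards [hadd, hle] with s h1 h2 using hΛ2 s h1 h2 a
  have hmeas : ∀ x, AEStronglyMeasurable (fun s => Λ s x) lam := by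
    intro x
    obtain ⟨u, hu, hux⟩ := mem_closure_iff_seq_limit.1 (hL x)
    choose g hg using hu
    refine aestronglyMeasurable_of_tendsto_ae atTop (f := fun n s => Λ s (u n)) (fun n => ?_)
      (Eventually.of_forall fun s => ((Λ s).continuous.tendsto x).comp hux)
    rw [← hg n]
    exact (hint (g n)).aestronglyMeasurable.congr (hΛh _).symm
  refine ⟨Λ, hΛ1, hmeas, fun x B hBm => ?_⟩
  have hbound : ∀ s x, ‖Λ s x‖ ≤ ‖x‖ := fun s x =>
    ((Λ s).le_opNorm x).trans (mul_le_of_le_one_left (norm_nonneg _) (hΛ1 s))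
  have hi : ∀ x, Integrable (fun s => Λ s x) (lam.restrict B) := fun x =>
    Integrable.of_bound (hmeas x).restrict ‖x‖ (Eventually.of_forall fun s => hbound s x)
  refine hL.induction_on (p := fun x => ∫ s in B, Λ s x ∂lam = dualSetFun φ hA hμA B x) x ?_ ?_
  · refine isClosed_eq ?_ (dualSetFun φ hA hμA B).continuous
    refine (LipschitzWith.of_dist_le_mul (K := (lam.real B).toNNReal) fun x y => ?_).continuous
    rw [Real.coe_toNNReal _ measureReal_nonneg, Real.dist_eq, ← integral_sub (hi x) (hi y), mul_comm,
      dist_eq_norm]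
    simp_rw [← map_sub]
    exact norm_setIntegral_le_of_norm_le_const (measure_lt_top _ _) fun s _ => hbound s _
  · intro a
    rw [← hB a B hBm]
    exact integral_congr_ae (ae_restrict_of_ae (hΛh a))

/-- The density of a functional represents it on all bounded functions supported in `A`. -/
theorem apply_eq_integral_dual_density (hp : p ≠ ∞) {Λ : Ω → X →L[ℝ] ℝ} (hΛ1 : ∀ s, ‖Λ s‖ ≤ 1)
    (hΛm : ∀ x, AEStronglyMeasurable (fun s => Λ s x) (dualVariation hp φ hA hμA))
    (hΛ : ∀ x B, MeasurableSet B →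
        ∫ s in B, Λ s x ∂(dualVariation hp φ hA hμA) = dualSetFun φ hA hμA B x)
    {g : Lp X p μ} {C : ℝ} (hC : ∀ᵐ s ∂μ, ‖g s‖ ≤ C) (hgA : ∀ᵐ s ∂μ, s ∉ A → g s = 0) :
    AEStronglyMeasurable (fun s => Λ s (g s)) (dualVariation hp φ hA hμA) ∧
      φ g = ∫ s, Λ s (g s) ∂(dualVariation hp φ hA hμA) := by
  have := isFiniteMeasure_dualVariation (φ := φ) (hA := hA) (hμA := hμA) hp
  have hac := dualVariation_absolutelyContinuous (φ := φ) (hA := hA) (hμA := hμA) hp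
  set lam := dualVariation hp φ hA hμA with hlam
  -- for `C < 0` the measure `μ` vanishes
  rcases lt_or_ge C 0 with hC0 | hC0
  · have hμ0 : μ = 0 := by
      rw [← ae_eq_bot, ← Filter.eventually_false_iff_eq_bot]
      filter_upwards [hC] with s hs
      exact absurd ((norm_nonneg _).trans hs) (not_le.2 hC0)
    have hlam0 : lam = 0 := Measure.absolutelyContinuous_zero_iff.1 (hμ0 ▸ hac)
    have hg0 : g = 0 := by
      rw [Lp.eq_zero_iff_ae_eq_zero]
      filter_upwards [hC] with s hs
      exact absurd ((norm_nonneg _).trans hs) (not_le.2 hC0)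
    rw [hlam0, hg0]
    simp
  have hgm : StronglyMeasurable g := Lp.stronglyMeasurable g
  -- simple functions `F k` bounded by `C` converging to `g`; `G k` is the class of `1_A F k`
  let F : ℕ → SimpleFunc Ω X := fun k => hgm.approxBounded C k
  have hFlim : ∀ᵐ s ∂μ, Tendsto (fun k => F k s) atTop (𝓝 (g s)) := by
    filter_upwards [hC] with s hs using hgm.tendsto_approxBounded_of_norm_le hs
  have hFC : ∀ k s, ‖F k s‖ ≤ C := fun k s => hgm.norm_approxBounded_le hC0 k s
  let G : ℕ → Lp X p μ := fun k => ∑ x ∈ (F k).range, indicatorConstLp p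
    (((F k).measurableSet_fiber x).inter hA) (measure_ne_top_of_subset inter_subset_right hμA) x
  have hG : ∀ k, G k =ᵐ[μ] A.indicator (F k) := by
    intro k
    have h2 : ∀ᵐ s ∂μ, ∀ x ∈ (F k).range, indicatorConstLp p
        (((F k).measurableSet_fiber x).inter hA) (measure_ne_top_of_subset inter_subset_right hμA) x s
          = (((F k) ⁻¹' {x}) ∩ A).indicator (fun _ => x) s :=
      (ae_ball_iff (Finset.countable_toSet _)).2 fun t _ => indicatorConstLp_coeFn
    filter_upwards [Lp.coeFn_finsetSum (μ := μ) (F k).range fun x => indicatorConstLp p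
      (((F k).measurableSet_fiber x).inter hA) (measure_ne_top_of_subset inter_subset_right hμA) x,
      h2] with s hs1 hs2
    rw [hs1, Finset.sum_apply, Finset.sum_congr rfl hs2]
    by_cases hsA : s ∈ A
    · rw [indicator_of_mem hsA]
      refine Eq.trans ?_ (sum_indicator_fiber (F k) id)
      refine Finset.sum_congr rfl fun x _ => ?_
      by_cases hx : s ∈ (F k) ⁻¹' {x}
      · rw [indicator_of_mem hx, indicator_of_mem (show s ∈ _ ∩ A from ⟨hx, hsA⟩)]; rfl
      · rw [indicator_of_notMem hx, indicator_of_notMem fun h : s ∈ _ ∩ A => hx h.1]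
    · rw [indicator_of_notMem hsA]
      exact Finset.sum_eq_zero fun x _ => indicator_of_notMem (fun h : s ∈ _ ∩ A => hsA h.2) _
  have hGlim : Tendsto G atTop (𝓝 g) := by
    refine tendsto_Lp_of_dominated hp (G := A.indicator fun _ => C)
      ((memLp_indicator_const p hA C (Or.inr hμA))) (fun k => ?_) ?_
    · filter_upwards [hG k] with s hs
      rw [hs]
      by_cases hsA : s ∈ A
      · rw [indicator_of_mem hsA, indicator_of_mem hsA]; exact hFC k s
      · rw [indicator_of_notMem hsA, indicator_of_notMem hsA, norm_zero]
    · filter_upwards [ae_all_iff.2 hG, hFlim, hgA] with s hs1 hs2 hs3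
      by_cases hsA : s ∈ A
      · refine hs2.congr fun k => ?_
        rw [hs1, indicator_of_mem hsA]
      · rw [hs3 hsA]
        refine tendsto_const_nhds.congr fun k => ?_
        rw [hs1, indicator_of_notMem hsA]
  have hsumΛ : ∀ k, (fun s => Λ s (F k s)) = fun s => ∑ x ∈ (F k).range,
      ((F k) ⁻¹' {x}).indicator (fun s => Λ s x) s := by
    intro k
    ext s
    rw [← sum_indicator_fiber (F k) (Λ s)]
    rfl
  have hint : ∀ k, ∀ x ∈ (F k).range,
      Integrable (((F k) ⁻¹' {x}).indicator (fun s => Λ s x)) lam := fun k x _ =>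
    (Integrable.of_bound (hΛm x) (1 * ‖x‖) (Eventually.of_forall fun s =>
      (Λ s).le_of_opNorm_le (hΛ1 s) x)).indicator ((F k).measurableSet_fiber x)
  have hφG : ∀ k, φ (G k) = ∫ s, Λ s (F k s) ∂lam := by
    intro k
    rw [hsumΛ k, integral_finsetSum _ (hint k), map_sum]
    refine Finset.sum_congr rfl fun x _ => ?_
    rw [integral_indicator ((F k).measurableSet_fiber x), hΛ x _ ((F k).measurableSet_fiber x),
      dualSetFun_apply ((F k).measurableSet_fiber x)]
  have hΛF : ∀ k, AEStronglyMeasurable (fun s => Λ s (F k s)) lam := fun k => by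
    rw [hsumΛ k]
    exact (integrable_finsetSum _ (hint k)).aestronglyMeasurable
  have hΛlim : ∀ᵐ s ∂lam, Tendsto (fun k => Λ s (F k s)) atTop (𝓝 (Λ s (g s))) := by
    filter_upwards [hac.ae_le hFlim] with s hs
    exact ((Λ s).continuous.tendsto _).comp hs
  refine ⟨aestronglyMeasurable_of_tendsto_ae atTop hΛF hΛlim, ?_⟩
  refine tendsto_nhds_unique ((φ.continuous.tendsto g).comp hGlim) ?_
  refine (tendsto_integral_of_dominated_convergence (fun _ => 1 * C) hΛF (integrable_const _)
    (fun k => Eventually.of_forall fun s => ?_) hΛlim).congr fun k => (hφG k).symm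
  exact (Λ s).le_of_opNorm_le_of_le (hΛ1 s) (hFC k s)

/-- Bounded sequences in `L^p(Ω, X)` supported in a common set of finite measure converge weakly to zero
if they do so pointwise. -/
theorem tendsto_apply_of_forall_ae_tendsto_real [TopologicalSpace.SeparableSpace X] (hp : p ≠ ∞)
    (hA : MeasurableSet A) (hμA : μ A ≠ ∞) {g : ℕ → Lp X p μ} {C : ℝ}
    (hC : ∀ n, ∀ᵐ s ∂μ, ‖g n s‖ ≤ C) (hgA : ∀ n, ∀ᵐ s ∂μ, s ∉ A → g n s = 0)
    (h : ∀ᵐ s ∂μ, ∀ l : X →L[ℝ] ℝ, Tendsto (fun n => l (g n s)) atTop (𝓝 0))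
    (φ : Lp X p μ →L[ℝ] ℝ) : Tendsto (fun n => φ (g n)) atTop (𝓝 0) := by
  have := isFiniteMeasure_dualVariation (φ := φ) (hA := hA) (hμA := hμA) hp
  have hac := dualVariation_absolutelyContinuous (φ := φ) (hA := hA) (hμA := hμA) hp
  obtain ⟨Λ, hΛ1, hΛm, hΛ⟩ := exists_dual_density (φ := φ) (hA := hA) (hμA := hμA) hp
  have hrep := fun n => apply_eq_integral_dual_density hp hΛ1 hΛm hΛ (hC n) (hgA n)
  have h0 : (0 : ℝ) = ∫ _, (0 : ℝ) ∂(dualVariation hp φ hA hμA) := by simp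
  rw [h0]
  refine (tendsto_integral_of_dominated_convergence (fun _ => 1 * C) (fun n => (hrep n).1)
    (integrable_const _) (fun n => ?_) ?_).congr fun n => (hrep n).2.symm
  · filter_upwards [hac.ae_le (hC n)] with s hs
    exact (Λ s).le_of_opNorm_le_of_le (hΛ1 s) hs
  · filter_upwards [hac.ae_le h] with s hs using hs (Λ s)

end DualDensity

section Complex

variable {Ω : Type*} [MeasurableSpace Ω] {μ : Measure Ω} {X : Type*} [NormedAddCommGroup X]
  [NormedSpace ℂ X] {p : ℝ≥0∞} [Fact (1 ≤ p)] {A : Set Ω}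

/-- The case of complex scalars, reduced to the real one by taking real and imaginary parts. -/
theorem tendsto_apply_of_forall_ae_tendsto [TopologicalSpace.SeparableSpace X] (hp : p ≠ ∞)
    (hA : MeasurableSet A) (hμA : μ A ≠ ∞) {g : ℕ → Lp X p μ} {C : ℝ}
    (hC : ∀ n, ∀ᵐ s ∂μ, ‖g n s‖ ≤ C) (hgA : ∀ n, ∀ᵐ s ∂μ, s ∉ A → g n s = 0)
    (h : ∀ᵐ s ∂μ, ∀ l : StrongDual ℂ X, Tendsto (fun n => l (g n s)) atTop (𝓝 0))
    (φ : StrongDual ℂ (Lp X p μ)) : Tendsto (fun n => φ (g n)) atTop (𝓝 0) := by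
  let _ : NormedSpace ℝ X := NormedSpace.restrictScalars ℝ ℂ X
  have h' : ∀ᵐ s ∂μ, ∀ l : X →L[ℝ] ℝ, Tendsto (fun n => l (g n s)) atTop (𝓝 0) := by
    filter_upwards [h] with s hs l
    have h1 := (Complex.continuous_re.tendsto _).comp (hs (StrongDual.extendRCLike (𝕜 := ℂ) l))
    rw [Complex.zero_re] at h1
    refine h1.congr fun n => ?_
    simp [StrongDual.extendRCLike_apply]
  have key : ∀ ψ : ℂ →L[ℝ] ℝ, Tendsto (fun n => ψ (φ (g n))) atTop (𝓝 0) := by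
    intro ψ
    exact tendsto_apply_of_forall_ae_tendsto_real hp hA hμA hC hgA h'
      (ψ.comp (φ.restrictScalars ℝ))
  have h1 := (Complex.continuous_ofReal.tendsto 0).comp (key Complex.reCLM)
  have h2 := ((Complex.continuous_ofReal.tendsto 0).comp (key Complex.imCLM)).mul_const Complex.I
  have h3 := h1.add h2
  simp only [Complex.ofReal_zero, zero_mul, add_zero] at h3
  refine h3.congr fun n => ?_
  exact Complex.re_add_im _

end Complex

/-! ### Semigroups indexed by the rationals -/

section Extension

variable {X : Type*} [NormedAddCommGroup X] [NormedSpace ℂ X] [CompleteSpace X]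

theorem denseRange_nnratCast : DenseRange ((↑) : ℚ≥0 → ℝ≥0) := by
  refine dense_of_exists_between fun a b hab => ?_
  obtain ⟨q, h1, h2⟩ := exists_rat_btwn (NNReal.coe_lt_coe.2 hab)
  have hq : 0 ≤ q := by exact_mod_cast (a.2.trans h1.le)
  lift q to ℚ≥0 using hq
  exact ⟨q, ⟨q, rfl⟩, by exact_mod_cast h1, by exact_mod_cast h2⟩

omit [NormedSpace ℂ X] in
/-- A function that is uniformly continuous on the nonnegative rationals extends continuously. -/
theorem exists_continuous_of_nnrat {u : ℝ≥0 → X}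
    (hu : ∀ ε > 0, ∃ δ > 0, ∀ q r : ℚ≥0, dist (q : ℝ≥0) r < δ → dist (u q) (u r) < ε) :
    ∃ F : ℝ≥0 → X, Continuous F ∧ ∀ q : ℚ≥0, F q = u q := by
  let D : Set ℝ≥0 := range ((↑) : ℚ≥0 → ℝ≥0)
  have hf : UniformContinuous fun d : D => u d := by
    refine Metric.uniformContinuous_iff.2 fun ε hε => ?_
    obtain ⟨δ, hδ, h⟩ := hu ε hε
    refine ⟨δ, hδ, ?_⟩
    rintro ⟨_, q, rfl⟩ ⟨_, r, rfl⟩ hd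
    exact h q r hd
  have he : IsUniformInducing ((↑) : D → ℝ≥0) := ⟨rfl⟩
  have hd : DenseRange ((↑) : D → ℝ≥0) := by
    rw [DenseRange, Subtype.range_coe]
    exact denseRange_nnratCast
  refine ⟨_, (uniformContinuous_uniformly_extend he hd hf).continuous, fun q => ?_⟩
  exact uniformly_extend_of_ind he hd hf ⟨(q : ℝ≥0), q, rfl⟩

/-- A bounded semigroup of operators indexed by the nonnegative rationals that is strongly continuous at
`0` extends to a `C₀`-semigroup. -/
theorem exists_isC0Semigroup_of_nnrat {N : ℝ≥0 → X →L[ℂ] X} {K : ℝ}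
    (h0 : N 0 = ContinuousLinearMap.id ℂ X)
    (hadd : ∀ q r : ℚ≥0, N ((q : ℝ≥0) + r) = (N q).comp (N r))
    (hK : ∀ (q : ℚ≥0) x, ‖N q x‖ ≤ K * ‖x‖)
    (hc : ∀ x, ∀ ε > 0, ∃ δ > 0, ∀ q : ℚ≥0, (q : ℝ) < δ → ‖N q x - x‖ < ε) :
    ∃ T : ℝ≥0 → X →L[ℂ] X, IsC0Semigroup T ∧ ∀ q : ℚ≥0, T q = N q := by
  have hden : DenseRange ((↑) : ℚ≥0 → ℝ≥0) := denseRange_nnratCast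
  have hex : ∀ x, ∃ F : ℝ≥0 → X, Continuous F ∧ ∀ q : ℚ≥0, F q = N q x := by
    intro x
    refine exists_continuous_of_nnrat (u := fun t => N t x) fun ε hε => ?_
    have hK0 : (0 : ℝ) < |K| + 1 := by positivity
    obtain ⟨δ, hδ, h⟩ := hc x (ε / (|K| + 1)) (by positivity)
    have key : ∀ q r : ℚ≥0, q ≤ r → dist (q : ℝ≥0) r < δ → dist (N q x) (N r x) < ε := by
      intro q r hqr hd
      obtain ⟨d, rfl⟩ := exists_add_of_le hqr
      have h1 : (d : ℝ) < δ := by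
        rw [NNReal.dist_eq, abs_sub_comm] at hd
        push_cast at hd
        rw [add_sub_cancel_left] at hd
        exact (le_abs_self _).trans_lt (by exact_mod_cast hd)
      rw [NNRat.cast_add, hadd, dist_comm, dist_eq_norm, ContinuousLinearMap.comp_apply, ← map_sub]
      calc ‖N q (N d x - x)‖ ≤ K * ‖N d x - x‖ := hK q _
        _ ≤ (|K| + 1) * ‖N d x - x‖ := by
          gcongr
          linarith [le_abs_self K]
        _ < (|K| + 1) * (ε / (|K| + 1)) := by
          gcongr
          exact h d h1
        _ = ε := by field_simp
    refine ⟨δ, hδ, fun q r hd => ?_⟩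
    rcases le_total q r with hqr | hqr
    · exact key q r hqr hd
    · rw [dist_comm]
      exact key r q hqr (by rwa [dist_comm])
  choose F hFc hFN using hex
  have hext : ∀ {f g : ℝ≥0 → X}, Continuous f → Continuous g → (∀ q : ℚ≥0, f q = g q) → ∀ t, f t = g t :=
    fun hf hg h t => congrFun (hden.equalizer hf hg (funext h)) t
  let T : ℝ≥0 → X →L[ℂ] X := fun t => LinearMap.mkContinuous
    { toFun := fun x => F x t
      map_add' := fun x y => hext (hFc _) ((hFc x).add (hFc y)) (fun q => by simp [hFN]) t
      map_smul' := fun c x => hext (hFc _) ((hFc x).const_smul c) (fun q => by simp [hFN]) t } K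
    (fun x => hden.induction_on (p := fun t => ‖F x t‖ ≤ K * ‖x‖) t
      (isClosed_le (hFc x).norm continuous_const) fun q => by rw [hFN]; exact hK q x)
  have hT : ∀ q : ℚ≥0, T q = N q := fun q => ContinuousLinearMap.ext fun x => hFN x q
  refine ⟨T, ⟨?_, fun s t => ?_, hFc⟩, hT⟩
  · rw [← h0]
    have := hT 0
    rwa [NNRat.cast_zero] at this
  · ext x
    change F x (s + t) = F (F x t) s
    refine hext (f := fun s => F x (s + t)) ((hFc x).comp (continuous_add_const t)) (hFc _) (fun q => ?_) s
    rw [hFN]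
    refine hext (f := fun t => F x (q + t)) ((hFc x).comp (continuous_const_add _))
      ((N q).continuous.comp (hFc x)) (fun r => ?_) t
    rw [← NNRat.cast_add, hFN, NNRat.cast_add, hadd, Function.comp_apply, hFN]
    rfl

end Extension

/-! ### Fields of operators -/

section Fields

variable {Ω : Type*} [MeasurableSpace Ω] {μ : Measure Ω} [SigmaFinite μ]
  {X : Type*} [NormedAddCommGroup X] {p : ℝ≥0∞}

/-- A closed condition on vectors that holds almost everywhere along every element of `L^p(Ω, X)`, holds
almost everywhere for all vectors. -/
theorem ae_forall_of_forall_ae_Lp [TopologicalSpace.SeparableSpace X] {P : Ω → X → Prop}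
    (hcl : ∀ᵐ s ∂μ, IsClosed {x | P s x}) (h : ∀ f : Lp X p μ, ∀ᵐ s ∂μ, P s (f s)) :
    ∀ᵐ s ∂μ, ∀ x, P s x := by
  have h1 : ∀ᵐ s ∂μ, ∀ n k, s ∈ spanningSets μ n → P s (TopologicalSpace.denseSeq X k) := by
    refine ae_all_iff.2 fun n => ae_all_iff.2 fun k => ?_
    filter_upwards [h (indicatorConstLp p (measurableSet_spanningSets μ n)
      (measure_spanningSets_lt_top μ n).ne (TopologicalSpace.denseSeq X k)),
      indicatorConstLp_coeFn (p := p) (hs := measurableSet_spanningSets μ n)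
        (hμs := (measure_spanningSets_lt_top μ n).ne) (c := TopologicalSpace.denseSeq X k)] with s h2 h3 hs
    rwa [h3, indicator_of_mem hs] at h2
  filter_upwards [hcl, h1] with s h2 h3 x
  have hs : s ∈ ⋃ n, spanningSets μ n := iUnion_spanningSets μ ▸ mem_univ s
  obtain ⟨n, hn⟩ := mem_iUnion.1 hs
  exact (TopologicalSpace.denseRange_denseSeq X).induction_on x h2 fun k => h3 n k hn

variable [NormedSpace ℂ X] [Fact (1 ≤ p)]

/-- The norm of a multiplication operator bounds almost all of its fibres: test it on `1_A x`. -/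
theorem IsMultiplicationOperator.ae_norm_le [TopologicalSpace.SeparableSpace X] (hp : p ≠ ∞)
    {M : Ω → X →L[ℂ] X} {S : Lp X p μ →L[ℂ] Lp X p μ} (hM : IsMultiplicationOperator M S) {K : ℝ}
    (hK : ‖S‖ ≤ K) : ∀ᵐ s ∂μ, ∀ x, ‖M s x‖ ≤ K * ‖x‖ := by
  have hK0 : 0 ≤ K := (norm_nonneg _).trans hK
  have hp0 : p ≠ 0 := (one_pos.trans_le (Fact.out : 1 ≤ p)).ne'
  have hpr : 0 < p.toReal := ENNReal.toReal_pos hp0 hp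
  have key : ∀ x, ∀ᵐ s ∂μ, ‖M s x‖ ≤ K * ‖x‖ := by
    intro x
    have h1 : (fun s => ‖M s x‖ₑ ^ p.toReal) ≤ᵐ[μ] fun _ => ‖K * ‖x‖‖ₑ ^ p.toReal := by
      refine ae_le_of_forall_setLIntegral_le_of_sigmaFinite₀
        ((hM.measurable x).enorm.pow_const _) fun A hA hμA => ?_
      set f := indicatorConstLp p hA hμA.ne x with hf
      have hfA : f =ᵐ[μ] A.indicator fun _ => x := indicatorConstLp_coeFn
      have hnorm : ∀ g : Lp X p μ, ‖g‖ₑ ^ p.toReal = ∫⁻ s, ‖g s‖ₑ ^ p.toReal ∂μ := fun g => by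
        rw [Lp.enorm_def, eLpNorm_eq_lintegral_rpow_enorm_toReal hp0 hp, ← ENNReal.rpow_mul,
          one_div, inv_mul_cancel₀ hpr.ne', ENNReal.rpow_one]
      calc ∫⁻ s in A, ‖M s x‖ₑ ^ p.toReal ∂μ = ∫⁻ s in A, ‖S f s‖ₑ ^ p.toReal ∂μ := by
            refine setLIntegral_congr_fun_ae hA ?_
            filter_upwards [hfA, hM.apply_ae f] with s h2 h3 hs
            rw [h3, h2, indicator_of_mem hs]
        _ ≤ ∫⁻ s, ‖S f s‖ₑ ^ p.toReal ∂μ := setLIntegral_le_lintegral _ _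
        _ = ‖S f‖ₑ ^ p.toReal := (hnorm _).symm
        _ ≤ (‖K‖ₑ * ‖f‖ₑ) ^ p.toReal := by
            gcongr
            rw [← enorm_norm f, ← enorm_mul, enorm_le_iff_norm_le, norm_mul, norm_norm,
              Real.norm_of_nonneg hK0]
            exact S.le_of_opNorm_le hK f
        _ = ‖K‖ₑ ^ p.toReal * ∫⁻ s, ‖f s‖ₑ ^ p.toReal ∂μ := by
            rw [ENNReal.mul_rpow_of_nonneg _ _ hpr.le, hnorm]
        _ = ‖K‖ₑ ^ p.toReal * ∫⁻ s in A, ‖x‖ₑ ^ p.toReal ∂μ := by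
            rw [← lintegral_indicator hA]
            congr 1
            refine lintegral_congr_ae ?_
            filter_upwards [hfA] with s h2
            rw [h2]
            by_cases hs : s ∈ A
            · rw [indicator_of_mem hs, indicator_of_mem hs]
            · rw [indicator_of_notMem hs, indicator_of_notMem hs, enorm_zero, ENNReal.zero_rpow_of_pos hpr]
        _ = ∫⁻ s in A, ‖K * ‖x‖‖ₑ ^ p.toReal ∂μ := by
            rw [setLIntegral_const, setLIntegral_const, ← mul_assoc,
              ← ENNReal.mul_rpow_of_nonneg _ _ hpr.le, enorm_mul, enorm_norm]
    filter_upwards [h1] with s hs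
    have h3 := (ENNReal.rpow_le_rpow_iff hpr).1 hs
    rw [enorm_le_iff_norm_le, Real.norm_of_nonneg (by positivity)] at h3
    exact h3
  have h2 : ∀ᵐ s ∂μ, ∀ k, ‖M s (TopologicalSpace.denseSeq X k)‖ ≤ K * ‖TopologicalSpace.denseSeq X k‖ :=
    ae_all_iff.2 fun k => key _
  filter_upwards [h2] with s hs x
  exact (TopologicalSpace.denseRange_denseSeq X).induction_on x (isClosed_le
    (M s).continuous.norm (continuous_const.mul continuous_norm)) hs

end Fields

/-! ### The pointwise semigroups of a multiplication semigroup -/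

section PointwiseSemigroups

variable {Ω : Type*} [MeasurableSpace Ω] {μ : Measure Ω} {X : Type*} [NormedAddCommGroup X]
  [NormedSpace ℂ X] {p : ℝ≥0∞} [Fact (1 ≤ p)]

omit [NormedSpace ℂ X] in
theorem exists_seq_tendsto_ae_of_tendsto_Lp {F : ℕ → Lp X p μ} {f : Lp X p μ}
    (h : Tendsto F atTop (𝓝 f)) :
    ∃ ns : ℕ → ℕ, StrictMono ns ∧ ∀ᵐ s ∂μ, Tendsto (fun i => F (ns i) s) atTop (𝓝 (f s)) :=
  (tendstoInMeasure_of_tendsto_Lp h).exists_seq_tendsto_ae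

omit [Fact (1 ≤ p)] in
theorem convex_setOf_ae_norm_le (G : Ω → ℝ) : Convex ℝ {g : Lp X p μ | ∀ᵐ s ∂μ, ‖g s‖ ≤ G s} := by
  intro f hf g hg a b ha hb hab
  filter_upwards [hf, hg, Lp.coeFn_add (a • f) (b • g), Lp.coeFn_smul a f, Lp.coeFn_smul b g]
    with s h1 h2 h3 h4 h5
  rw [h3, Pi.add_apply, h4, h5, Pi.smul_apply, Pi.smul_apply]
  refine (norm_add_le _ _).trans ?_
  rw [norm_smul, norm_smul, Real.norm_of_nonneg ha, Real.norm_of_nonneg hb]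
  calc a * ‖f s‖ + b * ‖g s‖ ≤ a * G s + b * G s := by gcongr
    _ = G s := by rw [← add_mul, hab, one_mul]

omit [NormedSpace ℂ X] in
theorem isClosed_setOf_ae_norm_le (G : Ω → ℝ) : IsClosed {g : Lp X p μ | ∀ᵐ s ∂μ, ‖g s‖ ≤ G s} := by
  refine IsSeqClosed.isClosed fun F f hF hf => ?_
  obtain ⟨ns, -, hns⟩ := exists_seq_tendsto_ae_of_tendsto_Lp hf
  filter_upwards [hns, ae_all_iff.2 hF] with s h1 h2
  exact le_of_tendsto h1.norm (Eventually.of_forall fun i => h2 _)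

variable {S : ℝ≥0 → Lp X p μ →L[ℂ] Lp X p μ} {K : ℝ}

/-- Integrals of an orbit obey the pointwise bounds of the orbit, since the functions dominated by
`K ‖f ·‖` form a closed convex set. -/
theorem ae_norm_integral_orbit_le [CompleteSpace X] (hS : IsC0Semigroup S)
    (hK : ∀ t f, ∀ᵐ s ∂μ, ‖S t f s‖ ≤ K * ‖f s‖) (f : Lp X p μ) {a b : ℝ} (hab : a ≤ b) :
    ∀ᵐ s ∂μ, ‖(∫ r in a..b, S r.toNNReal f) s‖ ≤ (b - a) * (K * ‖f s‖) := by
  rcases hab.eq_or_lt with rfl | hlt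
  · rw [intervalIntegral.integral_same]
    filter_upwards [Lp.coeFn_zero X p μ] with s hs
    rw [hs]
    simp
  have hpos : 0 < b - a := sub_pos.2 hlt
  have hmem := (convex_setOf_ae_norm_le (X := X) (p := p) (μ := μ) fun s => K * ‖f s‖).set_average_mem
    (isClosed_setOf_ae_norm_le _) (μ := volume) (t := Ioc a b) (f := fun r : ℝ => S r.toNNReal f)
    (by simpa using hlt) (by simp) (Eventually.of_forall fun r => hK _ f)
    (((hS.continuous_toNNReal f).integrableOn_Icc).mono_set Ioc_subset_Icc_self)
  have heq : ∫ r in a..b, S r.toNNReal f = (b - a) • ⨍ r in Ioc a b, S r.toNNReal f := by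
    rw [intervalIntegral.integral_of_le hab, setAverage_eq, Real.volume_real_Ioc_of_le hab, smul_smul,
      mul_inv_cancel₀ hpos.ne', one_smul]
  rw [heq]
  filter_upwards [hmem, Lp.coeFn_smul (b - a) (⨍ r in Ioc a b, S r.toNNReal f)] with s h1 h2
  rw [h2, Pi.smul_apply, norm_smul, Real.norm_of_nonneg hpos.le]
  gcongr

/-- Integrated orbits are Lipschitz continuous at `0` almost everywhere: `S h - 1` maps `∫₀ᵇ S r f dr` to
the difference of two integrals over intervals of length `h`. -/
theorem ae_norm_sub_integral_orbit_le [CompleteSpace X] (hS : IsC0Semigroup S)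
    (hK : ∀ t f, ∀ᵐ s ∂μ, ‖S t f s‖ ≤ K * ‖f s‖) (f : Lp X p μ) {b : ℝ} (hb : 0 ≤ b) (h : ℝ≥0) :
    ∀ᵐ s ∂μ, ‖S h (∫ r in (0 : ℝ)..b, S r.toNNReal f) s - (∫ r in (0 : ℝ)..b, S r.toNNReal f) s‖ ≤
      2 * h * (K * ‖f s‖) := by
  have hc := hS.continuous_toNNReal f
  have hi : ∀ u v, IntervalIntegrable (fun r : ℝ => S r.toNNReal f) volume u v := fun u v =>
    hc.intervalIntegrable u v
  have h1 : S h (∫ r in (0 : ℝ)..b, S r.toNNReal f) = ∫ r in (h : ℝ)..(b + h), S r.toNNReal f := by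
    rw [← (S h).intervalIntegral_comp_comm (hi 0 b)]
    have h2 := intervalIntegral.integral_comp_add_right (a := 0) (b := b)
      (fun r : ℝ => S r.toNNReal f) (h : ℝ)
    rw [zero_add] at h2
    rw [← h2]
    refine intervalIntegral.integral_congr fun r hr => ?_
    rw [uIcc_of_le hb] at hr
    rw [Real.toNNReal_add hr.1 h.coe_nonneg, Real.toNNReal_coe, add_comm, hS.map_add]
    rfl
  have h3 : S h (∫ r in (0 : ℝ)..b, S r.toNNReal f) - (∫ r in (0 : ℝ)..b, S r.toNNReal f) =
      (∫ r in b..(b + h), S r.toNNReal f) - ∫ r in (0 : ℝ)..h, S r.toNNReal f := by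
    rw [h1, intervalIntegral.integral_interval_sub_interval_comm' (hi _ _) (hi _ _) (hi _ _)]
  filter_upwards [Lp.coeFn_sub (S h (∫ r in (0 : ℝ)..b, S r.toNNReal f))
    (∫ r in (0 : ℝ)..b, S r.toNNReal f), Lp.coeFn_sub (∫ r in b..(b + h), S r.toNNReal f)
    (∫ r in (0 : ℝ)..h, S r.toNNReal f),
    ae_norm_integral_orbit_le hS hK f (show b ≤ b + h from le_add_of_nonneg_right h.2),
    ae_norm_integral_orbit_le hS hK f h.2] with s h4 h5 h6 h7
  rw [← Pi.sub_apply, ← h4, h3, h5, Pi.sub_apply]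
  refine (norm_sub_le _ _).trans ((add_le_add h6 h7).trans (le_of_eq ?_))
  rw [add_sub_cancel_left, sub_zero]
  change (h : ℝ) * _ + (h : ℝ) * _ = _
  ring

/-- Almost every pointwise orbit is continuous at `0` along the rationals. For the means
`e⁻¹ ∫₀ᵉ S r f dr` this holds by `ae_norm_sub_integral_orbit_le`, and they approximate `f` almost
everywhere along a sequence of `e`. -/
theorem ae_forall_nnrat_norm_sub_lt [CompleteSpace X] (hS : IsC0Semigroup S) {M : ℝ≥0 → Ω → X →L[ℂ] X}
    (hM : ∀ t, IsMultiplicationOperator (M t) (S t)) (hK : ∀ t, ∀ᵐ s ∂μ, ∀ x, ‖M t s x‖ ≤ K * ‖x‖)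
    (f : Lp X p μ) : ∀ᵐ s ∂μ, ∀ ε > 0, ∃ δ > 0, ∀ q : ℚ≥0, (q : ℝ) < δ → ‖M q s (f s) - f s‖ < ε := by
  have hK' : ∀ t f, ∀ᵐ s ∂μ, ‖S t f s‖ ≤ K * ‖f s‖ := fun t f => by
    filter_upwards [(hM t).apply_ae f, hK t] with s h1 h2
    rw [h1]; exact h2 _
  let e : ℕ → ℝ := fun n => 1 / ((n : ℝ) + 1)
  have he : ∀ n, 0 < e n := fun n => by positivity
  let I : ℕ → Lp X p μ := fun n => ∫ r in (0 : ℝ)..(e n), S r.toNNReal f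
  have hlim : Tendsto (fun n => (e n)⁻¹ • I n) atTop (𝓝 f) := by
    have h1 := ((hS.continuous_toNNReal f).integral_hasStrictDerivAt 0 0).hasDerivAt
    have h2 := h1.tendsto_slope_zero_right.comp (tendsto_nhdsWithin_iff.2
      ⟨tendsto_one_div_add_atTop_nhds_zero_nat, Eventually.of_forall he⟩)
    rw [Real.toNNReal_zero, hS.map_zero] at h2
    refine h2.congr fun n => ?_
    simp [I, e]
  obtain ⟨ns, -, hns⟩ := exists_seq_tendsto_ae_of_tendsto_Lp hlim
  have hall : ∀ᵐ s ∂μ, ∀ (q : ℚ≥0) (n : ℕ), ‖M q s (I n s) - I n s‖ ≤ 2 * (q : ℝ) * (K * ‖f s‖) := by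
    refine ae_all_iff.2 fun q => ae_all_iff.2 fun n => ?_
    filter_upwards [ae_norm_sub_integral_orbit_le hS hK' f (he n).le (q : ℝ≥0), (hM q).apply_ae (I n)]
      with s h1 h2
    rw [← h2]
    exact h1
  have hKq : ∀ᵐ s ∂μ, ∀ q : ℚ≥0, ∀ x, ‖M q s x‖ ≤ K * ‖x‖ := ae_all_iff.2 fun q => hK q
  have hsm : ∀ᵐ s ∂μ, ∀ n, ((e n)⁻¹ • I n : Lp X p μ) s = (e n)⁻¹ • I n s :=
    ae_all_iff.2 fun n => Lp.coeFn_smul _ _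
  filter_upwards [hns, hall, hKq, hsm] with s h1 h2 h3 h4 ε hε
  have h5 : Tendsto (fun i => (K + 1) * ‖f s - ((e (ns i))⁻¹ • I (ns i) : Lp X p μ) s‖) atTop (𝓝 0) := by
    have := (tendsto_iff_norm_sub_tendsto_zero.1 h1).const_mul (K + 1)
    simpa only [mul_zero, norm_sub_rev] using this
  obtain ⟨i, hi⟩ := (h5.eventually (gt_mem_nhds (half_pos hε))).exists
  set n := ns i
  rw [h4] at hi
  set y := (e n)⁻¹ • I n s with hy
  set c := (e n)⁻¹ * (2 * (|K| * ‖f s‖)) with hcdef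
  have hen := he n
  have hc0 : 0 ≤ c := by positivity
  refine ⟨ε / (2 * (c + 1)), by positivity, fun q hq => ?_⟩
  have h6 : ‖M q s y - y‖ ≤ q * c := by
    rw [hy, ContinuousLinearMap.map_smul_of_tower, ← smul_sub, norm_smul, Real.norm_of_nonneg
      (inv_nonneg.2 hen.le)]
    calc (e n)⁻¹ * ‖M q s (I n s) - I n s‖ ≤ (e n)⁻¹ * (2 * (q : ℝ) * (K * ‖f s‖)) := by
          gcongr
          exact h2 q n
      _ ≤ (e n)⁻¹ * (2 * (q : ℝ) * (|K| * ‖f s‖)) := by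
          gcongr
          exact le_abs_self K
      _ = q * c := by rw [hcdef]; ring
  have h7 : (q : ℝ) * c ≤ ε / 2 := by
    calc (q : ℝ) * c ≤ ε / (2 * (c + 1)) * (c + 1) := by
          gcongr
          linarith
      _ = ε / 2 := by field_simp
  have h8 : M q s (f s) - f s = M q s (f s - y) + (M q s y - y) - (f s - y) := by
    rw [map_sub]; abel
  rw [h8]
  calc _ ≤ ‖M q s (f s - y)‖ + ‖M q s y - y‖ + ‖f s - y‖ :=
        (norm_sub_le _ _).trans (add_le_add_left (norm_add_le _ _) _)
    _ ≤ K * ‖f s - y‖ + ε / 2 + ‖f s - y‖ := by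
        gcongr
        · exact h3 q _
        · exact h6.trans h7
    _ < ε := by linarith

variable [CompleteSpace X] [TopologicalSpace.SeparableSpace X] [SigmaFinite μ]

/-- A bounded multiplication semigroup consists of the multiplication operators induced by a family of
pointwise semigroups. At rational times the fibres form a bounded semigroup that is strongly continuous at
`0`, almost everywhere; it is extended to real times. -/
theorem IsMultiplicationSemigroup.exists_isPointwiseSemigroups (hp : p ≠ ∞)
    (hS : IsMultiplicationSemigroup S) (hK : ∀ t, ‖S t‖ ≤ K) :
    ∃ T : Ω → ℝ≥0 → X →L[ℂ] X, IsPointwiseSemigroups S T := by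
  choose M hM using hS.multiplication
  have hSS := hS.isC0Semigroup
  have hMK : ∀ t, ∀ᵐ s ∂μ, ∀ x, ‖M t s x‖ ≤ K * ‖x‖ := fun t => (hM t).ae_norm_le hp (hK t)
  have hMKq : ∀ᵐ s ∂μ, ∀ q : ℚ≥0, ∀ x, ‖M q s x‖ ≤ K * ‖x‖ := ae_all_iff.2 fun q => hMK q
  have h0 : ∀ᵐ s ∂μ, ∀ x, M 0 s x = x := by
    refine ae_forall_of_forall_ae_Lp (p := p)
      (Eventually.of_forall fun s => isClosed_eq (M 0 s).continuous continuous_id) fun f => ?_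
    filter_upwards [(hM 0).apply_ae f] with s h1
    rw [← h1, hSS.map_zero]
    rfl
  have hadd : ∀ᵐ s ∂μ, ∀ q r : ℚ≥0, ∀ x, M ((q : ℝ≥0) + r) s x = M q s (M r s x) := by
    refine ae_all_iff.2 fun q => ae_all_iff.2 fun r => ?_
    refine ae_forall_of_forall_ae_Lp (p := p) (Eventually.of_forall fun s =>
      isClosed_eq (M _ s).continuous ((M q s).continuous.comp (M r s).continuous)) fun f => ?_
    filter_upwards [(hM (q + r)).apply_ae f, (hM r).apply_ae f, (hM q).apply_ae (S r f)] with s h1 h2 h3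
    rw [← h1, ← h2, ← h3, hSS.map_add]
    rfl
  have hcont : ∀ᵐ s ∂μ, ∀ x, ∀ ε > 0, ∃ δ > 0, ∀ q : ℚ≥0, (q : ℝ) < δ → ‖M q s x - x‖ < ε := by
    refine ae_forall_of_forall_ae_Lp (p := p) ?_ fun f => ae_forall_nnrat_norm_sub_lt hSS hM hMK f
    filter_upwards [hMKq] with s hs
    refine isClosed_of_closure_subset fun x hx ε hε => ?_
    have hK1 : (0 : ℝ) < |K| + 1 := by positivity
    obtain ⟨y, hy, hxy⟩ := Metric.mem_closure_iff.1 hx (ε / 2 / (|K| + 1)) (by positivity)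
    obtain ⟨δ, hδ, h⟩ := hy (ε / 2) (by positivity)
    refine ⟨δ, hδ, fun q hq => ?_⟩
    have h8 : M q s x - x = M q s (x - y) + (M q s y - y) - (x - y) := by
      rw [map_sub]; abel
    rw [dist_eq_norm, lt_div_iff₀ hK1] at hxy
    rw [h8]
    have h9 := hs q (x - y)
    have h10 : K * ‖x - y‖ ≤ |K| * ‖x - y‖ := by
      gcongr
      exact le_abs_self K
    calc _ ≤ ‖M q s (x - y)‖ + ‖M q s y - y‖ + ‖x - y‖ :=
          (norm_sub_le _ _).trans (add_le_add_left (norm_add_le _ _) _)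
      _ < ε := by linarith [h q hq]
  have hgood : ∀ᵐ s ∂μ, ∃ T : ℝ≥0 → X →L[ℂ] X, IsC0Semigroup T ∧ ∀ q : ℚ≥0, T q = M q s := by
    filter_upwards [hMKq, h0, hadd, hcont] with s h1 h2 h3 h4
    exact exists_isC0Semigroup_of_nnrat (N := fun t => M t s) (ContinuousLinearMap.ext h2)
      (fun q r => ContinuousLinearMap.ext (h3 q r)) h1 h4
  classical
  -- on the exceptional null set the value is irrelevant
  let T : Ω → ℝ≥0 → X →L[ℂ] X := fun s =>
    if h : ∃ T : ℝ≥0 → X →L[ℂ] X, IsC0Semigroup T ∧ ∀ q : ℚ≥0, T q = M q s then h.choose else 0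
  have hT : ∀ᵐ s ∂μ, IsC0Semigroup (T s) ∧ ∀ q : ℚ≥0, T s q = M q s := by
    filter_upwards [hgood] with s hs
    have : T s = hs.choose := dif_pos hs
    rw [this]
    exact hs.choose_spec
  have hseq : ∀ t : ℝ≥0, ∃ u : ℕ → ℚ≥0, Tendsto (fun n => (u n : ℝ≥0)) atTop (𝓝 t) := by
    intro t
    obtain ⟨v, hv, hvt⟩ := mem_closure_iff_seq_limit.1 (denseRange_nnratCast t)
    choose u hu using hv
    exact ⟨u, by simpa only [hu] using hvt⟩
  refine ⟨T, hT.mono fun s hs => hs.1, fun t => ?_⟩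
  obtain ⟨u, hu⟩ := hseq t
  have hlim : ∀ᵐ s ∂μ, ∀ x, Tendsto (fun n => M (u n) s x) atTop (𝓝 (T s t x)) := by
    filter_upwards [hT] with s hs x
    have := ((hs.1.strong_cont x).tendsto t).comp hu
    refine this.congr fun n => ?_
    rw [Function.comp_apply, hs.2]
  refine ⟨fun x => aestronglyMeasurable_of_tendsto_ae atTop (fun n => (hM (u n)).measurable x)
    (hlim.mono fun s hs => hs x), fun f => ?_⟩
  obtain ⟨ns, hns, hns'⟩ := exists_seq_tendsto_ae_of_tendsto_Lp
    (((hSS.strong_cont f).tendsto t).comp hu)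
  have hall : ∀ᵐ s ∂μ, ∀ n, S (u n) f s = M (u n) s (f s) := ae_all_iff.2 fun n => (hM (u n)).apply_ae f
  filter_upwards [hlim, hns', hall] with s h1 h2 h3
  refine tendsto_nhds_unique h2 (((h1 (f s)).comp hns.tendsto_atTop).congr fun i => ?_)
  exact (h3 _).symm

omit [CompleteSpace X] in
theorem IsPointwiseSemigroups.ae_norm_le (hp : p ≠ ∞) {T : Ω → ℝ≥0 → X →L[ℂ] X}
    (hT : IsPointwiseSemigroups S T) (hK : ∀ t, ‖S t‖ ≤ K) : ∀ᵐ s ∂μ, ∀ t x, ‖T s t x‖ ≤ K * ‖x‖ := by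
  have h1 : ∀ᵐ s ∂μ, ∀ q : ℚ≥0, ∀ x, ‖T s q x‖ ≤ K * ‖x‖ :=
    ae_all_iff.2 fun q => (hT.multiplication q).ae_norm_le hp (hK q)
  filter_upwards [h1, hT.isC0Semigroup] with s h2 h3 t x
  exact denseRange_nnratCast.induction_on (p := fun t => ‖T s t x‖ ≤ K * ‖x‖) t
    (isClosed_le (h3.strong_cont x).norm continuous_const) fun q => h2 q x

end PointwiseSemigroups

/-! ### Stability of the multiplication semigroup -/

section Main

/-- For a bounded family of operators, strong convergence to zero on a set passes to its closure. -/
theorem isClosed_setOf_tendsto_zero {α E F : Type*} [NormedAddCommGroup E] [NormedSpace ℂ E]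
    [NormedAddCommGroup F] [NormedSpace ℂ F] {l : Filter α} {A : α → E →L[ℂ] F} {K : ℝ}
    (hK : ∀ a, ‖A a‖ ≤ K) : IsClosed {x | Tendsto (fun a => A a x) l (𝓝 0)} := by
  refine isClosed_of_closure_subset fun x hx => Metric.tendsto_nhds.2 fun ε hε => ?_
  have hK1 : (0 : ℝ) < |K| + 1 := by positivity
  obtain ⟨y, hy, hxy⟩ := Metric.mem_closure_iff.1 hx (ε / 2 / (|K| + 1)) (by positivity)
  rw [dist_eq_norm, lt_div_iff₀ hK1] at hxy
  filter_upwards [Metric.tendsto_nhds.1 hy (ε / 2) (half_pos hε)] with a ha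
  rw [dist_zero_right] at ha ⊢
  have h1 : A a x = A a (x - y) + A a y := by rw [map_sub]; abel
  have h2 := (A a).le_of_opNorm_le ((hK a).trans (le_abs_self K)) (x - y)
  rw [h1]
  refine (norm_add_le _ _).trans_lt ?_
  nlinarith [norm_nonneg (x - y)]

variable {Ω : Type*} [MeasurableSpace Ω] {μ : Measure Ω}
  {X : Type*} [NormedAddCommGroup X] [NormedSpace ℂ X] {p : ℝ≥0∞} [Fact (1 ≤ p)]
  {S : ℝ≥0 → Lp X p μ →L[ℂ] Lp X p μ} {T : Ω → ℝ≥0 → X →L[ℂ] X} {K : ℝ}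

theorem aestronglyMeasurable_weakGauge [TopologicalSpace.SeparableSpace X]
    [TopologicalSpace.SeparableSpace (StrongDual ℂ X)] {A : Ω → X →L[ℂ] X}
    (hA : ∀ x, AEStronglyMeasurable (fun s => A s x) μ) :
    AEStronglyMeasurable (fun s => weakGauge (A s)) μ := by
  refine aestronglyMeasurable_of_tendsto_ae atTop
    (f := fun n s => ∑ i ∈ Finset.range n, weakGaugeTerm i (A s)) (fun n => ?_)
    (Eventually.of_forall fun s => (summable_weakGaugeTerm (A s)).hasSum.tendsto_sum_nat)
  refine Finset.aestronglyMeasurable_fun_sum _ fun i _ => ?_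
  unfold weakGaugeTerm
  have h1 := (TopologicalSpace.denseSeq (StrongDual ℂ X)
    i.unpair.2).continuous.comp_aestronglyMeasurable (hA (TopologicalSpace.denseSeq X i.unpair.1))
  exact (aestronglyMeasurable_const.inf h1.norm).const_mul _

section PartOne

variable [SigmaFinite μ] [TopologicalSpace.SeparableSpace X]

/-- The weak gauges of the pointwise semigroups tend to zero in mean over `Ω`, along a common set of
times of density one. -/
theorem exists_hasDensityOne_tendsto_integral_weakGauge [CompleteSpace X] (hX : IsReflexive X)
    [TopologicalSpace.SeparableSpace (StrongDual ℂ X)] {ν : Measure Ω} [IsFiniteMeasure ν]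
    (hmeas : ∀ t x, AEStronglyMeasurable (fun s => T s t x) ν)
    (hT : ∀ᵐ s ∂ν, IsC0Semigroup (T s)) (hK : ∀ᵐ s ∂ν, ∀ t, ‖T s t‖ ≤ K)
    (h : ∀ᵐ s ∂ν, ∀ z : ℂ, z.re = 0 → z ∉ pointSpectrum (generator (T s))) :
    ∃ M, HasDensityOne M ∧ Tendsto (fun r : ℝ => ∫ s, weakGauge (T s r.toNNReal) ∂ν)
      (atTop ⊓ 𝓟 M) (𝓝 0) := by
  have hm : ∀ r : ℝ, AEStronglyMeasurable (fun s => weakGauge (T s r.toNNReal)) ν := fun r =>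
    aestronglyMeasurable_weakGauge (hmeas _)
  have hi : ∀ r : ℝ, Integrable (fun s => weakGauge (T s r.toNNReal)) ν := fun r =>
    Integrable.of_bound (hm r) 2 (Eventually.of_forall fun s => norm_weakGauge_le _)
  refine exists_hasDensityOne_tendsto (C := ∫ _, 2 ∂ν) ?_ (fun r => integral_nonneg fun s =>
    weakGauge_nonneg _) (fun r => integral_mono (hi r) (integrable_const _) fun s => weakGauge_le _)
    fun δ hδ => ?_
  · refine continuous_of_dominated hm (fun r => Eventually.of_forall fun s => norm_weakGauge_le _)
      (integrable_const _) ?_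
    filter_upwards [hT] with s hs using continuous_weakGauge_comp hs.continuous_toNNReal
  · have h1 : ∀ N, cesaro (fun n : ℕ => ∫ s, weakGauge (T s ((n : ℝ) + δ).toNNReal) ∂ν) N =
        ∫ s, cesaro (fun n : ℕ => weakGauge (T s ((n : ℝ) + δ).toNNReal)) N ∂ν := fun N => by
      unfold cesaro
      rw [integral_smul, integral_finsetSum _ fun n _ => hi _]
    rw [funext h1, ← integral_zero Ω ℝ (μ := ν)]
    refine tendsto_integral_of_dominated_convergence (fun _ => 2) (fun N => ?_) (integrable_const _)
      (fun N => Eventually.of_forall fun s => ?_) ?_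
    · unfold cesaro
      exact (Finset.aestronglyMeasurable_fun_sum (Finset.range N)
        fun n _ => hm ((n : ℝ) + δ)).const_smul (N : ℝ)⁻¹
    · exact norm_cesaro_le (fun n => norm_weakGauge_le _) N
    · filter_upwards [hT, hK, h] with s h1 h2 h3
      exact tendsto_cesaro_weakGauge_of_forall_notMem_pointSpectrum hX h1 h2 h3 hδ.1

/-- A sequence of nonnegative functions whose integrals tend to zero has a subsequence tending to zero
almost everywhere. -/
theorem exists_seq_tendsto_ae_of_tendsto_integral {ν : Measure Ω} {F : ℕ → Ω → ℝ}
    (hF : ∀ n, Integrable (F n) ν) (h0 : ∀ n s, 0 ≤ F n s)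
    (h : Tendsto (fun n => ∫ s, F n s ∂ν) atTop (𝓝 0)) :
    ∃ ns : ℕ → ℕ, StrictMono ns ∧ ∀ᵐ s ∂ν, Tendsto (fun i => F (ns i) s) atTop (𝓝 0) := by
  refine TendstoInMeasure.exists_seq_tendsto_ae (g := fun _ => (0 : ℝ)) ?_
  refine tendstoInMeasure_of_tendsto_eLpNorm one_ne_zero (fun n => (hF n).aestronglyMeasurable)
    aestronglyMeasurable_const ?_
  have h1 := (ENNReal.continuous_ofReal.tendsto 0).comp h
  rw [ENNReal.ofReal_zero] at h1
  refine h1.congr fun n => ?_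
  rw [Function.comp_apply, eLpNorm_one_eq_lintegral_enorm,
    ofReal_integral_eq_lintegral_ofReal (hF n) (Eventually.of_forall (h0 n))]
  refine lintegral_congr fun s => ?_
  simp [Real.enorm_of_nonneg (h0 n s)]

/-- Almost weak stability of almost all pointwise semigroups passes to the multiplication semigroup. Along a
set of times of density one the weak gauges tend to zero in mean over `Ω`, hence every sequence of such
times has a subsequence along which almost all fibres tend to zero weakly. -/
theorem IsPointwiseSemigroups.isAlmostWeaklyStable [CompleteSpace X] (hX : IsReflexive X) (hp : p ≠ ∞)
    (hT : IsPointwiseSemigroups S T) (hK : ∀ t, ‖S t‖ ≤ K)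
    (h : ∀ᵐ s ∂μ, IsAlmostWeaklyStable (T s)) : IsAlmostWeaklyStable S := by
  have := hX.separableSpace_strongDual
  have hK0 : 0 ≤ K := (norm_nonneg _).trans (hK 0)
  have hTK : ∀ᵐ s ∂μ, ∀ t, ‖T s t‖ ≤ K := by
    filter_upwards [hT.ae_norm_le hp hK] with s hs t
    exact (T s t).opNorm_le_bound hK0 (hs t)
  have hspec : ∀ᵐ s ∂μ, ∀ z : ℂ, z.re = 0 → z ∉ pointSpectrum (generator (T s)) := by
    filter_upwards [h, hT.isC0Semigroup] with s h1 h2 z hz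
    exact h1.forall_notMem_pointSpectrum h2 hz
  -- a finite measure equivalent to `μ`
  have hac : μ.toFinite ≪ μ := toFinite_absolutelyContinuous μ
  have hac' : μ ≪ μ.toFinite := absolutelyContinuous_toFinite μ
  have hmeas : ∀ t x, AEStronglyMeasurable (fun s => T s t x) μ.toFinite := fun t x =>
    ((hT.multiplication t).measurable x).mono_ac hac
  obtain ⟨M, hM, hlim⟩ := exists_hasDensityOne_tendsto_integral_weakGauge hX hmeas
    (hac.ae_le hT.isC0Semigroup) (hac.ae_le hTK) (hac.ae_le hspec)
  refine ⟨M, hM, ?_⟩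
  rw [ContinuousLinearMapWOT.tendsto_iff_forall_dual_apply_tendsto]
  intro f φ
  simp only [ContinuousLinearMapWOT.ofCLM_apply, ContinuousLinearMapWOT.zero_apply, map_zero]
  induction f using Lp.induction hp with
  | indicatorConst x hA hμA =>
    refine tendsto_of_subseq_tendsto fun r hr => ?_
    obtain ⟨ns, hns, hae⟩ := exists_seq_tendsto_ae_of_tendsto_integral (fun n =>
      Integrable.of_bound (aestronglyMeasurable_weakGauge (hmeas (r n).toNNReal)) 2
        (Eventually.of_forall fun s => norm_weakGauge_le _)) (fun n s => weakGauge_nonneg _)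
      (hlim.comp hr)
    refine ⟨ns, ?_⟩
    rw [Lp.simpleFunc.coe_indicatorConst]
    set f := indicatorConstLp p hA hμA.ne x
    have hSf : ∀ᵐ s ∂μ, ∀ n, S (r n).toNNReal f s = T s (r n).toNNReal (f s) :=
      ae_all_iff.2 fun n => (hT.multiplication _).apply_ae f
    refine tendsto_apply_of_forall_ae_tendsto (C := K * ‖x‖) hp hA hμA.ne (fun n => ?_) (fun n => ?_) ?_ φ
    · filter_upwards [hSf, hTK, indicatorConstLp_coeFn (p := p) (hs := hA) (hμs := hμA.ne) (c := x)]
        with s h1 h2 h3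
      rw [h1]
      refine (T s _).le_of_opNorm_le_of_le (h2 _) ?_
      rw [h3]
      exact norm_indicator_le_norm_self _ _
    · filter_upwards [hSf, indicatorConstLp_coeFn_notMem (p := p) (hs := hA) (hμs := hμA.ne) (c := x)]
        with s h1 h3 hs
      rw [h1, h3 hs, map_zero]
    · filter_upwards [hSf, hTK, hac'.ae_le hae] with s h1 h2 h3 l
      refine (tendsto_apply_of_tendsto_weakGauge (fun n => h2 _) h3 (f s) l).congr fun n => ?_
      rw [h1]
  | add hf hg _ h1 h2 =>
    simpa using h1.add h2
  | isClosed =>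
    refine isClosed_setOf_tendsto_zero (A := fun r : ℝ => φ.comp (S r.toNNReal)) (K := ‖φ‖ * K) fun r => ?_
    exact (φ.opNorm_comp_le _).trans (by gcongr; exact hK _)

end PartOne

section PartTwo

/-- The functional `f ↦ ∫_A x' (f s) dμ` on `L^p(Ω, X)`. -/
theorem exists_dual_setIntegral {A : Set Ω} (hμA : μ A ≠ ∞) (x' : StrongDual ℂ X) :
    ∃ φ : StrongDual ℂ (Lp X p μ), ∀ f, φ f = ∫ s in A, x' (f s) ∂μ := by
  have : IsFiniteMeasure (μ.restrict A) := isFiniteMeasure_restrict.2 hμA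
  have hp1 : 1 ≤ p := Fact.out
  have hmem : ∀ f : Lp X p μ, MemLp f 1 (μ.restrict A) := fun f =>
    ((Lp.memLp f).restrict A).mono_exponent hp1
  have hi : ∀ f : Lp X p μ, Integrable (fun s => x' (f s)) (μ.restrict A) := fun f =>
    x'.integrable_comp (memLp_one_iff_integrable.1 (hmem f))
  let C : ℝ := ((μ.restrict A) univ ^ (1 / (1 : ℝ≥0∞).toReal - 1 / p.toReal)).toReal
  refine ⟨LinearMap.mkContinuous
    { toFun := fun f => ∫ s in A, x' (f s) ∂μ
      map_add' := fun f g => ?_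
      map_smul' := fun c f => ?_ } (‖x'‖ * C) fun f => ?_, fun f => rfl⟩
  · rw [← integral_add (hi f) (hi g)]
    refine integral_congr_ae (ae_restrict_of_ae ?_)
    filter_upwards [Lp.coeFn_add f g] with s hs
    rw [hs, Pi.add_apply, map_add]
  · rw [RingHom.id_apply, ← integral_smul]
    refine integral_congr_ae (ae_restrict_of_ae ?_)
    filter_upwards [Lp.coeFn_smul c f] with s hs
    rw [hs, Pi.smul_apply, map_smul]
  · have h1 : ∫ s in A, ‖f s‖ ∂μ = (eLpNorm f 1 (μ.restrict A)).toReal := by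
      rw [eLpNorm_one_eq_lintegral_enorm, integral_norm_eq_lintegral_enorm (hmem f).1]
    have h2 : (eLpNorm f 1 (μ.restrict A)).toReal ≤ ‖f‖ * C := by
      rw [Lp.norm_def, ← ENNReal.toReal_mul]
      refine ENNReal.toReal_mono (ENNReal.mul_ne_top (Lp.eLpNorm_ne_top f)
        (ENNReal.rpow_ne_top_of_nonneg ?_ (measure_ne_top _ _))) ?_
      · rw [ENNReal.toReal_one, div_one, sub_nonneg, one_div]
        rcases eq_or_ne p ∞ with rfl | hp
        · simp
        · exact inv_le_one_of_one_le₀ (by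
            rw [← ENNReal.toReal_one]; exact ENNReal.toReal_mono hp hp1)
      · refine (eLpNorm_le_eLpNorm_mul_rpow_measure_univ hp1 ((Lp.aestronglyMeasurable f).restrict)).trans ?_
        gcongr
        exact Measure.restrict_le_self
    calc ‖∫ s in A, x' (f s) ∂μ‖ ≤ ∫ s in A, ‖x'‖ * ‖f s‖ ∂μ :=
          norm_integral_le_of_norm_le ((memLp_one_iff_integrable.1 (hmem f)).norm.const_mul _)
            (Eventually.of_forall fun s => x'.le_opNorm _)
      _ = ‖x'‖ * (eLpNorm f 1 (μ.restrict A)).toReal := by rw [integral_const_mul, h1]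
      _ ≤ ‖x'‖ * (‖f‖ * C) := by gcongr
      _ = ‖x'‖ * C * ‖f‖ := by ring

/-- A weakly null sequence of multiplication operators has no matrix coefficient that stays, up to
unimodular factors, close to one on a set of positive measure. -/
theorem measure_setOf_forall_norm_mul_sub_one_le [SigmaFinite μ] {t : ℕ → ℝ≥0}
    (hT : ∀ t, IsMultiplicationOperator (fun s => T s t) (S t))
    (hlim : ∀ (f : Lp X p μ) (φ : StrongDual ℂ (Lp X p μ)), Tendsto (fun n => φ (S (t n) f)) atTop (𝓝 0))
    {e : ℕ → ℂ} (he : ∀ n, ‖e n‖ = 1) (x : X) (x' : StrongDual ℂ X) :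
    μ {s | ∀ n, ‖e n * x' (T s (t n) x) - 1‖ ≤ 1 / 2} = 0 := by
  set B := {s | ∀ n, ‖e n * x' (T s (t n) x) - 1‖ ≤ 1 / 2} with hB
  have hm : ∀ n, AEStronglyMeasurable (fun s => x' (T s (t n) x)) μ := fun n =>
    x'.continuous.comp_aestronglyMeasurable ((hT (t n)).measurable x)
  have hBm : NullMeasurableSet B μ := by
    rw [hB, Set.ofPred_forall]
    refine NullMeasurableSet.iInter fun n => ?_
    exact nullMeasurableSet_le ((((hm n).const_mul (e n)).sub
      aestronglyMeasurable_const).norm.aemeasurable) aemeasurable_const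
  obtain ⟨A, hAB, hA, hAe⟩ := hBm.exists_measurable_subset_ae_eq
  rw [← measure_congr hAe]
  have key : ∀ m, μ (A ∩ spanningSets μ m) = 0 := by
    intro m
    set D := A ∩ spanningSets μ m with hDdef
    have hD : MeasurableSet D := hA.inter (measurableSet_spanningSets μ m)
    have hμD : μ D ≠ ∞ := measure_ne_top_of_subset inter_subset_right
      (measure_spanningSets_lt_top μ m).ne
    obtain ⟨φ, hφ⟩ := exists_dual_setIntegral (p := p) hμD x'
    have h1 := hlim (indicatorConstLp p hD hμD x) φ
    have h2 : ∀ n, φ (S (t n) (indicatorConstLp p hD hμD x)) = ∫ s in D, x' (T s (t n) x) ∂μ := by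
      intro n
      rw [hφ]
      refine setIntegral_congr_ae hD ?_
      filter_upwards [(hT (t n)).apply_ae (indicatorConstLp p hD hμD x),
        indicatorConstLp_coeFn (p := p) (hs := hD) (hμs := hμD) (c := x)] with s h3 h4 hs
      rw [h3, h4, indicator_of_mem hs]
    have hDle : ∀ n, μ.real D ≤ 1 / 2 * μ.real D + ‖φ (S (t n) (indicatorConstLp p hD hμD x))‖ := by
      intro n
      have h3 : ‖∫ s in D, (e n * x' (T s (t n) x) - 1) ∂μ‖ ≤ 1 / 2 * μ.real D :=
        norm_setIntegral_le_of_norm_le_const hμD.lt_top fun s hs => hAB hs.1 n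
      have hint : IntegrableOn (fun s => e n * x' (T s (t n) x) - 1) D μ := by
        refine Measure.integrableOn_of_bounded hμD (((hm n).const_mul (e n)).sub
          aestronglyMeasurable_const) (M := 1 / 2) ?_
        filter_upwards [ae_restrict_mem hD] with s hs using hAB hs.1 n
      have h4 : ∫ s in D, e n * x' (T s (t n) x) ∂μ =
          (∫ s in D, (e n * x' (T s (t n) x) - 1) ∂μ) + μ.real D := by
        have h5 : (μ.real D : ℂ) = ∫ _ in D, (1 : ℂ) ∂μ := by
          rw [setIntegral_const]; simp
        rw [h5, ← integral_add hint (integrableOn_const hμD)]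
        simp
      have h6 : (μ.real D : ℂ) = e n * φ (S (t n) (indicatorConstLp p hD hμD x)) -
          ∫ s in D, (e n * x' (T s (t n) x) - 1) ∂μ := by
        rw [h2, ← integral_const_mul, h4]; ring
      calc μ.real D = ‖(μ.real D : ℂ)‖ := by
            rw [Complex.norm_real, Real.norm_of_nonneg measureReal_nonneg]
        _ ≤ ‖e n * φ (S (t n) (indicatorConstLp p hD hμD x))‖ +
            ‖∫ s in D, (e n * x' (T s (t n) x) - 1) ∂μ‖ := by
            rw [h6]; exact norm_sub_le _ _
        _ ≤ _ := by rw [norm_mul, he, one_mul]; linarith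
    have h7 : μ.real D ≤ 1 / 2 * μ.real D + ‖(0 : ℂ)‖ :=
      ge_of_tendsto' (h1.norm.const_add _) hDle
    rw [norm_zero] at h7
    have h8 : μ.real D = 0 := le_antisymm (by linarith) measureReal_nonneg
    exact (measureReal_eq_zero_iff hμD).1 h8
  have h9 : A = ⋃ m, A ∩ spanningSets μ m := by
    rw [← inter_iUnion, iUnion_spanningSets, inter_univ]
  rw [h9, measure_iUnion_null_iff]
  exact key

/-- If `z` is an eigenvalue of the generator of `T s`, then some coefficient `x' (T s t x)` with `x`, `x'` in
countable dense sets stays close to `exp (z t)`; by weak convergence this happens only on a null set. -/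
theorem IsPointwiseSemigroups.measure_setOf_mem_pointSpectrum [SigmaFinite μ]
    [TopologicalSpace.SeparableSpace X] (hX : IsReflexive X) (hp : p ≠ ∞)
    (hT : IsPointwiseSemigroups S T) (hK : ∀ t, ‖S t‖ ≤ K) (h : IsAlmostWeaklyStable S) {z : ℂ}
    (hz : z.re = 0) : μ {s | z ∈ pointSpectrum (generator (T s))} = 0 := by
  have := hX.separableSpace_strongDual
  obtain ⟨M, hM, hlim⟩ := h
  have := hM.neBot
  obtain ⟨r, hr⟩ := exists_seq_tendsto (atTop ⊓ 𝓟 M : Filter ℝ)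
  let t : ℕ → ℝ≥0 := fun n => (r n).toNNReal
  have hweak : ∀ (f : Lp X p μ) (φ : StrongDual ℂ (Lp X p μ)),
      Tendsto (fun n => φ (S (t n) f)) atTop (𝓝 0) := by
    intro f φ
    have := ContinuousLinearMapWOT.tendsto_iff_forall_dual_apply_tendsto.1 hlim f φ
    simpa [Function.comp_def] using this.comp hr
  let e : ℕ → ℂ := fun n => Complex.exp (-(z * (t n : ℝ)))
  have he : ∀ n, ‖e n‖ = 1 := fun n => by simp [e, Complex.norm_exp, hz]
  have hnull : ∀ᵐ s ∂μ, ∀ k j, ¬ ∀ n, ‖e n * TopologicalSpace.denseSeq (StrongDual ℂ X) j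
      (T s (t n) (TopologicalSpace.denseSeq X k)) - 1‖ ≤ 1 / 2 := by
    refine ae_all_iff.2 fun k => ae_all_iff.2 fun j => ?_
    rw [ae_iff]
    simp only [not_not]
    exact measure_setOf_forall_norm_mul_sub_one_le hT.multiplication hweak he _ _
  have hmain : ∀ᵐ s ∂μ, z ∉ pointSpectrum (generator (T s)) := by
    filter_upwards [hnull, hT.isC0Semigroup, hT.ae_norm_le hp hK] with s h1 h2 h3 hmem
    obtain ⟨y, hy0, hy⟩ := (mem_pointSpectrum_generator_iff h2).1 hmem
    obtain ⟨x', hx'⟩ := SeparatingDual.exists_ne_zero (R := ℂ) hy0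
    obtain ⟨j, hj⟩ := (TopologicalSpace.denseRange_denseSeq (StrongDual ℂ X)).exists_mem_open
      (isOpen_ne_fun (f := fun x' : StrongDual ℂ X => x' y) (g := fun _ => 0)
        (ContinuousLinearMap.apply ℂ ℂ y).continuous continuous_const) ⟨x', hx'⟩
    set d := TopologicalSpace.denseSeq (StrongDual ℂ X) j
    have hj' : d y ≠ 0 := hj
    -- normalize the eigenvector so that `d y' = 1`
    set y' := (d y)⁻¹ • y with hy'
    have hdy : d y' = 1 := by rw [hy', map_smul, smul_eq_mul, inv_mul_cancel₀ hj']
    have hK1 : (0 : ℝ) < ‖d‖ * |K| + 1 := by positivity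
    obtain ⟨k, hk⟩ := (TopologicalSpace.denseRange_denseSeq X).exists_dist_lt y'
      (ε := 1 / 2 / (‖d‖ * |K| + 1)) (by positivity)
    refine h1 k j fun n => ?_
    set x := TopologicalSpace.denseSeq X k
    have hTy : e n * d (T s (t n) y') = 1 := by
      rw [hy', map_smul, hy, smul_comm, ← hy', map_smul, hdy, smul_eq_mul, mul_one, ← Complex.exp_add]
      simp
    have h4 : e n * d (T s (t n) x) - 1 = e n * d (T s (t n) (x - y')) := by
      rw [map_sub, map_sub, mul_sub, hTy]
    rw [h4, norm_mul, he, one_mul]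
    rw [dist_comm, dist_eq_norm, lt_div_iff₀ hK1] at hk
    calc ‖d (T s (t n) (x - y'))‖ ≤ ‖d‖ * (K * ‖x - y'‖) := d.le_opNorm_of_le (h3 _ _)
      _ ≤ ‖d‖ * (|K| * ‖x - y'‖) := by
          gcongr
          exact le_abs_self K
      _ ≤ ‖x - y'‖ * (‖d‖ * |K| + 1) := by nlinarith [norm_nonneg (x - y')]
      _ ≤ 1 / 2 := hk.le
  rw [ae_iff] at hmain
  simpa only [not_not] using hmain

end PartTwo

theorem IsPointwiseSemigroups.measure_iUnion_eq_zero_iff [SigmaFinite μ] [CompleteSpace X]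
    [TopologicalSpace.SeparableSpace X] (hX : IsReflexive X) (hp : p ≠ ∞)
    (hT : IsPointwiseSemigroups S T) (hK : ∀ t, ‖S t‖ ≤ K) :
    μ (⋃ z ∈ {z : ℂ | z.re = 0}, {s | z ∈ pointSpectrum (generator (T s))}) = 0 ↔
      ∀ᵐ s ∂μ, IsAlmostWeaklyStable (T s) := by
  have hK0 : 0 ≤ K := (norm_nonneg _).trans (hK 0)
  have h1 : ∀ᵐ s ∂μ, IsAlmostWeaklyStable (T s) ↔
      ∀ z : ℂ, z.re = 0 → z ∉ pointSpectrum (generator (T s)) := by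
    filter_upwards [hT.isC0Semigroup, hT.ae_norm_le hp hK] with s h2 h3
    exact isAlmostWeaklyStable_iff_forall_notMem_pointSpectrum hX h2 fun t =>
      (T s t).opNorm_le_bound hK0 (h3 t)
  rw [eventually_congr h1, ae_iff]
  congr! 2
  ext s
  simp

end Main

end MulSemigroup

theorem mainTheorem1 {Ω : Type*} [MeasurableSpace Ω] (μ : Measure Ω) [SigmaFinite μ]
    [MeasureTheory.IsSeparable μ]
    {X : Type*} [NormedAddCommGroup X] [NormedSpace ℂ X] [CompleteSpace X]
    [TopologicalSpace.SeparableSpace X] (hX : MulSemigroup.IsReflexive X)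
    (p : ℝ≥0∞) [Fact (1 ≤ p)] (hp1 : 1 < p) (hp : p < ∞)
    (S : ℝ≥0 → Lp X p μ →L[ℂ] Lp X p μ)
    (hS : MulSemigroup.IsMultiplicationSemigroup S)
    (hbdd : ∃ K : ℝ, ∀ t, ‖S t‖ ≤ K) :
    (∃ T : Ω → ℝ≥0 → X →L[ℂ] X, MulSemigroup.IsPointwiseSemigroups S T) ∧
    ∀ T : Ω → ℝ≥0 → X →L[ℂ] X, MulSemigroup.IsPointwiseSemigroups S T →
      ((∀ᵐ s ∂μ, MulSemigroup.IsAlmostWeaklyStable (T s)) →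
        MulSemigroup.IsAlmostWeaklyStable S) ∧
      (MulSemigroup.IsAlmostWeaklyStable S →
        ∀ z : ℂ, z.re = 0 →
          μ {s | z ∈ MulSemigroup.pointSpectrum (MulSemigroup.generator (T s))} = 0) ∧
      (μ (⋃ z ∈ {z : ℂ | z.re = 0},
          {s | z ∈ MulSemigroup.pointSpectrum (MulSemigroup.generator (T s))}) = 0 ↔
        ∀ᵐ s ∂μ, MulSemigroup.IsAlmostWeaklyStable (T s)) := by
  obtain ⟨K, hK⟩ := hbdd
  exact ⟨hS.exists_isPointwiseSemigroups hp.ne hK, fun T hT =>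
    ⟨hT.isAlmostWeaklyStable hX hp.ne hK, fun h z hz =>
      hT.measure_setOf_mem_pointSpectrum hX hp.ne hK h hz,
      hT.measure_iUnion_eq_zero_iff hX hp.ne hK⟩⟩
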